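/- Let $T>0$, let $u_0\in H^1(\mathbb R)\cap L^\infty(\mathbb R)$ with $u_0\ge 0$ a.e. (the initial density), and let $h:[0,T]\times\mathbb R\times\mathbb R\to\mathbb R$, $(t,x,z)\mapsto h(t,x,z)$, satisfy, for some constants $c_h,c_0,C_0,M_\infty$: (i) for every $(t,x)$ the map $z\mapsto h(t,x,z)$ is strictly increasing and continuous with $\lim_{z\to\pm\infty}h(t,x,z)=\pm\infty$; its inverse is denoted $v\mapsto h^{-1}(t,x,v)$; (ii) $h$ is globally Lipschitz in $(t,x,z)$, and all its partial derivatives of first and second order exist and are uniformly bounded; (iii) $\partial_z h$ is continuous and $\partial_z h\ge c_h>0$ everywhere; (iv) $0<c_0\le h^{-1}(t,x,0)\le C_0<\infty$ for all $(t,x)$; (v) $M_\infty\ge\|u_0\|_{L^\infty}$ and $c_0^2>2C_0M_\infty/c_h$. Then the singular Fokker–Planck equation $$\partial_t u=\tfrac12\,\partial_{xx}\Big[\big(h^{-1}(t,x,u)\big)^2u\Big]\ \text{ on }[0,T]\times\mathbb R,\qquad u(0,\cdot)=u_0,$$ has at most one weak solution in the class $L^\infty([0,T];H^1(\mathbb R)\cap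 L^\infty(\mathbb R))\cap L^2([0,T];H^2(\mathbb R))$: any two weak solutions $u_1,u_2$ in this class satisfy $u_1=u_2$ a.e. on $[0,T]\times\mathbb R$. Here $u$ in this class is a weak solution if for all $\varphi\in C_c^\infty([0,T)\times\mathbb R)$ $$-\int_0^T\!\!\int_{\mathbb R}u\,\partial_t\varphi\,dx\,dt-\int_{\mathbb R}u_0\,\varphi(0,\cdot)\,dx=\frac12\int_0^T\!\!\int_{\mathbb R}\big(h^{-1}(t,x,u)\big)^2u\,\partial_{xx}\varphi\,dx\,dt .$$ -/

import Mathlib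

open MeasureTheory Set Filter Topology
open scoped ENNReal NNReal ContDiff

/-- `g` is the weak (distributional) derivative of `f` on the real line. -/
def HasWeakDeriv (f g : ℝ → ℝ) : Prop :=
  LocallyIntegrable f volume ∧ LocallyIntegrable g volume ∧
    ∀ φ : ℝ → ℝ, ContDiff ℝ ∞ φ → HasCompactSupport φ →
      ∫ x, f x * deriv φ x = -∫ x, g x * φ x

/-- `f ∈ H¹(ℝ)`. -/
def MemH1 (f : ℝ → ℝ) : Prop :=
  MemLp f 2 volume ∧ ∃ g : ℝ → ℝ, MemLp g 2 volume ∧ HasWeakDeriv f g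

/-- Lebesgue measure on the space-time strip `[0,T] × ℝ`. -/
noncomputable def stripMeasure (T : ℝ) : Measure (ℝ × ℝ) :=
  (volume.restrict (Icc 0 T)).prod volume

/-- `u ∈ L^∞([0,T]; H¹(ℝ) ∩ L^∞(ℝ)) ∩ L²([0,T]; H²(ℝ))`; here `ux` and `uxx` are the first and
second weak derivatives of `u` in the space variable. -/
def MemSolutionClass (T : ℝ) (u : ℝ → ℝ → ℝ) : Prop :=
  ∃ ux uxx : ℝ → ℝ → ℝ,
    (∀ᵐ t ∂(volume.restrict (Icc 0 T)),
      HasWeakDeriv (u t) (ux t) ∧ HasWeakDeriv (ux t) (uxx t)) ∧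
    (∃ C : ℝ≥0, ∀ᵐ t ∂(volume.restrict (Icc 0 T)),
      eLpNorm (u t) 2 volume ≤ C ∧ eLpNorm (ux t) 2 volume ≤ C ∧
        eLpNorm (u t) ∞ volume ≤ C) ∧
    MemLp (Function.uncurry u) 2 (stripMeasure T) ∧
    MemLp (Function.uncurry ux) 2 (stripMeasure T) ∧
    MemLp (Function.uncurry uxx) 2 (stripMeasure T)

/-- On `[0,T] × ℝ × ℝ` the function `f(t,x,z)` has the partial derivatives `ft`, `fx`, `fz`
(one-sided in `t` at the end points of `[0,T]`), and these are uniformly bounded. -/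
def HasBoundedPartials (T : ℝ) (f ft fx fz : ℝ → ℝ → ℝ → ℝ) : Prop :=
  ∃ C : ℝ, ∀ t ∈ Icc 0 T, ∀ x z : ℝ,
    HasDerivWithinAt (fun s => f s x z) (ft t x z) (Icc 0 T) t ∧
    HasDerivAt (fun y => f t y z) (fx t x z) x ∧
    HasDerivAt (fun w => f t x w) (fz t x z) z ∧
    |ft t x z| ≤ C ∧ |fx t x z| ≤ C ∧ |fz t x z| ≤ C

/-- The inverse `h⁻¹(t,x,v)` of `h(t,x,z)` with respect to the third argument: the solution `z` of
`h(t,x,z) = v`. -/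
noncomputable def driverInv (h : ℝ → ℝ → ℝ → ℝ) (t x v : ℝ) : ℝ :=
  Function.invFun (h t x) v

/-- The assumptions on the driver `h : [0,T] × ℝ × ℝ → ℝ` and its parameters, relative to the
initial density `u₀`. -/
structure DriverAssumptions (T : ℝ) (h : ℝ → ℝ → ℝ → ℝ) (u₀ : ℝ → ℝ)
    (c_h c₀ C₀ M : ℝ) : Prop where
  /-- Monotonicity. -/
  strictMono : ∀ t ∈ Icc 0 T, ∀ x, StrictMono (h t x)
  continuous : ∀ t ∈ Icc 0 T, ∀ x, Continuous (h t x)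
  tendsto_atTop : ∀ t ∈ Icc 0 T, ∀ x, Tendsto (h t x) atTop atTop
  tendsto_atBot : ∀ t ∈ Icc 0 T, ∀ x, Tendsto (h t x) atBot atBot
  /-- Regularity: global Lipschitz continuity. -/
  lipschitz : ∃ L : ℝ, ∀ t ∈ Icc 0 T, ∀ s ∈ Icc 0 T, ∀ x y z w : ℝ,
    |h t x z - h s y w| ≤ L * (|t - s| + |x - y| + |z - w|)
  /-- Regularity: all partial derivatives of order one and two exist and are bounded. -/
  partials : ∃ ht hx hz : ℝ → ℝ → ℝ → ℝ, HasBoundedPartials T h ht hx hz ∧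
    (∃ a b c, HasBoundedPartials T ht a b c) ∧
    (∃ a b c, HasBoundedPartials T hx a b c) ∧
    (∃ a b c, HasBoundedPartials T hz a b c)
  /-- Non-degeneracy. -/
  continuousOn_deriv : ContinuousOn
    (fun p : ℝ × ℝ × ℝ => deriv (fun z => h p.1 p.2.1 z) p.2.2) (Icc 0 T ×ˢ univ)
  c_h_pos : 0 < c_h
  le_deriv : ∀ t ∈ Icc 0 T, ∀ x z, c_h ≤ deriv (fun w => h t x w) z
  /-- Basal volatility. -/
  c₀_pos : 0 < c₀
  basal : ∀ t ∈ Icc 0 T, ∀ x, c₀ ≤ driverInv h t x 0 ∧ driverInv h t x 0 ≤ C₀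
  /-- Stability condition. -/
  sup_le : (eLpNorm u₀ ∞ volume).toReal ≤ M
  stability : 2 * C₀ * M / c_h < c₀ ^ 2

/-- `u` is a weak solution, in the class `L^∞(H¹ ∩ L^∞) ∩ L²(H²)`, of
`∂ₜ u = ½ ∂ₓₓ [(h⁻¹(t,x,u))² u]` on `[0,T] × ℝ` with `u(0,·) = u₀`. The test functions are the
elements of `C_c^∞([0,T) × ℝ)`, given through smooth extensions to negative times. -/
def IsWeakSolution (T : ℝ) (h : ℝ → ℝ → ℝ → ℝ) (u₀ : ℝ → ℝ) (u : ℝ → ℝ → ℝ) : Prop :=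
  MemSolutionClass T u ∧
    ∀ φ : ℝ → ℝ → ℝ, ContDiff ℝ ∞ (Function.uncurry φ) →
      HasCompactSupport (Function.uncurry φ) →
      tsupport (Function.uncurry φ) ⊆ Iio T ×ˢ univ →
      -(∫ t in Icc 0 T, ∫ x, u t x * deriv (fun s => φ s x) t) - ∫ x, u₀ x * φ 0 x =
        1 / 2 * ∫ t in Icc 0 T, ∫ x,
          driverInv h t x (u t x) ^ 2 * u t x * iteratedDeriv 2 (φ t) x

/-!
The equation reads `∂ₜ u = ½ ∂ₓₓ A(t,x,u)` with the flux `A(t,x,v) = h⁻¹(t,x,v)² v`. If the values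
of `u` are nonnegative, then `A` is strongly monotone in `v`, because `h⁻¹ ≥ c₀` there and `h⁻¹`
increases in `v`. For negative `v` this fails in general, so the first step is to show that every
weak solution is nonnegative; the second is uniqueness among nonnegative solutions.

Both steps use finite differences instead of derivatives. Averaging a solution against the hat
function of width `r` turns the Laplacian into an exact second difference with step `r`, so that
the hat average `U` of `u` satisfies, pointwise almost everywhere,
`U(t,x) = U(0,x) + (2r²)⁻¹ ∫₀ᵗ (p(s,x+r) - 2 p(s,x) + p(s,x-r)) ds` with `p = A(·,·,u)`
(`hatAvg_evolution`). This identity is absolutely continuous in time for each `x` and needs no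
derivative of `p`. The regularity `u ∈ L^∞(H¹ ∩ L^∞) ∩ L²(H²)` enters only through bounds for
first and second differences of `u` (`MemSolutionClass.exists_stripRegular`); in particular `U - u`
is `O(r)` in `L²`, the increments of `U` and `u` over distance `r` differ by `O(r²)` in `L²`, and
`U - u` is uniformly `O(√r)`.

*Positivity* (`ae_nonneg_of_evolution`). Let `κ(v) = max(-δ, min(v, 0))` and let `Φ` be its
primitive, a convex function that vanishes exactly on `[0,∞)`. In the time derivative of
`∫ Φ(U) dx`, a summation by parts in space leaves the products of the increments of `κ(U)` and of
`p` over distance `r`. Since `κ` is constant on `(-∞,-δ]`, such a product vanishes for small `r`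
unless `u` exceeds `-2δ` at both points, and there `A` is still strongly monotone if
`δ = c₀ c_h / 16`, since `h⁻¹` has slope at most `1 / c_h` in `v`.
The monotone part of the increment of `p` has the good sign; the part that comes from the explicit
dependence of `A` on `x` is at most a constant times `r |u|`, and Young's inequality bounds its
contribution by `r² Φ(U)` and errors of order `r³` (`energy_pointwise`). The weight
`exp(-l t)` absorbs `Φ(U)`, so the weighted integral of `Φ(U)` is `O(r)`
(`weighted_energy_hatAvg_le`), and `r → 0` gives `Φ(u) = 0`.

*Uniqueness* (`ae_eq_of_evolution`). For two nonnegative solutions let `w = u₁ - u₂` and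
`g = A(·,·,u₁) - A(·,·,u₂)`. The integral of `g` times the hat average of `w` is
`(2r²)⁻¹` times that of `g(t,x)` times the second difference of `∫₀ᵗ g(s,·) ds`, hence
`-(4r²)⁻¹ ∫ (∫₀ᵀ (g(t,x+r) - g(t,x)) dt)² dx ≤ 0`
(`integral_mul_secondDiff_primitive_nonpos`). For `r → 0` it follows that `∫∫ g w ≤ 0`, while
`g w ≥ (c₀² / 8) w²`.

The required bounds for the flux are derived from the assumptions on the driver in
`DriverAssumptions.fluxBounds_driverFlux`.
-/

/-! ### Averages over translations -/

theorem lintegral_enorm_sq_eq {α : Type*} [MeasurableSpace α] {ν : Measure α} (f : α → ℝ) :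
    ∫⁻ x, ‖f x‖ₑ ^ 2 ∂ν = eLpNorm f 2 ν ^ 2 := by
  rw [eLpNorm_eq_lintegral_rpow_enorm_toReal (by norm_num) (by norm_num), ← ENNReal.rpow_natCast,
    ← ENNReal.rpow_mul]
  simp

/-- The Cauchy-Schwarz inequality for the integral of a function, valid without integrability
because a non-integrable function has integral `0`. -/
theorem enorm_integral_sq_le_mul {Ω : Type*} [MeasurableSpace Ω] {ν : Measure Ω}
    {f : Ω → ℝ} (hf : AEStronglyMeasurable f ν) :
    ‖∫ w, f w ∂ν‖ₑ ^ 2 ≤ ν univ * ∫⁻ w, ‖f w‖ₑ ^ 2 ∂ν := by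
  have h1 : ‖∫ w, f w ∂ν‖ₑ ≤ eLpNorm f 2 ν * ν univ ^ ((1 : ℝ) / 2) := by
    refine (enorm_integral_le_lintegral_enorm f).trans
      ((eLpNorm_one_eq_lintegral_enorm (f := f) (μ := ν)).symm.le.trans ?_)
    have := eLpNorm_le_eLpNorm_mul_rpow_measure_univ (p := 1) (q := 2) (by norm_num) hf
    refine this.trans (le_of_eq ?_)
    norm_num
  refine (pow_le_pow_left₀ (by simp) h1 2).trans ?_
  rw [mul_pow, lintegral_enorm_sq_eq, mul_comm, ← ENNReal.rpow_natCast (ν univ ^ _),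
    ← ENNReal.rpow_mul]
  simp

theorem enorm_integral_sq_le {Ω : Type*} [MeasurableSpace Ω] {ν : Measure Ω}
    [IsProbabilityMeasure ν] {f : Ω → ℝ} (hf : AEStronglyMeasurable f ν) :
    ‖∫ θ, f θ ∂ν‖ₑ ^ 2 ≤ ∫⁻ θ, ‖f θ‖ₑ ^ 2 ∂ν := by
  simpa using enorm_integral_sq_le_mul hf

/-- The shear `(θ, x) ↦ (θ, x + s θ)` preserves `ν ⊗ dx`. -/
theorem measurePreserving_shear {Ω : Type*} [MeasurableSpace Ω] (ν : Measure Ω) [SFinite ν]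
    {s : Ω → ℝ} (hs : Measurable s) :
    MeasurePreserving (fun q : Ω × ℝ => (q.1, q.2 + s q.1)) (ν.prod volume)
      (ν.prod volume) := by
  refine (MeasurePreserving.id ν).skew_product (g := fun θ x => x + s θ) ?_ ?_
  · exact measurable_snd.add (hs.comp measurable_fst)
  · exact ae_of_all _ fun θ => (measurePreserving_add_right volume (s θ)).map_eq

/-- Averaging over translations is, up to reflection, self-adjoint. -/
theorem integral_average_translate_mul {Ω : Type*} [MeasurableSpace Ω] (ν : Measure Ω)
    [IsFiniteMeasure ν] {s : Ω → ℝ} (hs : Measurable s) {B : ℝ} (hB : ∀ᵐ θ ∂ν, |s θ| ≤ B)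
    {f : ℝ → ℝ} (hf : LocallyIntegrable f volume) {ψ : ℝ → ℝ} (hψ : Continuous ψ)
    (hψc : HasCompactSupport ψ) :
    ∫ x, (∫ θ, f (x + s θ) ∂ν) * ψ x = ∫ x, f x * ∫ θ, ψ (x - s θ) ∂ν := by
  have hint : Integrable (fun q : Ω × ℝ => f q.2 * ψ (q.2 - s q.1)) (ν.prod volume) := by
    obtain ⟨C, hC⟩ := hψ.bounded_above_of_compact_support hψc
    obtain ⟨r, hr⟩ := hψc.isCompact.isBounded.subset_closedBall (0 : ℝ)
    have hg : Integrable (fun x => (Metric.closedBall (0 : ℝ) (r + B)).indicator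
        (fun x => ‖f x‖ * C) x) volume :=
      IntegrableOn.integrable_indicator
        ((hf.integrableOn_isCompact (isCompact_closedBall 0 (r + B))).norm.mul_const C)
        Metric.isClosed_closedBall.measurableSet
    refine Integrable.mono' (hg.comp_snd ν) ?_ ?_
    · refine AEStronglyMeasurable.mul hf.aestronglyMeasurable.comp_snd ?_
      exact (hψ.measurable.comp
        (measurable_snd.sub (hs.comp measurable_fst))).aestronglyMeasurable
    · have h1 : ∀ᵐ q ∂(ν.prod (volume : Measure ℝ)), |s q.1| ≤ B :=
        Measure.quasiMeasurePreserving_fst.ae hB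
      filter_upwards [h1] with q hq
      rw [norm_mul]
      by_cases hx : q.2 ∈ Metric.closedBall (0 : ℝ) (r + B)
      · rw [indicator_of_mem hx]
        exact mul_le_mul_of_nonneg_left (hC _) (norm_nonneg _)
      · have : ψ (q.2 - s q.1) = 0 := by
          apply image_eq_zero_of_notMem_tsupport
          intro hmem
          apply hx
          have := hr hmem
          simp only [Metric.mem_closedBall, dist_zero_right, Real.norm_eq_abs] at this ⊢
          have h2 := abs_add_le (q.2 - s q.1) (s q.1)
          rw [sub_add_cancel] at h2
          linarith
        rw [this, indicator_of_notMem hx]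
        simp
  have hint2 : Integrable (fun q : Ω × ℝ => f (q.2 + s q.1) * ψ q.2) (ν.prod volume) := by
    have := ((measurePreserving_shear ν hs).integrable_comp hint.aestronglyMeasurable).2 hint
    simpa [Function.comp_def] using this
  calc ∫ x, (∫ θ, f (x + s θ) ∂ν) * ψ x
      = ∫ x : ℝ, ∫ θ, f (x + s θ) * ψ x ∂ν := by simp_rw [integral_mul_const]
    _ = ∫ θ, (∫ x : ℝ, f (x + s θ) * ψ x) ∂ν :=
        (integral_integral_swap (f := fun θ (x : ℝ) => f (x + s θ) * ψ x) hint2).symm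
    _ = ∫ θ, (∫ x : ℝ, f x * ψ (x - s θ)) ∂ν := by
        congr 1 with θ
        rw [← integral_add_right_eq_self (fun x : ℝ => f x * ψ (x - s θ)) (s θ)]
        simp
    _ = ∫ x : ℝ, ∫ θ, f x * ψ (x - s θ) ∂ν :=
        integral_integral_swap (f := fun θ (x : ℝ) => f x * ψ (x - s θ)) hint
    _ = _ := by simp_rw [integral_const_mul]

/-- Averaging over translations is a contraction of `L²(ℝ)`. -/
theorem lintegral_enorm_average_translate_sq_le {Ω : Type*} [MeasurableSpace Ω] (ν : Measure Ω)
    [IsProbabilityMeasure ν] {s : Ω → ℝ} (hs : Measurable s) {f : ℝ → ℝ}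
    (hf : AEStronglyMeasurable f volume) :
    AEStronglyMeasurable (fun x => ∫ θ, f (x + s θ) ∂ν) volume ∧
      (∀ᵐ x, ‖∫ θ, f (x + s θ) ∂ν‖ₑ ^ 2 ≤ ∫⁻ θ, ‖f (x + s θ)‖ₑ ^ 2 ∂ν) ∧
      ∫⁻ x, ‖∫ θ, f (x + s θ) ∂ν‖ₑ ^ 2 ≤ ∫⁻ x, ‖f x‖ₑ ^ 2 := by
  have hmeas : AEStronglyMeasurable (fun q : Ω × ℝ => f (q.2 + s q.1)) (ν.prod volume) :=
    (hf.comp_snd (μ := ν)).comp_measurePreserving (measurePreserving_shear ν hs)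
  have hmeas' : AEStronglyMeasurable (fun q : ℝ × Ω => f (q.1 + s q.2)) (volume.prod ν) :=
    hmeas.prod_swap
  have hJ : ∀ᵐ x, ‖∫ θ, f (x + s θ) ∂ν‖ₑ ^ 2 ≤ ∫⁻ θ, ‖f (x + s θ)‖ₑ ^ 2 ∂ν := by
    filter_upwards [hmeas'.prodMk_left] with x hx
    exact enorm_integral_sq_le hx
  refine ⟨hmeas'.integral_prod_right', hJ, (lintegral_mono_ae hJ).trans ?_⟩
  rw [lintegral_lintegral_swap (hmeas'.enorm.pow_const 2)]
  refine (lintegral_mono fun θ => (lintegral_add_right_eq_self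
    (fun x : ℝ => ‖f x‖ₑ ^ 2) (s θ)).le).trans ?_
  simp

/-! ### Difference quotients of weakly differentiable functions -/

/-- The uniform distribution on `[0,1]`. -/
noncomputable abbrev unitMeasure : Measure ℝ := volume.restrict (Icc (0 : ℝ) 1)

instance : IsProbabilityMeasure unitMeasure := ⟨by simp⟩

theorem locallyIntegrable_comp_add_right {f : ℝ → ℝ} (hf : LocallyIntegrable f volume) (a : ℝ) :
    LocallyIntegrable (fun x => f (x + a)) volume := by
  rw [locallyIntegrable_iff] at hf ⊢
  intro K hK
  have h := hf (k := (fun x => x + a) '' K) (hK.image (continuous_id.add continuous_const))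
  have := ((measurePreserving_add_right (volume : Measure ℝ) a).integrableOn_comp_preimage
    (f := f) (s := (fun x => x + a) '' K) (measurableEmbedding_addRight a)).2 h
  rwa [preimage_image_eq _ (add_left_injective a)] at this

/-- A primitive of a smooth function is smooth. -/
theorem contDiff_primitive {ψ : ℝ → ℝ} (hψ : ContDiff ℝ ∞ ψ) :
    ContDiff ℝ ∞ (fun x => ∫ y in (0 : ℝ)..x, ψ y) ∧
      ∀ x, HasDerivAt (fun x => ∫ y in (0 : ℝ)..x, ψ y) (ψ x) x := by
  have hd : ∀ x, HasDerivAt (fun x => ∫ y in (0 : ℝ)..x, ψ y) (ψ x) x := fun x =>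
    hψ.continuous.integral_hasStrictDerivAt 0 x |>.hasDerivAt
  refine ⟨?_, hd⟩
  rw [contDiff_infty_iff_deriv]
  refine ⟨fun x => (hd x).differentiableAt, ?_⟩
  rw [show deriv (fun x => ∫ y in (0 : ℝ)..x, ψ y) = ψ from funext fun x => (hd x).deriv]
  exact hψ

/-- `∫_{x-a}^x ψ`, written as an average over translations. -/
theorem average_eq_primitive_sub {ψ : ℝ → ℝ} (hψ : Continuous ψ) (a x : ℝ) :
    a * ∫ r, ψ (x - r * a) ∂unitMeasure =
      (∫ y in (0 : ℝ)..x, ψ y) - ∫ y in (0 : ℝ)..(x - a), ψ y := by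
  rw [integral_Icc_eq_integral_Ioc, ← intervalIntegral.integral_of_le zero_le_one]
  simp_rw [mul_comm _ a]
  rw [intervalIntegral.mul_integral_comp_sub_mul,
    intervalIntegral.integral_interval_sub_left (hψ.intervalIntegrable _ _)
      (hψ.intervalIntegrable _ _)]
  simp

/-- Outside a compact set `x` and `x - a` lie on the same side of the support of `ψ`. -/
theorem hasCompactSupport_primitive_sub {ψ : ℝ → ℝ}
    (hψc : HasCompactSupport ψ) (a : ℝ) :
    HasCompactSupport fun x => a * ∫ r, ψ (x - r * a) ∂unitMeasure := by
  obtain ⟨R, hR⟩ := hψc.isCompact.isBounded.subset_closedBall (0 : ℝ)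
  refine HasCompactSupport.intro (isCompact_closedBall (0 : ℝ) (R + |a|)) fun x hx => ?_
  have : ∀ᵐ r ∂unitMeasure, ψ (x - r * a) = 0 := by
    refine (ae_restrict_iff' measurableSet_Icc).2 (ae_of_all _ fun r hr => ?_)
    apply image_eq_zero_of_notMem_tsupport
    intro hmem
    apply hx
    have h1 := hR hmem
    simp only [Metric.mem_closedBall, dist_zero_right, Real.norm_eq_abs] at h1 ⊢
    have h2 := abs_add_le (x - r * a) (r * a)
    rw [sub_add_cancel, abs_mul, abs_of_nonneg hr.1] at h2
    nlinarith [hr.2, abs_nonneg a]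
  rw [integral_congr_ae this]
  simp

/-- The fundamental theorem of calculus for weak derivatives, for a fixed increment `a`. -/
theorem HasWeakDeriv.translate_sub_ae {f g : ℝ → ℝ} (hfg : HasWeakDeriv f g)
    (hg2 : MemLp g 2 volume) (a : ℝ) :
    ∀ᵐ x, f (x + a) - f x = a * ∫ r, g (x + r * a) ∂unitMeasure := by
  obtain ⟨hf, hg, hw⟩ := hfg
  have hs : Measurable fun r : ℝ => r * a := measurable_id.mul_const a
  have hG := lintegral_enorm_average_translate_sq_le unitMeasure hs hg.aestronglyMeasurable
  have hG2 : MemLp (fun x => ∫ r, g (x + r * a) ∂unitMeasure) 2 volume := by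
    refine ⟨hG.1, ?_⟩
    have h1 := hG.2.2
    rw [lintegral_enorm_sq_eq, lintegral_enorm_sq_eq] at h1
    have h2 := h1.trans_lt (ENNReal.pow_lt_top hg2.2)
    exact (ENNReal.pow_lt_top_iff.1 h2).resolve_right (by norm_num)
  have hGl := hG2.locallyIntegrable (by norm_num)
  have key : ∀ᵐ x, f (x + a) - f x - a * ∫ r, g (x + r * a) ∂unitMeasure = 0 := by
    have hfa := locallyIntegrable_comp_add_right hf a
    refine ae_eq_zero_of_integral_contDiff_smul_eq_zero
      ((hfa.sub hf).sub (hGl.smul a)) fun ψ hψ hψc => ?_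
    obtain ⟨hΨ, hΨd⟩ := contDiff_primitive hψ
    have hχ := average_eq_primitive_sub hψ.continuous a
    have hχ' : (fun x => a * ∫ r, ψ (x - r * a) ∂unitMeasure) = fun x =>
      (∫ y in (0 : ℝ)..x, ψ y) - ∫ y in (0 : ℝ)..(x - a), ψ y := funext hχ
    have hsub : ContDiff ℝ ∞ fun x : ℝ => x - a := contDiff_id.sub contDiff_const
    have h1 := hw (fun x => a * ∫ r, ψ (x - r * a) ∂unitMeasure)
      (by rw [hχ']; exact hΨ.sub (hΨ.comp hsub)) (hasCompactSupport_primitive_sub hψc a)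
    have hd : deriv (fun x => a * ∫ r, ψ (x - r * a) ∂unitMeasure) =
        fun x => ψ x - ψ (x - a) := by
      rw [hχ']
      ext x
      have h2 : HasDerivAt (fun x : ℝ => ∫ y in (0 : ℝ)..(x - a), ψ y) (ψ (x - a)) x :=
        (hΨd (x - a)).comp_sub_const x a
      exact ((hΨd x).sub h2).deriv
    rw [hd] at h1
    have hdual := integral_average_translate_mul unitMeasure hs (B := |a|)
      ((ae_restrict_iff' measurableSet_Icc).2 (ae_of_all _ fun r hr => by
        rw [abs_mul, abs_of_nonneg hr.1]
        exact mul_le_of_le_one_left (abs_nonneg a) hr.2)) hg hψ.continuous hψc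
    have hψa : HasCompactSupport fun x => ψ (x - a) :=
      hψc.comp_homeomorph (Homeomorph.subRight a)
    have i1 : Integrable fun x => f x * ψ x :=
      hf.integrable_smul_right_of_hasCompactSupport hψ.continuous hψc
    have i2 : Integrable fun x => f x * ψ (x - a) :=
      hf.integrable_smul_right_of_hasCompactSupport
        (hψ.continuous.comp hsub.continuous) hψa
    have i3 : Integrable fun x => f (x + a) * ψ x :=
      hfa.integrable_smul_right_of_hasCompactSupport hψ.continuous hψc
    have i4 : Integrable fun x => (∫ r, g (x + r * a) ∂unitMeasure) * ψ x :=
      hGl.integrable_smul_right_of_hasCompactSupport hψ.continuous hψc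
    have e1 : ∫ x, f (x + a) * ψ x = ∫ x, f x * ψ (x - a) := by
      rw [← integral_add_right_eq_self (fun x => f x * ψ (x - a)) a]
      simp
    have e2 : ∫ x, f x * (ψ x - ψ (x - a)) =
        (∫ x, f x * ψ x) - ∫ x, f x * ψ (x - a) := by
      rw [← integral_sub i1 i2]
      simp_rw [mul_sub]
    have e3 : ∫ x, g x * (a * ∫ r, ψ (x - r * a) ∂unitMeasure) =
        a * ∫ x, (∫ r, g (x + r * a) ∂unitMeasure) * ψ x := by
      rw [hdual, ← integral_const_mul]
      congr 1 with x
      ring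
    have e4 : ∫ x, ψ x • (f (x + a) - f x - a * ∫ r, g (x + r * a) ∂unitMeasure) =
        (∫ x, f (x + a) * ψ x) - (∫ x, f x * ψ x) -
          a * ∫ x, (∫ r, g (x + r * a) ∂unitMeasure) * ψ x := by
      rw [← integral_const_mul, ← integral_sub i3 i1, ← integral_sub _ (i4.const_mul a)]
      · congr 1 with x
        simp only [smul_eq_mul]
        ring
      · exact i3.sub i1
    refine e4.trans ?_
    rw [e2, e3] at h1
    rw [e1]
    linarith
  filter_upwards [key] with x hx using by linarith

/-- The `L²` bound of a difference by the weak derivative. -/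
theorem HasWeakDeriv.lintegral_translate_sub_sq_le {f g : ℝ → ℝ} (hfg : HasWeakDeriv f g)
    (hg2 : MemLp g 2 volume) (a : ℝ) :
    ∫⁻ x, ‖f (x + a) - f x‖ₑ ^ 2 ≤ ‖a‖ₑ ^ 2 * ∫⁻ x, ‖g x‖ₑ ^ 2 := by
  have hs : Measurable fun r : ℝ => r * a := measurable_id.mul_const a
  have hG := lintegral_enorm_average_translate_sq_le unitMeasure hs hg2.1
  calc ∫⁻ x, ‖f (x + a) - f x‖ₑ ^ 2
      = ∫⁻ x, ‖a‖ₑ ^ 2 * ‖∫ r, g (x + r * a) ∂unitMeasure‖ₑ ^ 2 := by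
        refine lintegral_congr_ae ?_
        filter_upwards [hfg.translate_sub_ae hg2 a] with x hx
        rw [hx, enorm_mul, mul_pow]
    _ = ‖a‖ₑ ^ 2 * ∫⁻ x, ‖∫ r, g (x + r * a) ∂unitMeasure‖ₑ ^ 2 :=
        lintegral_const_mul'' _ (hG.1.enorm.pow_const 2)
    _ ≤ _ := mul_le_mul_right hG.2.2 _

/-- Functions with a square integrable weak derivative are Hölder continuous of exponent `1/2`. -/
theorem HasWeakDeriv.translate_sub_sq_le_ae {f g : ℝ → ℝ} (hfg : HasWeakDeriv f g)
    (hg2 : MemLp g 2 volume) (a : ℝ) :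
    ∀ᵐ x, ‖f (x + a) - f x‖ₑ ^ 2 ≤ ‖a‖ₑ * ∫⁻ x, ‖g x‖ₑ ^ 2 := by
  have hs : Measurable fun r : ℝ => r * a := measurable_id.mul_const a
  have hG := lintegral_enorm_average_translate_sq_le unitMeasure hs hg2.1
  filter_upwards [hfg.translate_sub_ae hg2 a, hG.2.1] with x hx hJ
  rcases eq_or_ne a 0 with rfl | ha
  · simp
  rw [hx, enorm_mul, mul_pow, sq ‖a‖ₑ, mul_assoc]
  refine mul_le_mul_right ?_ _
  refine (mul_le_mul_right hJ _).trans ?_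
  have h1 : ∫⁻ r, ‖g (x + r * a)‖ₑ ^ 2 ∂unitMeasure ≤ ∫⁻ r : ℝ, ‖g (x + r * a)‖ₑ ^ 2 :=
    setLIntegral_le_lintegral _ _
  refine (mul_le_mul_right h1 _).trans ?_
  have he := (measurableEmbedding_mulRight₀ ha).lintegral_map (μ := volume)
    (fun y => ‖g (x + y)‖ₑ ^ 2)
  rw [Real.map_volume_mul_right ha, lintegral_smul_measure,
    lintegral_add_left_eq_self (fun y => ‖g y‖ₑ ^ 2)] at he
  rw [← he, smul_eq_mul, ← mul_assoc, Real.enorm_eq_ofReal_abs,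
    ← ENNReal.ofReal_mul (abs_nonneg _), ← abs_mul, mul_inv_cancel₀ ha]
  simp

theorem HasWeakDeriv.translate_sub {f g : ℝ → ℝ} (hfg : HasWeakDeriv f g) (a : ℝ) :
    HasWeakDeriv (fun x => f (x + a) - f x) (fun x => g (x + a) - g x) := by
  obtain ⟨hf, hg, hw⟩ := hfg
  have hfa := locallyIntegrable_comp_add_right hf a
  have hga := locallyIntegrable_comp_add_right hg a
  refine ⟨hfa.sub hf, hga.sub hg, fun φ hφ hφc => ?_⟩
  have hsub : ContDiff ℝ ∞ fun x : ℝ => x - a := contDiff_id.sub contDiff_const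
  have hφa : HasCompactSupport fun x => φ (x - a) :=
    hφc.comp_homeomorph (Homeomorph.subRight a)
  have hd : deriv (fun x => φ (x - a)) = fun x => deriv φ (x - a) := by
    ext x
    exact deriv_comp_sub_const ..
  have h1 := hw φ hφ hφc
  have h2 := hw (fun x => φ (x - a)) (hφ.comp hsub) hφa
  rw [hd] at h2
  have e1 : ∫ x, f (x + a) * deriv φ x = ∫ x, f x * deriv φ (x - a) := by
    rw [← integral_add_right_eq_self (fun x => f x * deriv φ (x - a)) a]
    simp
  have e2 : ∫ x, g (x + a) * φ x = ∫ x, g x * φ (x - a) := by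
    rw [← integral_add_right_eq_self (fun x => g x * φ (x - a)) a]
    simp
  have hdc : Continuous (deriv φ) := hφ.continuous_deriv (by simp)
  have i1 : ∀ k : ℝ → ℝ, LocallyIntegrable k volume → Integrable fun x => k x * deriv φ x :=
    fun k hk => hk.integrable_smul_right_of_hasCompactSupport hdc hφc.deriv
  have i2 : ∀ k : ℝ → ℝ, LocallyIntegrable k volume → Integrable fun x => k x * φ x :=
    fun k hk => hk.integrable_smul_right_of_hasCompactSupport hφ.continuous hφc
  simp_rw [sub_mul]
  rw [integral_sub (i1 _ hfa) (i1 _ hf), integral_sub (i2 _ hga) (i2 _ hg), e1, e2, h1, h2]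
  ring

/-! ### Bounded representatives with difference bounds -/

instance (T : ℝ) : SFinite (stripMeasure T) := by unfold stripMeasure; infer_instance

/-- What the uniqueness argument uses of the solution class: `u` is Borel measurable and bounded
everywhere, is square integrable on the strip together with its first and second difference
quotients in space, and is Hölder continuous of exponent `1/2` in space. -/
structure StripRegular (T K : ℝ) (u : ℝ → ℝ → ℝ) : Prop where
  nonneg : 0 ≤ K
  measurable : Measurable (Function.uncurry u)
  abs_le : ∀ t x, |u t x| ≤ K
  sq_le : ∫⁻ p, ‖u p.1 p.2‖ₑ ^ 2 ∂(stripMeasure T) ≤ ENNReal.ofReal K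
  diff_le : ∀ a, ∫⁻ p, ‖u p.1 (p.2 + a) - u p.1 p.2‖ₑ ^ 2 ∂(stripMeasure T) ≤
    ENNReal.ofReal (a ^ 2 * K)
  diff_diff_le : ∀ a b, ∫⁻ p, ‖(u p.1 (p.2 + a + b) - u p.1 (p.2 + a)) -
      (u p.1 (p.2 + b) - u p.1 p.2)‖ₑ ^ 2 ∂(stripMeasure T) ≤
    ENNReal.ofReal (a ^ 2 * b ^ 2 * K)
  holder : ∀ a, ∀ᵐ p ∂(stripMeasure T), (u p.1 (p.2 + a) - u p.1 p.2) ^ 2 ≤ K * |a|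

theorem ae_strip_time_mem (T : ℝ) : ∀ᵐ q ∂(stripMeasure T), q.1 ∈ Icc 0 T :=
  Measure.quasiMeasurePreserving_fst.ae (ae_restrict_mem measurableSet_Icc)

theorem ae_stripMeasure_of_ae_ae {T : ℝ} {P : ℝ × ℝ → Prop} (hP : MeasurableSet {p | P p})
    (h : ∀ᵐ t ∂(volume.restrict (Icc 0 T)), ∀ᵐ x : ℝ, P (t, x)) :
    ∀ᵐ p ∂(stripMeasure T), P p :=
  (Measure.ae_prod_iff_ae_ae hP).2 h

theorem ae_translate {P : ℝ → Prop} (h : ∀ᵐ x : ℝ, P x) (a : ℝ) : ∀ᵐ x : ℝ, P (x + a) :=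
  (measurePreserving_add_right (volume : Measure ℝ) a).quasiMeasurePreserving.ae h

theorem lintegral_strip_le {T : ℝ} {F : ℝ × ℝ → ℝ≥0∞} (hF : Measurable F) {G : ℝ × ℝ → ℝ≥0∞}
    (hG : AEMeasurable G (stripMeasure T)) {c : ℝ≥0∞} (hc : c ≠ ⊤)
    (h : ∀ᵐ t ∂(volume.restrict (Icc 0 T)), ∫⁻ x, F (t, x) ≤ c * ∫⁻ x, G (t, x)) :
    ∫⁻ p, F p ∂(stripMeasure T) ≤ c * ∫⁻ p, G p ∂(stripMeasure T) := by
  unfold stripMeasure at *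
  rw [lintegral_prod _ hF.aemeasurable, lintegral_prod _ hG, ← lintegral_const_mul' _ _ hc]
  exact lintegral_mono_ae h

theorem Measurable.uncurry_translate {u : ℝ → ℝ → ℝ} (hu : Measurable (Function.uncurry u))
    (a : ℝ) : Measurable fun p : ℝ × ℝ => u p.1 (p.2 + a) :=
  hu.comp (measurable_fst.prodMk (measurable_snd.add_const a))

/-- A function in the solution class agrees almost everywhere, both on the strip and on almost
every time slice, with a bounded Borel function that satisfies the difference bounds. -/
theorem MemSolutionClass.exists_stripRegular {T : ℝ} {u : ℝ → ℝ → ℝ}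
    (hu : MemSolutionClass T u) :
    ∃ K v, StripRegular T K v ∧ (∀ᵐ p ∂(stripMeasure T), u p.1 p.2 = v p.1 p.2) ∧
      ∀ᵐ t ∂(volume.restrict (Icc 0 T)), ∀ᵐ x, u t x = v t x := by
  obtain ⟨ux, uxx, hw, ⟨C, hC⟩, hu2, hux2, huxx2⟩ := hu
  set m : ℝ × ℝ → ℝ := hu2.1.mk _ with hm
  have hmm : Measurable m := hu2.1.stronglyMeasurable_mk.measurable
  have hmu : ∀ᵐ p ∂(stripMeasure T), u p.1 p.2 = m p := hu2.1.ae_eq_mk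
  set v : ℝ → ℝ → ℝ := fun t x => max (-C) (min C (m (t, x))) with hv
  have hvm : Measurable (Function.uncurry v) :=
    measurable_const.max (measurable_const.min hmm)
  have hvb : ∀ t x, |v t x| ≤ C := fun t x =>
    abs_le.2 ⟨le_max_left _ _, max_le (by linarith [C.2]) (min_le_left _ _)⟩
  have hmu' : ∀ᵐ t ∂(volume.restrict (Icc 0 T)), ∀ᵐ x : ℝ, u t x = m (t, x) :=
    Measure.ae_ae_of_ae_prod hmu
  have hvu : ∀ᵐ t ∂(volume.restrict (Icc 0 T)), ∀ᵐ x : ℝ, u t x = v t x := by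
    filter_upwards [hmu', hC] with t ht hCt
    filter_upwards [ht, ae_le_eLpNormEssSup (f := u t) (μ := volume)] with x hx hxC
    have h1 : ‖u t x‖ₑ ≤ C := hxC.trans (by simpa using hCt.2.2)
    have h2 : |u t x| ≤ C := by
      have : ‖u t x‖₊ ≤ C := by exact_mod_cast h1
      exact_mod_cast this
    rw [abs_le] at h2
    simp only [hv, ← hx]
    rw [min_eq_right h2.2, max_eq_right h2.1]
  have hvm' : ∀ᵐ p ∂(stripMeasure T), m p = v p.1 p.2 := by
    refine ae_stripMeasure_of_ae_ae (measurableSet_eq_fun hmm hvm) ?_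
    filter_upwards [hmu', hvu] with t h1 h2
    filter_upwards [h1, h2] with x h3 h4
    rw [← h3, h4]
  have huv : ∀ᵐ p ∂(stripMeasure T), u p.1 p.2 = v p.1 p.2 := by
    filter_upwards [hmu, hvm'] with p h1 h2 using h1.trans h2
  have hfin : ∀ {w : ℝ → ℝ → ℝ}, MemLp (Function.uncurry w) 2 (stripMeasure T) →
      ∫⁻ p, ‖w p.1 p.2‖ₑ ^ 2 ∂(stripMeasure T) ≠ ⊤ := by
    intro w hw
    have := lintegral_enorm_sq_eq (ν := stripMeasure T) (Function.uncurry w)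
    simp only [Function.uncurry] at this
    rw [this]
    exact (ENNReal.pow_lt_top hw.2).ne
  have hslice : ∀ {w : ℝ → ℝ → ℝ}, MemLp (Function.uncurry w) 2 (stripMeasure T) →
      ∀ᵐ t ∂(volume.restrict (Icc 0 T)), MemLp (w t) 2 volume := by
    intro w hw
    have h1 : ∀ᵐ t ∂(volume.restrict (Icc 0 T)), AEStronglyMeasurable (w t) volume :=
      hw.1.prodMk_left
    have h2 : ∀ᵐ t ∂(volume.restrict (Icc 0 T)), ∫⁻ x, ‖w t x‖ₑ ^ 2 < ⊤ := by
      have h3 := hfin hw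
      unfold stripMeasure at h3 hw
      have hmeas : AEMeasurable (fun p : ℝ × ℝ => ‖w p.1 p.2‖ₑ ^ 2)
          ((volume.restrict (Icc 0 T)).prod volume) := hw.1.enorm.pow_const 2
      rw [lintegral_prod _ hmeas] at h3
      exact ae_lt_top' hmeas.lintegral_prod_right' h3
    filter_upwards [h1, h2] with t ht1 ht2
    refine ⟨ht1, ?_⟩
    rw [lintegral_enorm_sq_eq] at ht2
    exact (ENNReal.pow_lt_top_iff.1 ht2).resolve_right (by norm_num)
  set N0 := ∫⁻ p, ‖u p.1 p.2‖ₑ ^ 2 ∂(stripMeasure T) with hN0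
  set N1 := ∫⁻ p, ‖ux p.1 p.2‖ₑ ^ 2 ∂(stripMeasure T) with hN1
  set N2 := ∫⁻ p, ‖uxx p.1 p.2‖ₑ ^ 2 ∂(stripMeasure T) with hN2
  set K : ℝ := C + N0.toReal + N1.toReal + N2.toReal + (C : ℝ) ^ 2 with hK
  have hC0 : (0 : ℝ) ≤ C := C.2
  have f0 : N0 ≠ ⊤ := hfin hu2
  have f1 : N1 ≠ ⊤ := hfin hux2
  have f2 : N2 ≠ ⊤ := hfin huxx2
  have p0 : 0 ≤ N0.toReal := ENNReal.toReal_nonneg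
  have p1 : 0 ≤ N1.toReal := ENNReal.toReal_nonneg
  have p2 : 0 ≤ N2.toReal := ENNReal.toReal_nonneg
  have p3 : (0 : ℝ) ≤ (C : ℝ) ^ 2 := sq_nonneg _
  have hsq : ∀ a : ℝ, ‖a‖ₑ ^ 2 = ENNReal.ofReal (a ^ 2) := fun a => by
    rw [Real.enorm_eq_ofReal_abs, ← ENNReal.ofReal_pow (abs_nonneg a), sq_abs]
  refine ⟨K, v, ⟨by positivity, hvm, fun t x => (hvb t x).trans (by linarith), ?_, ?_, ?_, ?_⟩,
    huv, hvu⟩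
  · calc ∫⁻ p, ‖v p.1 p.2‖ₑ ^ 2 ∂(stripMeasure T) = N0 := by
          refine lintegral_congr_ae ?_
          filter_upwards [huv] with p hp
          rw [hp]
      _ = ENNReal.ofReal N0.toReal := (ENNReal.ofReal_toReal (hfin hu2)).symm
      _ ≤ _ := ENNReal.ofReal_le_ofReal (by linarith)
  · intro a
    have h1 : ∫⁻ p, ‖v p.1 (p.2 + a) - v p.1 p.2‖ₑ ^ 2 ∂(stripMeasure T) ≤ ‖a‖ₑ ^ 2 * N1 := by
      refine lintegral_strip_le (((hvm.uncurry_translate a).sub hvm).enorm.pow_const 2)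
        (G := fun p => ‖ux p.1 p.2‖ₑ ^ 2) (hux2.1.enorm.pow_const 2) (by simp) ?_
      filter_upwards [hvu, hw, hslice hux2] with t h1 h2 h3
      refine le_trans (le_of_eq (lintegral_congr_ae ?_))
        (h2.1.lintegral_translate_sub_sq_le h3 a)
      filter_upwards [h1, ae_translate h1 a] with x h4 h5
      rw [h4, h5]
      rfl
    refine h1.trans ?_
    rw [hsq, ← ENNReal.ofReal_toReal f1, ← ENNReal.ofReal_mul (sq_nonneg a)]
    exact ENNReal.ofReal_le_ofReal (mul_le_mul_of_nonneg_left (by linarith) (sq_nonneg a))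
  · intro a b
    have h1 : ∫⁻ p, ‖(v p.1 (p.2 + a + b) - v p.1 (p.2 + a)) -
        (v p.1 (p.2 + b) - v p.1 p.2)‖ₑ ^ 2 ∂(stripMeasure T) ≤ (‖a‖ₑ ^ 2 * ‖b‖ₑ ^ 2) * N2 := by
      refine lintegral_strip_le (G := fun p => ‖uxx p.1 p.2‖ₑ ^ 2) ?_
        (huxx2.1.enorm.pow_const 2) (ENNReal.mul_ne_top (by simp) (by simp)) ?_
      · simp_rw [add_assoc]
        exact (((hvm.uncurry_translate (a + b)).sub (hvm.uncurry_translate a)).sub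
          ((hvm.uncurry_translate b).sub hvm)).enorm.pow_const 2
      filter_upwards [hvu, hw, hslice hux2, hslice huxx2] with t h1 h2 h3 h4
      have h5 := (h2.1.translate_sub b).lintegral_translate_sub_sq_le (g := fun x =>
        ux t (x + b) - ux t x) ?_ a
      · have h6 := h2.2.lintegral_translate_sub_sq_le h4 b
        rw [mul_assoc]
        refine le_trans (le_of_eq (lintegral_congr_ae ?_))
          (h5.trans (mul_le_mul_right h6 _))
        filter_upwards [h1, ae_translate h1 a, ae_translate h1 b,
          ae_translate (ae_translate h1 b) a] with x e1 e2 e3 e4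
        rw [e1, e2, e3, e4]
      · exact (h3.comp_measurePreserving (measurePreserving_add_right volume b)).sub h3
    refine h1.trans ?_
    rw [hsq, hsq, ← ENNReal.ofReal_toReal f2, ← ENNReal.ofReal_mul (sq_nonneg a),
      ← ENNReal.ofReal_mul (by positivity)]
    exact ENNReal.ofReal_le_ofReal (mul_le_mul_of_nonneg_left (by linarith) (by positivity))
  · intro a
    refine ae_stripMeasure_of_ae_ae (measurableSet_le
      (((hvm.uncurry_translate a).sub hvm).pow_const 2) measurable_const) ?_
    filter_upwards [hvu, hw, hslice hux2, hC] with t h1 h2 h3 h4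
    filter_upwards [h1, ae_translate h1 a, h2.1.translate_sub_sq_le_ae h3 a] with x e1 e2 e3
    rw [e1, e2, hsq, lintegral_enorm_sq_eq] at e3
    have e4 : ENNReal.ofReal ((v t (x + a) - v t x) ^ 2) ≤ ENNReal.ofReal (K * |a|) := by
      refine e3.trans ((mul_le_mul_right (pow_le_pow_left₀ (by simp) h4.2.1 2) _).trans ?_)
      rw [Real.enorm_eq_ofReal_abs, ← ENNReal.ofReal_coe_nnreal, ← ENNReal.ofReal_pow hC0,
        ← ENNReal.ofReal_mul (abs_nonneg a), mul_comm]
      exact ENNReal.ofReal_le_ofReal (mul_le_mul_of_nonneg_right (by linarith) (abs_nonneg a))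
    exact (ENNReal.ofReal_le_ofReal_iff (by positivity)).1 e4

/-! ### From tested identities to pointwise identities -/

/-- A compact subset of `(0,T)` stays below some `b < T`. -/
theorem exists_lt_of_isCompact_subset_Ioo {T : ℝ} (hT : 0 < T) {S : Set ℝ} (hS : IsCompact S)
    (hST : S ⊆ Ioo 0 T) : ∃ b, 0 < b ∧ b < T ∧ S ⊆ Iic b := by
  rcases S.eq_empty_or_nonempty with rfl | hne
  · exact ⟨T / 2, by linarith, by linarith, empty_subset _⟩
  · obtain ⟨b, hb⟩ := hS.exists_isGreatest hne
    exact ⟨b, (hST hb.1).1, (hST hb.1).2, fun x hx => hb.2 hx⟩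

/-- The du Bois-Reymond lemma in time with an initial value: a weak solution of `m' = n`,
`m(0) = m₀` on `[0,T)` is the primitive of `n` starting from `m₀`. -/
theorem ae_eq_add_integral_of_weak_deriv {T : ℝ} (hT : 0 < T) {m n : ℝ → ℝ} {m₀ : ℝ}
    (hm : IntervalIntegrable m volume 0 T) (hn : IntervalIntegrable n volume 0 T)
    (hw : ∀ η : ℝ → ℝ, ContDiff ℝ ∞ η → HasCompactSupport η → tsupport η ⊆ Iio T →
      -(∫ t in (0 : ℝ)..T, m t * deriv η t) - m₀ * η 0 = ∫ t in (0 : ℝ)..T, η t * n t) :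
    ∀ᵐ t ∂(volume.restrict (Icc 0 T)), m t = m₀ + ∫ s in (0 : ℝ)..t, n s := by
  have hN : AbsolutelyContinuousOnInterval (fun t => ∫ s in (0 : ℝ)..t, n s) 0 T :=
    hn.absolutelyContinuousOnInterval_intervalIntegral (by simp)
  have hNd : ∀ᵐ t, t ∈ uIcc 0 T → HasDerivAt (fun t => ∫ s in (0 : ℝ)..t, n s) (n t) t := by
    filter_upwards [hn.ae_hasDerivAt_integral] with t ht h
    exact ht h 0 (by simp)
  have hNi : IntervalIntegrable (fun t => ∫ s in (0 : ℝ)..t, n s) volume 0 T :=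
    hN.continuousOn.intervalIntegrable
  have hF : IntervalIntegrable (fun t => m t - (m₀ + ∫ s in (0 : ℝ)..t, n s)) volume 0 T :=
    hm.sub (intervalIntegrable_const.add hNi)
  have key : ∀ᵐ t, t ∈ Ioo 0 T → m t - (m₀ + ∫ s in (0 : ℝ)..t, n s) = 0 := by
    refine isOpen_Ioo.ae_eq_zero_of_integral_contDiff_smul_eq_zero ?_ fun g hg hgc hgT => ?_
    · exact (((intervalIntegrable_iff_integrableOn_Ioc_of_le hT.le).1 hF).mono_set
        Ioo_subset_Ioc_self).locallyIntegrableOn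
    · obtain ⟨b, hb0, hbT, hgb⟩ := exists_lt_of_isCompact_subset_Ioo hT hgc.isCompact hgT
      have hg0 : ∀ t, t ∉ Ioo 0 T → g t = 0 := fun t ht =>
        image_eq_zero_of_notMem_tsupport fun h => ht (hgT h)
      obtain ⟨hP, hPd⟩ := contDiff_primitive hg
      set P : ℝ → ℝ := fun x => ∫ y in (0 : ℝ)..x, g y with hPdef
      have hP0 : P 0 = 0 := by simp [hPdef]
      have hPb : ∀ t, b ≤ t → P t = P b := by
        intro t ht
        have h1 : ∫ y in b..t, g y = 0 := by
          rw [intervalIntegral.integral_of_le ht]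
          refine setIntegral_eq_zero_of_forall_eq_zero fun y hy => ?_
          exact image_eq_zero_of_notMem_tsupport fun h => absurd (hgb h) (not_le.2 hy.1)
        have h2 := intervalIntegral.integral_add_adjacent_intervals
          (hg.continuous.intervalIntegrable (μ := volume) 0 b)
          (hg.continuous.intervalIntegrable (μ := volume) b t)
        rw [h1, add_zero] at h2
        exact h2.symm
      -- The test function is `-∫_t^T g`, cut off at negative times.
      let κ : ContDiffBump (0 : ℝ) := ⟨T + 1, T + 2, by linarith, by linarith⟩
      have hκ1 : ∀ t, |t| ≤ T + 1 → κ t = 1 := fun t ht =>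
        κ.one_of_mem_closedBall (by simpa using ht)
      have hη : ContDiff ℝ ∞ fun t => κ t * (P t - P T) :=
        κ.contDiff.mul (hP.sub contDiff_const)
      have hηc : HasCompactSupport fun t => κ t * (P t - P T) := κ.hasCompactSupport.mul_right
      have hηT : tsupport (fun t => κ t * (P t - P T)) ⊆ Iio T := by
        refine (closure_minimal (t := Iic b) ?_ isClosed_Iic).trans (Iic_subset_Iio.2 hbT)
        intro t ht
        by_contra hbt
        rw [mem_Iic, not_le] at hbt
        apply ht
        simp only
        rw [hPb t hbt.le, hPb T hbT.le]
        simp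
      have hηd : ∀ t ∈ Icc 0 T, deriv (fun t => κ t * (P t - P T)) t = g t := by
        intro t ht
        have h1 : (fun t => κ t * (P t - P T)) =ᶠ[𝓝 t] fun t => P t - P T := by
          have : Iio (T + 1) ∩ Ioi (-(T + 1)) ∈ 𝓝 t :=
            inter_mem (Iio_mem_nhds (by linarith [ht.2])) (Ioi_mem_nhds (by linarith [ht.1]))
          filter_upwards [this] with s hs
          rw [hκ1 s (abs_le.2 ⟨(mem_Ioi.1 hs.2).le, (mem_Iio.1 hs.1).le⟩), one_mul]
        rw [h1.deriv_eq]
        exact ((hPd t).sub_const _).deriv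
      have h1 := hw _ hη hηc hηT
      have e1 : ∫ t in (0 : ℝ)..T, m t * deriv (fun t => κ t * (P t - P T)) t =
          ∫ t in (0 : ℝ)..T, m t * g t := by
        refine intervalIntegral.integral_congr fun t ht => ?_
        rw [uIcc_of_le hT.le] at ht
        rw [hηd t ht]
      have e2 : ∫ t in (0 : ℝ)..T, κ t * (P t - P T) * n t =
          ∫ t in (0 : ℝ)..T, (P t - P T) * n t := by
        refine intervalIntegral.integral_congr fun t ht => ?_
        rw [uIcc_of_le hT.le] at ht
        rw [hκ1 t (abs_le.2 ⟨by linarith [ht.1], by linarith [ht.2]⟩), one_mul]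
      have hPac : AbsolutelyContinuousOnInterval (fun t => P t - P T) 0 T :=
        ((hP.sub contDiff_const).of_le (by simp)).contDiffOn.absolutelyContinuousOnInterval
      have e3 := hPac.integral_mul_deriv_eq_deriv_mul hN
      have e4 : ∫ t in (0 : ℝ)..T, (P t - P T) * deriv (fun t => ∫ s in (0 : ℝ)..t, n s) t =
          ∫ t in (0 : ℝ)..T, (P t - P T) * n t := by
        refine intervalIntegral.integral_congr_ae ?_
        filter_upwards [hNd] with t ht h
        rw [(ht (uIoc_subset_uIcc h)).deriv]
      have e5 : ∫ t in (0 : ℝ)..T, deriv (fun t => P t - P T) t * (∫ s in (0 : ℝ)..t, n s) =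
          ∫ t in (0 : ℝ)..T, g t * (∫ s in (0 : ℝ)..t, n s) := by
        refine intervalIntegral.integral_congr fun t _ => ?_
        rw [((hPd t).sub_const _).deriv]
      rw [e4, e5] at e3
      rw [e1, e2, e3, hκ1 0 (by simp; linarith), hP0] at h1
      have hgc' : ContinuousOn g (uIcc 0 T) := hg.continuous.continuousOn
      have e6 : ∫ t, g t • (m t - (m₀ + ∫ s in (0 : ℝ)..t, n s)) =
          ∫ t in (0 : ℝ)..T, g t * (m t - (m₀ + ∫ s in (0 : ℝ)..t, n s)) := by
        rw [intervalIntegral.integral_of_le hT.le, integral_Ioc_eq_integral_Ioo]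
        refine (setIntegral_eq_integral_of_forall_compl_eq_zero fun t ht => ?_).symm
        rw [hg0 t ht, zero_smul]
      have e7 : ∫ t in (0 : ℝ)..T, g t * (m t - (m₀ + ∫ s in (0 : ℝ)..t, n s)) =
          (∫ t in (0 : ℝ)..T, m t * g t) - (m₀ * ∫ t in (0 : ℝ)..T, g t) -
            ∫ t in (0 : ℝ)..T, g t * ∫ s in (0 : ℝ)..t, n s := by
        rw [← intervalIntegral.integral_const_mul, ← intervalIntegral.integral_sub,
          ← intervalIntegral.integral_sub]
        · refine intervalIntegral.integral_congr fun t _ => ?_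
          ring
        · exact (hm.mul_continuousOn hgc').sub (hgc'.intervalIntegrable.const_mul _)
        · exact hNi.continuousOn_mul hgc'
        · exact hm.mul_continuousOn hgc'
        · exact hgc'.intervalIntegrable.const_mul _
      have e8 : P T = ∫ t in (0 : ℝ)..T, g t := rfl
      rw [e6, e7, ← e8]
      simp only [intervalIntegral.integral_same] at h1
      linarith
  have key' : ∀ᵐ t ∂(volume.restrict (Ioo 0 T)), m t = m₀ + ∫ s in (0 : ℝ)..t, n s := by
    rw [ae_restrict_iff' measurableSet_Ioo]
    filter_upwards [key] with t ht h
    linarith [ht h]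
  rwa [Measure.restrict_congr_set (Ioo_ae_eq_Icc (μ := volume) (a := (0 : ℝ)) (b := T))] at key'

/-- A bounded function of `(t,x)` vanishes almost everywhere if all its integrals in `x` against
test functions vanish, with an exceptional null set of times that may depend on the test
function. -/
theorem ae_eq_zero_of_forall_ae_integral_eq_zero {T : ℝ} {F : ℝ → ℝ → ℝ}
    (hF : Measurable (Function.uncurry F)) {B : ℝ} (hB : ∀ t x, |F t x| ≤ B)
    (h : ∀ ψ : ℝ → ℝ, ContDiff ℝ ∞ ψ → HasCompactSupport ψ →
      ∀ᵐ t ∂(volume.restrict (Icc 0 T)), ∫ x, F t x * ψ x = 0) :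
    ∀ᵐ p ∂(stripMeasure T), F p.1 p.2 = 0 := by
  let κ : ℕ → ContDiffBump (0 : ℝ) := fun k =>
    ⟨1 / ((k : ℝ) + 1), 2 * (1 / ((k : ℝ) + 1)), by positivity,
      by linarith [show (0 : ℝ) < 1 / ((k : ℝ) + 1) by positivity]⟩
  -- Countably many mollifiers leave a single null set of times.
  have h1 : ∀ k, ∀ᵐ t ∂(volume.restrict (Icc 0 T)), ∀ᵐ x,
      ∫ y, F t y * (κ k).normed volume (x - y) = 0 := by
    intro k
    have hmeas : Measurable fun q : ℝ × ℝ =>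
        ∫ y, F q.1 y * (κ k).normed volume (q.2 - y) := by
      have : StronglyMeasurable fun z : (ℝ × ℝ) × ℝ =>
          F z.1.1 z.2 * (κ k).normed volume (z.1.2 - z.2) := by
        refine Measurable.stronglyMeasurable (Measurable.mul ?_ ?_)
        · exact hF.comp ((measurable_fst.comp measurable_fst).prodMk measurable_snd)
        · exact (κ k).continuous_normed.measurable.comp
            ((measurable_snd.comp measurable_fst).sub measurable_snd)
      exact this.integral_prod_right.measurable
    have hset : MeasurableSet {q : ℝ × ℝ | ∫ y, F q.1 y * (κ k).normed volume (q.2 - y) = 0} :=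
      hmeas (measurableSet_singleton 0)
    refine Measure.ae_ae_comm (μ := volume.restrict (Icc 0 T)) (ν := volume) hset |>.2 ?_
    refine ae_of_all _ fun x => ?_
    have hs : ContDiff ℝ ∞ fun y : ℝ => x - y := contDiff_const.sub contDiff_id
    exact h (fun y => (κ k).normed volume (x - y)) ((κ k).contDiff_normed.comp hs)
      ((κ k).hasCompactSupport_normed.comp_homeomorph (Homeomorph.subLeft x))
  refine ae_stripMeasure_of_ae_ae (hF (measurableSet_singleton 0)) ?_
  filter_upwards [ae_all_iff.2 h1] with t ht
  have hloc : LocallyIntegrable (F t) volume := by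
    refine (memLp_top_of_bound (C := B) (hF.comp measurable_prodMk_left).aestronglyMeasurable
      (ae_of_all _ (hB t))).locallyIntegrable (by simp)
  have hlim := ContDiffBump.ae_convolution_tendsto_right_of_locallyIntegrable (μ := volume)
    (φ := κ) (l := atTop) (K := 2) (g := F t) ?_ (Eventually.of_forall fun k => le_rfl) hloc
  · filter_upwards [hlim, ae_all_iff.2 ht] with x hx h0
    refine tendsto_nhds_unique hx ?_
    refine tendsto_const_nhds.congr fun k => ?_
    rw [convolution_eq_swap]
    refine (h0 k).symm.trans ?_
    congr 1 with y
    simp [mul_comm]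
  · have := (tendsto_one_div_add_atTop_nhds_zero_nat (𝕜 := ℝ)).const_mul 2
    rwa [mul_zero] at this

/-! ### Hat averages and the integrated equation -/

/-- The average of `f` against the hat function of width `h` centred at `x`, written as the
expectation of `f (x + h (q₁ - q₂))` for independent uniform variables `q₁, q₂` in `[0,1]`. -/
noncomputable def hatAvg (h : ℝ) (f : ℝ → ℝ) (x : ℝ) : ℝ :=
  ∫ q, f (x + h * (q.1 - q.2)) ∂(unitMeasure.prod unitMeasure)

/-- The symmetric second difference with step `h`. -/
def secondDiff (h : ℝ) (f : ℝ → ℝ) (x : ℝ) : ℝ := f (x + h) - 2 * f x + f (x - h)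

theorem ae_unitSquare : ∀ᵐ q ∂(unitMeasure.prod unitMeasure),
    q.1 ∈ Icc (0 : ℝ) 1 ∧ q.2 ∈ Icc (0 : ℝ) 1 :=
  (Measure.quasiMeasurePreserving_fst.ae (ae_restrict_mem measurableSet_Icc)).and
    (Measure.quasiMeasurePreserving_snd.ae (ae_restrict_mem measurableSet_Icc))

theorem ae_abs_hat_shift_le {h : ℝ} (hh : 0 ≤ h) :
    ∀ᵐ q ∂(unitMeasure.prod unitMeasure), |h * (q.1 - q.2)| ≤ h := by
  filter_upwards [ae_unitSquare] with q hq
  rw [abs_mul, abs_of_nonneg hh]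
  refine mul_le_of_le_one_right hh (abs_le.2 ⟨?_, ?_⟩) <;> linarith [hq.1.1, hq.1.2, hq.2.1, hq.2.2]

theorem measurable_hat_shift (h : ℝ) : Measurable fun q : ℝ × ℝ => h * (q.1 - q.2) :=
  (measurable_fst.sub measurable_snd).const_mul h

theorem abs_hatAvg_le {f : ℝ → ℝ} {K : ℝ} (hf : ∀ x, |f x| ≤ K) (h x : ℝ) :
    |hatAvg h f x| ≤ K := by
  have := norm_integral_le_of_norm_le_const (μ := unitMeasure.prod unitMeasure)
    (f := fun q => f (x + h * (q.1 - q.2))) (C := K) (ae_of_all _ fun q => hf _)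
  simpa [hatAvg] using this

theorem measurable_hatAvg {v : ℝ → ℝ → ℝ} (hv : Measurable (Function.uncurry v)) (h : ℝ) :
    Measurable fun q : ℝ × ℝ => hatAvg h (v q.1) q.2 := by
  have : StronglyMeasurable fun z : (ℝ × ℝ) × (ℝ × ℝ) =>
      v z.1.1 (z.1.2 + h * (z.2.1 - z.2.2)) := by
    have hc : Measurable fun z : (ℝ × ℝ) × (ℝ × ℝ) =>
        (z.1.1, z.1.2 + h * (z.2.1 - z.2.2)) := by fun_prop
    exact (hv.comp hc).stronglyMeasurable
  exact this.integral_prod_right.measurable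

theorem measurable_secondDiff {p : ℝ → ℝ → ℝ} (hp : Measurable (Function.uncurry p)) (h : ℝ) :
    Measurable fun q : ℝ × ℝ => secondDiff h (p q.1) q.2 :=
  ((hp.uncurry_translate h).sub (hp.const_mul 2)).add (hp.uncurry_translate (-h))

theorem abs_secondDiff_le {f : ℝ → ℝ} {K : ℝ} (hf : ∀ x, |f x| ≤ K) (h x : ℝ) :
    |secondDiff h f x| ≤ 4 * K := by
  have h1 := abs_le.1 (hf (x + h))
  have h2 := abs_le.1 (hf x)
  have h3 := abs_le.1 (hf (x - h))
  rw [secondDiff, abs_le]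
  constructor <;> linarith

theorem measurable_integral_Ioc {p : ℝ → ℝ → ℝ} (hp : Measurable (Function.uncurry p)) :
    Measurable fun q : ℝ × ℝ => ∫ s in Ioc 0 q.1, p s q.2 := by
  have : StronglyMeasurable fun z : (ℝ × ℝ) × ℝ =>
      {z : (ℝ × ℝ) × ℝ | 0 < z.2 ∧ z.2 ≤ z.1.1}.indicator (fun z => p z.2 z.1.2) z := by
    refine Measurable.stronglyMeasurable (Measurable.indicator ?_ ?_)
    · exact hp.comp (measurable_snd.prodMk (measurable_snd.comp measurable_fst))
    · exact (measurableSet_lt measurable_const measurable_snd).inter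
        (measurableSet_le measurable_snd (measurable_fst.comp measurable_fst))
  have e : (fun q : ℝ × ℝ => ∫ s in Ioc 0 q.1, p s q.2) = fun q : ℝ × ℝ =>
      ∫ s, {z : (ℝ × ℝ) × ℝ | 0 < z.2 ∧ z.2 ≤ z.1.1}.indicator (fun z => p z.2 z.1.2) (q, s) := by
    ext q
    rw [← integral_indicator measurableSet_Ioc]
    rfl
  rw [e]
  exact this.integral_prod_right'.measurable

theorem locallyIntegrable_of_bound {f : ℝ → ℝ} (hf : Measurable f) {K : ℝ}
    (hK : ∀ x, |f x| ≤ K) : LocallyIntegrable f volume :=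
  (memLp_top_of_bound (C := K) hf.aestronglyMeasurable (ae_of_all _ hK)).locallyIntegrable
    (by simp)

theorem integrable_mul_of_bound {f ψ : ℝ → ℝ} (hf : Measurable f) {K : ℝ}
    (hK : ∀ x, |f x| ≤ K) (hψ : Continuous ψ) (hψc : HasCompactSupport ψ) :
    Integrable fun x => f x * ψ x :=
  (locallyIntegrable_of_bound hf hK).integrable_smul_right_of_hasCompactSupport hψ hψc

theorem intervalIntegrable_integral_mul {v : ℝ → ℝ → ℝ} (hv : Measurable (Function.uncurry v))
    {K : ℝ} (hK : ∀ t x, |v t x| ≤ K) {ψ : ℝ → ℝ} (hψ : Continuous ψ)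
    (hψc : HasCompactSupport ψ) (a b : ℝ) :
    IntervalIntegrable (fun t => ∫ x, v t x * ψ x) volume a b := by
  have hm : StronglyMeasurable fun z : ℝ × ℝ => v z.1 z.2 * ψ z.2 :=
    (hv.mul (hψ.measurable.comp measurable_snd)).stronglyMeasurable
  have hψi := hψ.integrable_of_hasCompactSupport hψc (μ := volume)
  refine (intervalIntegrable_const (c := K * ∫ x, |ψ x|)).mono_fun
    hm.integral_prod_right.aestronglyMeasurable (ae_of_all _ fun t => ?_)
  have h1 : ‖∫ x, v t x * ψ x‖ ≤ ∫ x, K * |ψ x| := by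
    refine norm_integral_le_of_norm_le (hψi.abs.const_mul K) (ae_of_all _ fun x => ?_)
    rw [norm_mul]
    exact mul_le_mul_of_nonneg_right (hK t x) (abs_nonneg _)
  rw [integral_const_mul] at h1
  exact h1.trans (le_abs_self _)

/-- The hat average of a test function is a test function, and its second derivative is a second
difference quotient. -/
theorem hat_testFunction {h : ℝ} (hh : 0 < h) {ψ : ℝ → ℝ} (hψ : ContDiff ℝ ∞ ψ)
    (hψc : HasCompactSupport ψ) :
    ∃ χ : ℝ → ℝ, ContDiff ℝ ∞ χ ∧ HasCompactSupport χ ∧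
      (∀ x, χ x = ∫ q, ψ (x - h * (q.1 - q.2)) ∂(unitMeasure.prod unitMeasure)) ∧
      ∀ x, deriv (deriv χ) x = (h ^ 2)⁻¹ * secondDiff h ψ x := by
  obtain ⟨hP, hPd⟩ := contDiff_primitive hψ
  set P : ℝ → ℝ := fun x => ∫ y in (0 : ℝ)..x, ψ y
  obtain ⟨hQ, hQd⟩ := contDiff_primitive hP
  set Q : ℝ → ℝ := fun x => ∫ y in (0 : ℝ)..x, P y
  have hχ : ∀ x, ∫ q, ψ (x - h * (q.1 - q.2)) ∂(unitMeasure.prod unitMeasure) =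
      (h ^ 2)⁻¹ * secondDiff h Q x := by
    intro x
    obtain ⟨C, hC⟩ := hψ.continuous.bounded_above_of_compact_support hψc
    have hi : Integrable (fun q : ℝ × ℝ => ψ (x - h * (q.1 - q.2)))
        (unitMeasure.prod unitMeasure) := by
      refine Integrable.of_bound (C := C) ?_ (ae_of_all _ fun q => hC _)
      have : Continuous fun q : ℝ × ℝ => ψ (x - h * (q.1 - q.2)) := by
        have := hψ.continuous
        fun_prop
      exact this.aestronglyMeasurable
    rw [integral_prod _ hi]
    have e1 : ∀ r : ℝ, ∫ y, ψ (x - h * (r - y)) ∂unitMeasure =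
        h⁻¹ * (P (x + h - r * h) - P (x - r * h)) := by
      intro r
      have := average_eq_primitive_sub hψ.continuous (-h) (x - r * h)
      have e : ∫ y, ψ (x - h * (r - y)) ∂unitMeasure =
          ∫ y, ψ (x - r * h - y * -h) ∂unitMeasure := by
        congr 1 with y
        ring_nf
      rw [e, eq_inv_mul_iff_mul_eq₀ hh.ne', ← neg_inj, ← neg_mul, this]
      simp only [P]
      rw [show x - r * h - -h = x + h - r * h by ring]
      ring
    simp_rw [e1]
    have hPc : ∀ c : ℝ, Integrable (fun r : ℝ => P (c - r * h)) unitMeasure := by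
      intro c
      have : Continuous fun r : ℝ => P (c - r * h) := by
        have := hP.continuous
        fun_prop
      exact (this.continuousOn.integrableOn_compact isCompact_Icc)
    rw [integral_const_mul, integral_sub (hPc _) (hPc _)]
    have e2 := average_eq_primitive_sub hP.continuous h x
    have e3 := average_eq_primitive_sub hP.continuous h (x + h)
    have e4 : Q (x + h - h) = Q x := by rw [add_sub_cancel_right]
    change _ = Q x - Q (x - h) at e2
    change _ = Q (x + h) - Q (x + h - h) at e3
    rw [e4] at e3
    rw [secondDiff, sq, mul_inv, mul_assoc]
    congr 1
    rw [eq_inv_mul_iff_mul_eq₀ hh.ne', mul_sub, e2, e3]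
    ring
  have hQ' : ∀ c : ℝ, ContDiff ℝ ∞ fun x => Q (x + c) := fun c =>
    hQ.comp (contDiff_id.add contDiff_const)
  have hd2 : ∀ {F f : ℝ → ℝ}, (∀ x, HasDerivAt F (f x) x) → ∀ x,
      HasDerivAt (fun x => (h ^ 2)⁻¹ * secondDiff h F x) ((h ^ 2)⁻¹ * secondDiff h f x) x := by
    intro F f hFf x
    exact ((((hFf (x + h)).comp_add_const x h).sub ((hFf x).const_mul 2)).add
      ((hFf (x - h)).comp_sub_const x h)).const_mul _
  refine ⟨fun x => (h ^ 2)⁻¹ * secondDiff h Q x, ?_, ?_, fun x => (hχ x).symm, fun x => ?_⟩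
  · exact contDiff_const.mul (((hQ' h).sub (contDiff_const.mul hQ)).add (hQ' (-h)))
  · obtain ⟨R, hR⟩ := hψc.isCompact.isBounded.subset_closedBall (0 : ℝ)
    refine HasCompactSupport.intro (isCompact_closedBall (0 : ℝ) (R + h)) fun x hx => ?_
    rw [← hχ x]
    have : ∀ᵐ q ∂(unitMeasure.prod unitMeasure), ψ (x - h * (q.1 - q.2)) = 0 := by
      filter_upwards [ae_abs_hat_shift_le hh.le] with q hq
      apply image_eq_zero_of_notMem_tsupport
      intro hmem
      apply hx
      have h1 := hR hmem
      simp only [Metric.mem_closedBall, dist_zero_right, Real.norm_eq_abs] at h1 ⊢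
      have h2 := abs_add_le (x - h * (q.1 - q.2)) (h * (q.1 - q.2))
      rw [sub_add_cancel] at h2
      linarith
    rw [integral_congr_ae this]
    simp
  · have e1 : deriv (fun x => (h ^ 2)⁻¹ * secondDiff h Q x) =
        fun x => (h ^ 2)⁻¹ * secondDiff h P x := funext fun x => (hd2 hQd x).deriv
    rw [e1]
    exact (hd2 hPd x).deriv

theorem integral_sub_two_mul_add {α : Type*} [MeasurableSpace α] {μ : Measure α} {A B C : α → ℝ}
    (hA : Integrable A μ) (hB : Integrable B μ) (hC : Integrable C μ) :
    ∫ x, (A x - 2 * B x + C x) ∂μ = (∫ x, A x ∂μ) - 2 * (∫ x, B x ∂μ) + ∫ x, C x ∂μ := by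
  have h1 : ∫ x, (A x - 2 * B x + C x) ∂μ = (∫ x, (A x - 2 * B x) ∂μ) + ∫ x, C x ∂μ :=
    integral_add (hA.sub (hB.const_mul 2)) hC
  rw [h1, integral_sub hA (hB.const_mul 2), integral_const_mul]

theorem integral_mul_secondDiff {f ψ : ℝ → ℝ} (hf : Measurable f) {K : ℝ}
    (hK : ∀ x, |f x| ≤ K) (hψ : Continuous ψ) (hψc : HasCompactSupport ψ) (h : ℝ) :
    ∫ x, f x * secondDiff h ψ x = ∫ x, secondDiff h f x * ψ x := by
  have i1 : ∀ a, Integrable fun x => f x * ψ (x + a) := fun a =>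
    integrable_mul_of_bound hf hK (hψ.comp (continuous_id.add continuous_const))
      (hψc.comp_homeomorph (Homeomorph.addRight a))
  have i2 : ∀ a, Integrable fun x => f (x + a) * ψ x := fun a =>
    integrable_mul_of_bound (hf.comp (measurable_id.add_const a)) (fun x => hK _) hψ hψc
  have e : ∀ a, ∫ x, f x * ψ (x + a) = ∫ x, f (x - a) * ψ x := by
    intro a
    rw [← integral_sub_right_eq_self (fun x => f x * ψ (x + a)) a]
    simp
  have i0 : Integrable fun x => f x * ψ x := by simpa using i1 0
  calc ∫ x, f x * secondDiff h ψ x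
      = ∫ x, (f x * ψ (x + h) - 2 * (f x * ψ x) + f x * ψ (x + -h)) := by
        congr 1 with x
        rw [secondDiff, ← sub_eq_add_neg]
        ring
    _ = (∫ x, f x * ψ (x + h)) - 2 * (∫ x, f x * ψ x) + ∫ x, f x * ψ (x + -h) := by
        exact integral_sub_two_mul_add (i1 h) i0 (i1 (-h))
    _ = (∫ x, f (x + h) * ψ x) - 2 * (∫ x, f x * ψ x) + ∫ x, f (x + -h) * ψ x := by
        rw [e h, e (-h)]
        simp only [sub_neg_eq_add, ← sub_eq_add_neg]
        ring
    _ = ∫ x, (f (x + h) * ψ x - 2 * (f x * ψ x) + f (x + -h) * ψ x) := by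
        exact (integral_sub_two_mul_add (i2 h) i0 (i2 (-h))).symm
    _ = _ := by
        congr 1 with x
        rw [secondDiff, ← sub_eq_add_neg]
        ring

theorem integral_hatAvg_mul {f ψ : ℝ → ℝ} (hf : Measurable f) {K : ℝ} (hK : ∀ x, |f x| ≤ K)
    (hψ : Continuous ψ) (hψc : HasCompactSupport ψ) {h : ℝ} (hh : 0 ≤ h) :
    ∫ x, hatAvg h f x * ψ x =
      ∫ x, f x * ∫ q, ψ (x - h * (q.1 - q.2)) ∂(unitMeasure.prod unitMeasure) :=
  integral_average_translate_mul _ (measurable_hat_shift h) (ae_abs_hat_shift_le hh)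
    (locallyIntegrable_of_bound hf hK) hψ hψc

theorem measurable_hatAvg_of_measurable {f : ℝ → ℝ} (hf : Measurable f) (h : ℝ) :
    Measurable (hatAvg h f) :=
  (measurable_hatAvg (v := fun _ => f) (hf.comp measurable_snd) h).comp
    (measurable_prodMk_left (x := (0 : ℝ)))

/-- The equation `∂ₜ v = ½ ∂ₓₓ p`, `v(0) = u₀`, integrated in time and averaged against hat
functions in space: for hat averages the Laplacian is exactly a second difference quotient. -/
theorem hatAvg_evolution {T : ℝ} (hT : 0 < T) {v p : ℝ → ℝ → ℝ} {u₀ : ℝ → ℝ} {K : ℝ}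
    (hv : Measurable (Function.uncurry v)) (hvK : ∀ t x, |v t x| ≤ K)
    (hp : Measurable (Function.uncurry p)) (hpK : ∀ t x, |p t x| ≤ K)
    (hu : Measurable u₀) (huK : ∀ x, |u₀ x| ≤ K)
    (hw : ∀ φ : ℝ → ℝ → ℝ, ContDiff ℝ ∞ (Function.uncurry φ) →
      HasCompactSupport (Function.uncurry φ) →
      tsupport (Function.uncurry φ) ⊆ Iio T ×ˢ univ →
      -(∫ t in Icc 0 T, ∫ x, v t x * deriv (fun s => φ s x) t) - ∫ x, u₀ x * φ 0 x =
        1 / 2 * ∫ t in Icc 0 T, ∫ x, p t x * iteratedDeriv 2 (φ t) x)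
    {h : ℝ} (hh : 0 < h) :
    ∀ᵐ q ∂(stripMeasure T), hatAvg h (v q.1) q.2 =
      hatAvg h u₀ q.2 + (2 * h ^ 2)⁻¹ * ∫ s in Ioc 0 q.1, secondDiff h (p s) q.2 := by
  have hpm := measurable_secondDiff hp h
  have hpb : ∀ t x, |secondDiff h (p t) x| ≤ 4 * K := fun t x => abs_secondDiff_le (hpK t) h x
  have hK0 : 0 ≤ K := (abs_nonneg _).trans (huK 0)
  have hvt : ∀ t, Measurable (v t) := fun t => hv.comp measurable_prodMk_left
  have hpt : ∀ t, Measurable (p t) := fun t => hp.comp measurable_prodMk_left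
  have hIm := measurable_integral_Ioc (p := fun s x => secondDiff h (p s) x) hpm
  -- Times beyond `T` are cut off to obtain a function that is bounded everywhere.
  have hIb : ∀ t x, |∫ s in Ioc 0 (min t T), secondDiff h (p s) x| ≤ 4 * K * T := by
    intro t x
    have h1 := norm_setIntegral_le_of_norm_le_const (μ := volume) (s := Ioc 0 (min t T))
      (f := fun s => secondDiff h (p s) x) (C := 4 * K) (by simp) (fun s _ => hpb s x)
    refine h1.trans (mul_le_mul_of_nonneg_left ?_ (by positivity))
    rw [measureReal_def, Real.volume_Ioc]
    refine ENNReal.toReal_le_of_le_ofReal hT.le (ENNReal.ofReal_le_ofReal ?_)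
    linarith [min_le_right t T]
  set F : ℝ → ℝ → ℝ := fun t x => hatAvg h (v t) x - hatAvg h u₀ x -
    (2 * h ^ 2)⁻¹ * ∫ s in Ioc 0 (min t T), secondDiff h (p s) x with hFdef
  have hFm : Measurable (Function.uncurry F) := by
    refine ((measurable_hatAvg hv h).sub
      ((measurable_hatAvg_of_measurable hu h).comp measurable_snd)).sub (Measurable.const_mul ?_ _)
    exact hIm.comp ((measurable_fst.min measurable_const).prodMk measurable_snd)
  have hFb : ∀ t x, |F t x| ≤ K + K + (2 * h ^ 2)⁻¹ * (4 * K * T) := by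
    intro t x
    refine (abs_sub _ _).trans (add_le_add ((abs_sub _ _).trans
      (add_le_add (abs_hatAvg_le (hvK t) h x) (abs_hatAvg_le huK h x))) ?_)
    rw [abs_mul, abs_of_nonneg (by positivity : 0 ≤ (2 * h ^ 2)⁻¹)]
    exact mul_le_mul_of_nonneg_left (hIb t x) (by positivity)
  have hF0 : ∀ᵐ q ∂(stripMeasure T), F q.1 q.2 = 0 := by
    refine ae_eq_zero_of_forall_ae_integral_eq_zero hFm hFb fun ψ hψ hψc => ?_
    obtain ⟨χ, hχ, hχc, hχq, hχd⟩ := hat_testFunction hh hψ hψc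
    have hpsi : ∀ t, ∫ x, p t x * deriv (deriv χ) x =
        (h ^ 2)⁻¹ * ∫ x, secondDiff h (p t) x * ψ x := by
      intro t
      simp_rw [hχd]
      rw [← integral_mul_secondDiff (hpt t) (hpK t) hψ.continuous hψc h, ← integral_const_mul]
      congr 1 with x
      ring
    have hI1 := intervalIntegrable_integral_mul hv hvK hχ.continuous hχc 0 T
    have hI2 := intervalIntegrable_integral_mul (v := fun s x => secondDiff h (p s) x) hpm hpb
      hψ.continuous hψc 0 T
    have hweak := ae_eq_add_integral_of_weak_deriv hT (m := fun t => ∫ x, v t x * χ x)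
      (n := fun t => (2 * h ^ 2)⁻¹ * ∫ x, secondDiff h (p t) x * ψ x) (m₀ := ∫ x, u₀ x * χ x)
      hI1 (hI2.const_mul _) ?_
    · filter_upwards [hweak, ae_restrict_mem measurableSet_Icc] with t ht htT
      have i1 : Integrable fun x => hatAvg h (v t) x * ψ x :=
        integrable_mul_of_bound (measurable_hatAvg_of_measurable (hvt t) h)
          (abs_hatAvg_le (hvK t) h) hψ.continuous hψc
      have i2 : Integrable fun x => hatAvg h u₀ x * ψ x :=
        integrable_mul_of_bound (measurable_hatAvg_of_measurable hu h)
          (abs_hatAvg_le huK h) hψ.continuous hψc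
      have i3 : Integrable fun x => (∫ s in Ioc 0 (min t T), secondDiff h (p s) x) * ψ x :=
        integrable_mul_of_bound (hIm.comp measurable_prodMk_left) (hIb t) hψ.continuous hψc
      have hfub : ∫ x, (∫ s in Ioc 0 t, secondDiff h (p s) x) * ψ x =
          ∫ s in Ioc 0 t, ∫ x, secondDiff h (p s) x * ψ x := by
        simp_rw [← integral_mul_const]
        refine integral_integral_swap (f := fun x s => secondDiff h (p s) x * ψ x) ?_
        have hψi := hψ.continuous.integrable_of_hasCompactSupport hψc (μ := volume)
        refine Integrable.mono' ((hψi.abs.const_mul (4 * K)).comp_fst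
          (volume.restrict (Ioc 0 t))) ?_ (ae_of_all _ fun q => ?_)
        · exact ((hpm.comp measurable_swap).mul
            (hψ.continuous.measurable.comp measurable_fst)).aestronglyMeasurable
        · change ‖secondDiff h (p q.2) q.1 * ψ q.1‖ ≤ 4 * K * |ψ q.1|
          rw [norm_mul]
          exact mul_le_mul_of_nonneg_right (hpb _ _) (abs_nonneg _)
      have e1 : ∫ x, F t x * ψ x = (∫ x, hatAvg h (v t) x * ψ x) -
          (∫ x, hatAvg h u₀ x * ψ x) - (2 * h ^ 2)⁻¹ *
            ∫ x, (∫ s in Ioc 0 (min t T), secondDiff h (p s) x) * ψ x := by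
        rw [← integral_const_mul, ← integral_sub i1 i2, ← integral_sub _ (i3.const_mul _)]
        · congr 1 with x
          simp only [hFdef]
          ring
        · exact i1.sub i2
      rw [e1, min_eq_left htT.2, hfub, integral_hatAvg_mul (hvt t) (hvK t) hψ.continuous hψc hh.le,
        integral_hatAvg_mul hu huK hψ.continuous hψc hh.le]
      simp_rw [← hχq]
      rw [ht, intervalIntegral.integral_const_mul, intervalIntegral.integral_of_le htT.1]
      ring
    · intro η hη hηc hηT
      have h1 := hw (fun t x => η t * χ x)
        ((hη.comp contDiff_fst).mul (hχ.comp contDiff_snd)) ?_ ?_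
      · rw [intervalIntegral.integral_of_le hT.le, intervalIntegral.integral_of_le hT.le,
          ← integral_Icc_eq_integral_Ioc, ← integral_Icc_eq_integral_Ioc]
        have e1 : ∀ t, ∫ x, v t x * deriv (fun s => η s * χ x) t =
            (∫ x, v t x * χ x) * deriv η t := by
          intro t
          rw [← integral_mul_const]
          congr 1 with x
          rw [deriv_mul_const_field]
          ring
        have e2 : ∀ t, ∫ x, p t x * iteratedDeriv 2 (fun x => η t * χ x) x =
            2 * (η t * ((2 * h ^ 2)⁻¹ * ∫ x, secondDiff h (p t) x * ψ x)) := by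
          intro t
          have e3 : (2 * h ^ 2)⁻¹ = 2⁻¹ * (h ^ 2)⁻¹ := mul_inv _ _
          rw [e3, mul_assoc, ← hpsi t]
          have e4 : iteratedDeriv 2 (fun x => η t * χ x) = fun x => η t * deriv (deriv χ) x := by
            rw [iteratedDeriv_succ, iteratedDeriv_one]
            ext x
            simp only [deriv_const_mul_field']
          rw [e4, ← integral_const_mul, ← integral_const_mul, ← integral_const_mul]
          congr 1 with x
          ring
        simp_rw [e1, e2] at h1
        rw [integral_const_mul] at h1
        have e5 : ∫ x, u₀ x * (η 0 * χ x) = (∫ x, u₀ x * χ x) * η 0 := by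
          rw [← integral_mul_const]
          congr 1 with x
          ring
        rw [e5] at h1
        rw [h1]
        ring
      · refine HasCompactSupport.intro (hηc.isCompact.prod hχc.isCompact) fun q hq => ?_
        rw [mem_prod, not_and_or] at hq
        rcases hq with hq | hq
        · simp [Function.uncurry, image_eq_zero_of_notMem_tsupport hq]
        · simp [Function.uncurry, image_eq_zero_of_notMem_tsupport hq]
      · have : tsupport (Function.uncurry fun t x => η t * χ x) ⊆ tsupport η ×ˢ univ := by
          refine closure_minimal ?_ ((isClosed_tsupport η).prod isClosed_univ)
          intro q hq
          refine ⟨subset_tsupport _ fun h0 => hq ?_, mem_univ _⟩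
          simp [Function.uncurry, h0]
        exact this.trans (prod_mono hηT subset_rfl)
  filter_upwards [hF0, ae_strip_time_mem T] with q hq hqT
  simp only [hFdef] at hq
  rw [min_eq_left hqT.2] at hq
  linarith

/-! ### A convex functional of the negative part -/

/-- The negative part of `v` with its sign, cut off at `-δ`. -/
def clipNeg (δ v : ℝ) : ℝ := max (-δ) (min v 0)

/-- The primitive of `clipNeg δ` that vanishes on `[0,∞)`: the Huber function of the negative
part. -/
noncomputable def negEnergy (δ v : ℝ) : ℝ := clipNeg δ v * v - clipNeg δ v ^ 2 / 2

theorem clipNeg_continuous (δ : ℝ) : Continuous (clipNeg δ) := by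
  unfold clipNeg
  fun_prop

theorem negEnergy_continuous (δ : ℝ) : Continuous (negEnergy δ) := by
  have := clipNeg_continuous δ
  unfold negEnergy
  fun_prop

theorem clipNeg_cases {δ : ℝ} (hδ : 0 < δ) (v : ℝ) : (v ≤ -δ ∧ clipNeg δ v = -δ) ∨
    (-δ ≤ v ∧ v ≤ 0 ∧ clipNeg δ v = v) ∨ (0 ≤ v ∧ clipNeg δ v = 0) := by
  unfold clipNeg
  rcases le_total v 0 with h0 | h0
  · rcases le_total v (-δ) with h1 | h1
    · left; exact ⟨h1, by rw [min_eq_left h0, max_eq_left h1]⟩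
    · right; left; exact ⟨h1, h0, by rw [min_eq_left h0, max_eq_right h1]⟩
  · right; right; exact ⟨h0, by rw [min_eq_right h0, max_eq_right (by linarith)]⟩

/-- `negEnergy δ` is convex with derivative `clipNeg δ` and grows at most quadratically. -/
theorem negEnergy_sub_bounds {δ : ℝ} (hδ : 0 < δ) (a b : ℝ) :
    0 ≤ negEnergy δ b - negEnergy δ a - clipNeg δ a * (b - a) ∧
      negEnergy δ b - negEnergy δ a - clipNeg δ a * (b - a) ≤ (b - a) ^ 2 := by
  unfold negEnergy
  rcases clipNeg_cases hδ a with ⟨h1, h2⟩ | ⟨h1, h1', h2⟩ | ⟨h1, h2⟩ <;>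
  rcases clipNeg_cases hδ b with ⟨h3, h4⟩ | ⟨h3, h3', h4⟩ | ⟨h3, h4⟩ <;>
  rw [h2, h4] <;> constructor <;>
    nlinarith [sq_nonneg (a - b), sq_nonneg (a + δ), sq_nonneg (b + δ)]

theorem clipNeg_sq_le {δ : ℝ} (hδ : 0 < δ) (v : ℝ) : clipNeg δ v ^ 2 ≤ 2 * negEnergy δ v := by
  unfold negEnergy
  rcases clipNeg_cases hδ v with ⟨h1, h2⟩ | ⟨h1, h1', h2⟩ | ⟨h1, h2⟩ <;> rw [h2] <;> nlinarith

theorem negEnergy_nonneg {δ : ℝ} (hδ : 0 < δ) (v : ℝ) : 0 ≤ negEnergy δ v := by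
  nlinarith [clipNeg_sq_le hδ v, sq_nonneg (clipNeg δ v)]

theorem negEnergy_of_nonneg {δ : ℝ} (hδ : 0 < δ) {v : ℝ} (hv : 0 ≤ v) : negEnergy δ v = 0 := by
  unfold negEnergy
  rcases clipNeg_cases hδ v with ⟨h1, h2⟩ | ⟨h1, h1', h2⟩ | ⟨h1, h2⟩ <;> rw [h2] <;> nlinarith

theorem nonneg_of_negEnergy_le {δ : ℝ} (hδ : 0 < δ) {v : ℝ} (hv : negEnergy δ v ≤ 0) : 0 ≤ v := by
  unfold negEnergy at hv
  rcases clipNeg_cases hδ v with ⟨h1, h2⟩ | ⟨h1, h1', h2⟩ | ⟨h1, h2⟩ <;> rw [h2] at hv <;> nlinarith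

theorem abs_clipNeg_le {δ : ℝ} (hδ : 0 < δ) (v : ℝ) : |clipNeg δ v| ≤ |v| := by
  rcases clipNeg_cases hδ v with ⟨h1, h2⟩ | ⟨h1, h1', h2⟩ | ⟨h1, h2⟩ <;> rw [h2]
  · rw [abs_neg, abs_of_pos hδ]
    exact (by linarith : δ ≤ -v).trans (neg_le_abs v)
  · simp

theorem negEnergy_le_sq {δ : ℝ} (hδ : 0 < δ) (v : ℝ) : negEnergy δ v ≤ v ^ 2 := by
  have := (negEnergy_sub_bounds hδ 0 v).2
  rw [negEnergy_of_nonneg hδ le_rfl] at this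
  have h0 : clipNeg δ 0 = 0 := by simp [clipNeg, hδ.le]
  rw [h0] at this
  linarith

/-- Convexity and the quadratic upper bound allow to change the argument of `negEnergy`. -/
theorem negEnergy_le_of_near {δ : ℝ} (hδ : 0 < δ) (u U : ℝ) :
    negEnergy δ u ≤ 2 * negEnergy δ U + 2 * (U - u) ^ 2 := by
  have h1 := (negEnergy_sub_bounds hδ U u).2
  have h2 := clipNeg_sq_le hδ U
  nlinarith [sq_nonneg (clipNeg δ U - (u - U))]

/-- On a bounded range, `negEnergy` controls the square of the negative part. -/
theorem sq_le_negEnergy {δ : ℝ} (hδ : 0 < δ) {R v : ℝ} (hv : |v| ≤ R) (hv0 : v ≤ 0) :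
    v ^ 2 ≤ 2 * (1 + R / δ) ^ 2 * negEnergy δ v := by
  have hR : 0 ≤ R := (abs_nonneg v).trans hv
  have hq : 0 ≤ R / δ := by positivity
  have h1 : |v| ≤ (1 + R / δ) * |clipNeg δ v| := by
    rcases clipNeg_cases hδ v with ⟨h1, h2⟩ | ⟨h1, h1', h2⟩ | ⟨h1, h2⟩ <;> rw [h2]
    · rw [abs_neg, abs_of_pos hδ, add_mul, div_mul_cancel₀ _ hδ.ne']
      linarith
    · nlinarith [abs_nonneg v]
    · have : v = 0 := le_antisymm hv0 h1
      simp [this]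
  have h2 : v ^ 2 ≤ ((1 + R / δ) * |clipNeg δ v|) ^ 2 := by
    rw [← sq_abs v]
    exact pow_le_pow_left₀ (abs_nonneg v) h1 2
  rw [mul_pow, sq_abs] at h2
  nlinarith [clipNeg_sq_le hδ v, sq_nonneg (1 + R / δ)]

/-- The slope of `clipNeg` lies in `[0,1]`, and it vanishes if both arguments are below `-δ` or
both are nonnegative. -/
theorem exists_clipNeg_slope {δ : ℝ} (hδ : 0 < δ) (a b : ℝ) : ∃ S, 0 ≤ S ∧ S ≤ 1 ∧
    clipNeg δ b - clipNeg δ a = S * (b - a) ∧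
      (S = 0 ∨ ((-δ ≤ a ∨ -δ ≤ b) ∧ (a < 0 ∨ b < 0))) := by
  by_cases hz : clipNeg δ b - clipNeg δ a = 0
  · exact ⟨0, le_rfl, zero_le_one, by rw [hz]; ring, Or.inl rfl⟩
  have hab : b - a ≠ 0 := by
    intro h
    apply hz
    rw [sub_eq_zero] at h
    rw [h, sub_self]
  refine ⟨(clipNeg δ b - clipNeg δ a) / (b - a), ?_, ?_, (div_mul_cancel₀ _ hab).symm,
    Or.inr ⟨?_, ?_⟩⟩
  · rcases lt_or_gt_of_ne hab with h | h
    · rw [div_nonneg_iff]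
      right
      refine ⟨?_, h.le⟩
      rcases clipNeg_cases hδ a with ⟨h1, h2⟩ | ⟨h1, h1', h2⟩ | ⟨h1, h2⟩ <;>
      rcases clipNeg_cases hδ b with ⟨h3, h4⟩ | ⟨h3, h3', h4⟩ | ⟨h3, h4⟩ <;>
      rw [h2, h4] <;> linarith
    · rw [div_nonneg_iff]
      left
      refine ⟨?_, h.le⟩
      rcases clipNeg_cases hδ a with ⟨h1, h2⟩ | ⟨h1, h1', h2⟩ | ⟨h1, h2⟩ <;>
      rcases clipNeg_cases hδ b with ⟨h3, h4⟩ | ⟨h3, h3', h4⟩ | ⟨h3, h4⟩ <;>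
      rw [h2, h4] <;> linarith
  · rcases lt_or_gt_of_ne hab with h | h
    · rw [div_le_one_of_neg h]
      rcases clipNeg_cases hδ a with ⟨h1, h2⟩ | ⟨h1, h1', h2⟩ | ⟨h1, h2⟩ <;>
      rcases clipNeg_cases hδ b with ⟨h3, h4⟩ | ⟨h3, h3', h4⟩ | ⟨h3, h4⟩ <;>
      rw [h2, h4] <;> linarith
    · rw [div_le_one h]
      rcases clipNeg_cases hδ a with ⟨h1, h2⟩ | ⟨h1, h1', h2⟩ | ⟨h1, h2⟩ <;>
      rcases clipNeg_cases hδ b with ⟨h3, h4⟩ | ⟨h3, h3', h4⟩ | ⟨h3, h4⟩ <;>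
      rw [h2, h4] <;> linarith
  · by_contra! h
    apply hz
    simp only [clipNeg]
    rw [min_eq_left (by linarith), min_eq_left (by linarith), max_eq_left h.1.le,
      max_eq_left h.2.le, sub_self]
  · by_contra! h
    apply hz
    simp only [clipNeg]
    rw [min_eq_right h.1, min_eq_right h.2, sub_self]

theorem hasDerivAt_negEnergy {δ : ℝ} (hδ : 0 < δ) (v : ℝ) :
    HasDerivAt (negEnergy δ) (clipNeg δ v) v := by
  rw [hasDerivAt_iff_isLittleO]
  have h1 : (fun w => negEnergy δ w - negEnergy δ v - (w - v) • clipNeg δ v) =O[𝓝 v]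
      fun w => (w - v) ^ 2 := by
    refine Asymptotics.IsBigO.of_bound 1 (Eventually.of_forall fun w => ?_)
    have := negEnergy_sub_bounds hδ v w
    rw [smul_eq_mul, mul_comm, Real.norm_eq_abs, abs_of_nonneg this.1, Real.norm_eq_abs, one_mul]
    exact this.2.trans (le_abs_self _)
  refine h1.trans_isLittleO ?_
  simpa using (Asymptotics.isLittleO_pow_sub_sub v (m := 2) (by norm_num))

theorem abs_clipNeg_le_const {δ : ℝ} (hδ : 0 < δ) (v : ℝ) : |clipNeg δ v| ≤ δ := by
  rw [abs_le]
  rcases clipNeg_cases hδ v with ⟨h1, h2⟩ | ⟨h1, h1', h2⟩ | ⟨h1, h2⟩ <;> rw [h2] <;>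
    constructor <;> linarith

theorem lipschitzWith_negEnergy {δ : ℝ} (hδ : 0 < δ) : LipschitzWith ⟨δ, hδ.le⟩ (negEnergy δ) :=
  lipschitzWith_of_nnnorm_deriv_le (fun v => (hasDerivAt_negEnergy hδ v).differentiableAt)
    fun v => by
      rw [(hasDerivAt_negEnergy hδ v).deriv]
      exact abs_clipNeg_le_const hδ v

/-- The energy balance in time, with a weight that absorbs linear growth. -/
theorem negEnergy_weighted_le {δ : ℝ} (hδ : 0 < δ) {T : ℝ} {n : ℝ → ℝ}
    (hn : IntervalIntegrable n volume 0 T) {B : ℝ} (hB : ∀ t, |n t| ≤ B) {c : ℝ} (hc : 0 ≤ c)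
    (l : ℝ) :
    l * ∫ t in (0 : ℝ)..T, Real.exp (-(l * t)) * negEnergy δ (c + ∫ s in (0 : ℝ)..t, n s) ≤
      ∫ t in (0 : ℝ)..T, Real.exp (-(l * t)) * clipNeg δ (c + ∫ s in (0 : ℝ)..t, n s) * n t := by
  set F : ℝ → ℝ := fun t => c + ∫ s in (0 : ℝ)..t, n s with hF
  have hFd : ∀ᵐ t, t ∈ uIcc 0 T → HasDerivAt F (n t) t := by
    filter_upwards [hn.ae_hasDerivAt_integral] with t ht h
    exact (ht h 0 (by simp)).const_add c
  have hFL : LipschitzOnWith ⟨|B|, abs_nonneg B⟩ F (uIcc 0 T) := by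
    refine LipschitzOnWith.of_dist_le_mul fun x hx y hy => ?_
    rw [hF, dist_add_left, Real.dist_eq, Real.dist_eq,
      intervalIntegral.integral_interval_sub_left
        (hn.mono_set (uIcc_subset_uIcc left_mem_uIcc hx))
        (hn.mono_set (uIcc_subset_uIcc left_mem_uIcc hy))]
    exact intervalIntegral.norm_integral_le_of_norm_le_const (f := n) (C := |B|) fun t _ =>
      (hB t).trans (le_abs_self B)
  have hΦF : AbsolutelyContinuousOnInterval (fun t => negEnergy δ (F t)) 0 T :=
    ((lipschitzWith_negEnergy hδ).comp_lipschitzOnWith hFL).absolutelyContinuousOnInterval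
  have hwd : ∀ t, HasDerivAt (fun t => Real.exp (-(l * t))) (Real.exp (-(l * t)) * -l) t := by
    intro t
    have := ((hasDerivAt_id t).const_mul l).neg.exp
    simpa using this
  have hw : AbsolutelyContinuousOnInterval (fun t => Real.exp (-(l * t))) 0 T := by
    have : ContDiff ℝ 1 fun t : ℝ => Real.exp (-(l * t)) :=
      (contDiff_const.mul contDiff_id).neg.exp
    exact this.contDiffOn.absolutelyContinuousOnInterval
  have h1 := hw.integral_deriv_mul_eq_sub hΦF
  have e1 : ∫ t in (0 : ℝ)..T, (deriv (fun t => Real.exp (-(l * t))) t * negEnergy δ (F t) +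
      Real.exp (-(l * t)) * deriv (fun t => negEnergy δ (F t)) t) =
      ∫ t in (0 : ℝ)..T, (-l * (Real.exp (-(l * t)) * negEnergy δ (F t)) +
        Real.exp (-(l * t)) * clipNeg δ (F t) * n t) := by
    refine intervalIntegral.integral_congr_ae ?_
    filter_upwards [hFd] with t ht h
    have hcomp : HasDerivAt (fun t => negEnergy δ (F t)) (clipNeg δ (F t) * n t) t :=
      (hasDerivAt_negEnergy hδ (F t)).comp t (ht (uIoc_subset_uIcc h))
    rw [(hwd t).deriv, hcomp.deriv]
    ring
  have hFc : ContinuousOn F (uIcc 0 T) := hFL.continuousOn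
  have hwc : Continuous fun t => Real.exp (-(l * t)) := by fun_prop
  have i1 : IntervalIntegrable (fun t => Real.exp (-(l * t)) * negEnergy δ (F t)) volume 0 T :=
    (hwc.continuousOn.mul hΦF.continuousOn).intervalIntegrable
  have i2 : IntervalIntegrable (fun t => Real.exp (-(l * t)) * clipNeg δ (F t) * n t)
      volume 0 T :=
    hn.continuousOn_mul (hwc.continuousOn.mul ((clipNeg_continuous δ).comp_continuousOn hFc))
  rw [e1, intervalIntegral.integral_add (i1.const_mul _) i2,
    intervalIntegral.integral_const_mul] at h1
  have hF0 : negEnergy δ (F 0) = 0 := negEnergy_of_nonneg hδ (by simpa [hF] using hc)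
  have hFT : 0 ≤ Real.exp (-(l * T)) * negEnergy δ (F T) :=
    mul_nonneg (Real.exp_pos _).le (negEnergy_nonneg hδ _)
  rw [hF0] at h1
  linarith

/-- The pointwise form of the energy estimate. Here `a, b` are the values of a solution at two
points at distance `h`, `Ua, Ub` those of its hat average, and `Y₁ + Y₂` is the increment of the
flux, with a monotone part `Y₁` and a part `Y₂` caused by the explicit dependence on space.
Because `clipNeg` is constant below `-δ`, the monotonicity is needed only for values above
`-2δ`. -/
theorem energy_pointwise {δ c C R h a b Ua Ub Y₁ Y₂ : ℝ} (hδ : 0 < δ) (hc : 0 < c)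
    (hR : 0 ≤ R) (hh : 0 < h) (hh1 : h ≤ 1)
    (hY₁ : -(2 * δ) ≤ a → -(2 * δ) ≤ b → c * (b - a) ^ 2 ≤ Y₁ * (b - a))
    (hY₂ : |Y₂| ≤ C * (h * |a|)) (hY : |Y₁ + Y₂| ≤ C * (h * |a| + |b - a|))
    (hab : |b - a| ≤ δ / 2) (ha : |Ua - a| ≤ δ / 2) (hb : |Ub - b| ≤ δ / 2) (hUa : |Ua| ≤ R) :
    -((clipNeg δ Ub - clipNeg δ Ua) * (Y₁ + Y₂)) ≤
      (C ^ 2 / (4 * c) * (4 + 4 * (1 + R / δ) ^ 2) + C ^ 2 + 1) *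
        (h ^ 2 * negEnergy δ Ua + h ^ 2 * (Ua - a) ^ 2 + h * (b - a) ^ 2 +
          ((Ub - Ua) - (b - a)) ^ 2 / h + h ^ 3 * a ^ 2) := by
  obtain ⟨S, hS0, hS1, hS, hS'⟩ := exists_clipNeg_slope hδ Ua Ub
  set d := b - a with hd
  set e := (Ub - Ua) - d with he
  set Y := Y₁ + Y₂ with hYdef
  set M := 2 * (1 + R / δ) ^ 2 with hM
  have hM0 : 0 ≤ M := by positivity
  have hΦ := negEnergy_nonneg hδ Ua
  have hUd : Ub - Ua = d + e := by rw [he]; ring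
  set Q := C ^ 2 / (4 * c) with hQ
  have hQ0 : 0 ≤ Q := by positivity
  clear_value Q e d Y M
  -- Young's inequality for the averaging error.
  have h1 : -(S * e * Y) ≤ e ^ 2 / (2 * h) + h * (C ^ 2 * (h ^ 2 * a ^ 2 + d ^ 2)) := by
    have hY2 : Y ^ 2 ≤ 2 * (C ^ 2 * (h ^ 2 * a ^ 2 + d ^ 2)) := by
      have : Y ^ 2 ≤ (C * (h * |a| + |d|)) ^ 2 := by
        rw [← sq_abs Y]
        exact pow_le_pow_left₀ (abs_nonneg _) hY 2
      rw [mul_pow] at this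
      have h3 : (h * |a| + |d|) ^ 2 ≤ 2 * (h ^ 2 * a ^ 2 + d ^ 2) := by
        rw [← sq_abs a, ← sq_abs d]
        nlinarith [sq_nonneg (h * |a| - |d|)]
      nlinarith [mul_le_mul_of_nonneg_left h3 (sq_nonneg C)]
    have h4 : -(S * e * Y) ≤ e ^ 2 / (2 * h) + h / 2 * (S * Y) ^ 2 := by
      have h5 : e ^ 2 / (2 * h) + h / 2 * (S * Y) ^ 2 + S * e * Y =
          (e + h * (S * Y)) ^ 2 / (2 * h) := by
        field_simp
        ring
      have h6 : 0 ≤ (e + h * (S * Y)) ^ 2 / (2 * h) := by positivity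
      linarith
    have h7 : (S * Y) ^ 2 ≤ Y ^ 2 := by
      rw [mul_pow]
      exact mul_le_of_le_one_left (sq_nonneg _) (pow_le_one₀ hS0 hS1)
    have h8 : h / 2 * (S * Y) ^ 2 ≤ h / 2 * (2 * (C ^ 2 * (h ^ 2 * a ^ 2 + d ^ 2))) :=
      mul_le_mul_of_nonneg_left (h7.trans hY2) (by positivity)
    linarith
  have h2 : -(S * d * Y) ≤ S * (Q * (h ^ 2 * a ^ 2)) ∧
      S * a ^ 2 ≤ 2 * (Ua - a) ^ 2 + 4 * d ^ 2 + 4 * e ^ 2 + 2 * M * negEnergy δ Ua := by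
    rcases hS' with rfl | ⟨hlow, hneg⟩
    · constructor
      · simp
      · rw [zero_mul]
        positivity
    · rw [abs_le] at hab ha hb
      have hab' : -(2 * δ) ≤ a ∧ -(2 * δ) ≤ b := by
        rcases hlow with hl | hl <;> constructor <;> linarith
      constructor
      · have hm := hY₁ hab'.1 hab'.2
        have h3 : -(d * Y₂) ≤ c * d ^ 2 + Q * (h ^ 2 * a ^ 2) := by
          have h4 : Y₂ ^ 2 ≤ C ^ 2 * (h ^ 2 * a ^ 2) := by
            rw [← sq_abs Y₂, ← sq_abs a, ← mul_pow, ← mul_pow]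
            exact pow_le_pow_left₀ (abs_nonneg _) hY₂ 2
          have h5 : c * d ^ 2 + Y₂ ^ 2 / (4 * c) + d * Y₂ = (2 * c * d + Y₂) ^ 2 / (4 * c) := by
            field_simp
            ring
          have h6 : 0 ≤ (2 * c * d + Y₂) ^ 2 / (4 * c) := by positivity
          have h7 : Y₂ ^ 2 / (4 * c) ≤ Q * (h ^ 2 * a ^ 2) := by
            rw [hQ, div_mul_eq_mul_div]
            gcongr
          linarith
        have h8 : -(d * Y) ≤ Q * (h ^ 2 * a ^ 2) := by
          rw [hYdef, mul_add]
          linarith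
        calc -(S * d * Y) = S * (-(d * Y)) := by ring
          _ ≤ _ := mul_le_mul_of_nonneg_left h8 hS0
      · have hSa : S * a ^ 2 ≤ a ^ 2 := mul_le_of_le_one_left (sq_nonneg _) hS1
        refine hSa.trans ?_
        have h3 : a ^ 2 ≤ 2 * (Ua - a) ^ 2 + 2 * Ua ^ 2 := by
          nlinarith [sq_nonneg (2 * Ua - a)]
        -- If `Ua ≥ 0 > Ub`, then the increment `Ub - Ua` dominates `Ua`.
        rcases lt_or_ge Ua 0 with hU | hU
        · have h4 : Ua ^ 2 ≤ M * negEnergy δ Ua := hM ▸ sq_le_negEnergy hδ hUa hU.le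
          linarith [sq_nonneg d, sq_nonneg e]
        · have hUb : Ub < 0 := by
            rcases hneg with h | h
            · linarith
            · exact h
          have h4 : Ua ^ 2 ≤ (Ub - Ua) ^ 2 :=
            (pow_le_pow_left₀ hU (by linarith : Ua ≤ Ua - Ub) 2).trans_eq (by ring)
          rw [hUd] at h4
          have h5 : (d + e) ^ 2 ≤ 2 * d ^ 2 + 2 * e ^ 2 := add_sq_le.trans_eq (by ring)
          linarith [mul_nonneg hM0 hΦ]
  have hXY : -((clipNeg δ Ub - clipNeg δ Ua) * Y) = -(S * d * Y) + -(S * e * Y) := by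
    rw [hS, hUd]
    ring
  rw [hXY]
  have h3 : S * (Q * (h ^ 2 * a ^ 2)) ≤ Q * h ^ 2 *
      (2 * (Ua - a) ^ 2 + 4 * d ^ 2 + 4 * e ^ 2 + 2 * M * negEnergy δ Ua) := by
    calc S * (Q * (h ^ 2 * a ^ 2)) = Q * h ^ 2 * (S * a ^ 2) := by ring
      _ ≤ _ := mul_le_mul_of_nonneg_left h2.2 (by positivity)
  set E := e ^ 2 / h with hE
  have hE0 : 0 ≤ E := by positivity
  have hE2 : e ^ 2 / (2 * h) = E / 2 := by
    rw [hE]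
    field_simp
  have hE3 : h ^ 2 * e ^ 2 ≤ E := by
    have : e ^ 2 = E * h := by
      rw [hE]
      field_simp
    rw [this]
    have h3 : h ^ 3 ≤ 1 := pow_le_one₀ hh.le hh1
    calc h ^ 2 * (E * h) = h ^ 3 * E := by ring
      _ ≤ E := mul_le_of_le_one_left hE0 h3
  have hd3 : h ^ 2 * d ^ 2 ≤ h * d ^ 2 := by
    have : h ^ 2 ≤ h := by
      rw [sq]
      exact mul_le_of_le_one_left hh.le hh1
    exact mul_le_mul_of_nonneg_right this (sq_nonneg d)
  rw [hE2] at h1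
  have hMM : 4 * (1 + R / δ) ^ 2 = 2 * M := by rw [hM]; ring
  rw [hMM]
  have hsum := add_le_add (h2.1.trans h3) h1
  refine hsum.trans ?_
  have q1 := mul_le_mul_of_nonneg_left hE3 hQ0
  have q2 := mul_le_mul_of_nonneg_left hd3 hQ0
  have t1 : 0 ≤ h ^ 2 * negEnergy δ Ua := by positivity
  have t2 : 0 ≤ h ^ 2 * (Ua - a) ^ 2 := by positivity
  have t3 : 0 ≤ h * d ^ 2 := by positivity
  have t4 : 0 ≤ h ^ 3 * a ^ 2 := by positivity
  have hC2 := sq_nonneg C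
  have r1 := mul_nonneg (mul_nonneg hQ0 hM0) t2
  have r2 := mul_nonneg (mul_nonneg hQ0 hM0) t3
  have r3 := mul_nonneg (mul_nonneg hQ0 hM0) t4
  have r4 := mul_nonneg (mul_nonneg hQ0 hM0) hE0
  have s1 := mul_nonneg hQ0 t1
  have s2 := mul_nonneg hQ0 t2
  have s4 := mul_nonneg hQ0 t4
  have c1 := mul_nonneg hC2 t1
  have c2 := mul_nonneg hC2 t2
  have c4 := mul_nonneg hC2 hE0
  linarith

/-! ### Square integrable functions on the strip -/

theorem measurePreserving_strip_translate (T a : ℝ) :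
    MeasurePreserving (fun q : ℝ × ℝ => (q.1, q.2 + a)) (stripMeasure T) (stripMeasure T) :=
  (MeasurePreserving.id (volume.restrict (Icc 0 T))).prod (measurePreserving_add_right volume a)

theorem memLp_two_of_lintegral_le {α : Type*} [MeasurableSpace α] {μ : Measure α} {f : α → ℝ}
    (hf : AEStronglyMeasurable f μ) {c : ℝ} (hc : 0 ≤ c)
    (h : ∫⁻ x, ‖f x‖ₑ ^ 2 ∂μ ≤ ENNReal.ofReal c) :
    MemLp f 2 μ ∧ ∫ x, f x ^ 2 ∂μ ≤ c := by
  constructor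
  · refine ⟨hf, ?_⟩
    rw [lintegral_enorm_sq_eq] at h
    exact (ENNReal.pow_lt_top_iff.1 (h.trans_lt ENNReal.ofReal_lt_top)).resolve_right (by norm_num)
  · rw [integral_eq_lintegral_of_nonneg_ae (ae_of_all _ fun x => sq_nonneg _) (hf.pow 2)]
    refine ENNReal.toReal_le_of_le_ofReal hc (le_trans (le_of_eq ?_) h)
    congr 1 with x
    rw [Real.enorm_eq_ofReal_abs, ← ENNReal.ofReal_pow (abs_nonneg _), sq_abs]

theorem MemLp.strip_translate {T : ℝ} {F : ℝ → ℝ → ℝ}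
    (hF : MemLp (fun q : ℝ × ℝ => F q.1 q.2) 2 (stripMeasure T)) (a : ℝ) :
    MemLp (fun q : ℝ × ℝ => F q.1 (q.2 + a)) 2 (stripMeasure T) :=
  hF.comp_measurePreserving (measurePreserving_strip_translate T a)

theorem MemLp.integrable_mul_two {α : Type*} [MeasurableSpace α] {μ : Measure α} {f g : α → ℝ}
    (hf : MemLp f 2 μ) (hg : MemLp g 2 μ) : Integrable (fun x => f x * g x) μ :=
  hf.integrable_mul hg

theorem integral_strip_translate {T : ℝ} (F : ℝ → ℝ → ℝ) (a : ℝ) :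
    ∫ q, F q.1 (q.2 + a) ∂(stripMeasure T) = ∫ q, F q.1 q.2 ∂(stripMeasure T) := by
  have he : MeasurableEmbedding fun q : ℝ × ℝ => (q.1, q.2 + a) :=
    ((MeasurableEquiv.refl ℝ).prodCongr (MeasurableEquiv.addRight a)).measurableEmbedding
  exact (measurePreserving_strip_translate T a).integral_comp he fun q => F q.1 q.2

theorem MemLp.strip_secondDiff {T : ℝ} {G : ℝ → ℝ → ℝ}
    (hG : MemLp (fun q : ℝ × ℝ => G q.1 q.2) 2 (stripMeasure T)) (h : ℝ) :
    MemLp (fun q : ℝ × ℝ => secondDiff h (G q.1) q.2) 2 (stripMeasure T) :=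
  ((MemLp.strip_translate hG h).sub (hG.const_mul 2)).add (MemLp.strip_translate hG (-h))

/-- Summation by parts in space. -/
theorem integral_strip_mul_secondDiff {T : ℝ} {F G : ℝ → ℝ → ℝ}
    (hF : MemLp (fun q : ℝ × ℝ => F q.1 q.2) 2 (stripMeasure T))
    (hG : MemLp (fun q : ℝ × ℝ => G q.1 q.2) 2 (stripMeasure T)) (h : ℝ) :
    ∫ q, F q.1 q.2 * secondDiff h (G q.1) q.2 ∂(stripMeasure T) =
      -∫ q, (F q.1 (q.2 + h) - F q.1 q.2) * (G q.1 (q.2 + h) - G q.1 q.2) ∂(stripMeasure T) := by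
  have hFh := MemLp.strip_translate hF h
  have hGh := MemLp.strip_translate hG h
  have hGm := MemLp.strip_translate hG (-h)
  have i1 := MemLp.integrable_mul_two hF hGh
  have i2 := MemLp.integrable_mul_two hF hG
  have i3 := MemLp.integrable_mul_two hF hGm
  have i4 := MemLp.integrable_mul_two hFh hGh
  have i5 := MemLp.integrable_mul_two hFh hG
  have e1 : ∫ q, F q.1 (q.2 + h) * G q.1 (q.2 + h) ∂(stripMeasure T) =
      ∫ q, F q.1 q.2 * G q.1 q.2 ∂(stripMeasure T) :=
    integral_strip_translate (fun t x => F t x * G t x) h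
  have e2 : ∫ q, F q.1 (q.2 + h) * G q.1 q.2 ∂(stripMeasure T) =
      ∫ q, F q.1 q.2 * G q.1 (q.2 + -h) ∂(stripMeasure T) := by
    rw [← integral_strip_translate (fun t x => F t x * G t (x + -h)) h]
    simp
  have l1 : ∫ q, F q.1 q.2 * secondDiff h (G q.1) q.2 ∂(stripMeasure T) =
      (∫ q, F q.1 q.2 * G q.1 (q.2 + h) ∂(stripMeasure T)) -
        2 * (∫ q, F q.1 q.2 * G q.1 q.2 ∂(stripMeasure T)) +
        ∫ q, F q.1 q.2 * G q.1 (q.2 + -h) ∂(stripMeasure T) := by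
    rw [← integral_const_mul, ← integral_sub i1 (i2.const_mul 2), ← integral_add _ i3]
    · congr 1 with q
      rw [secondDiff, ← sub_eq_add_neg]
      ring
    · exact i1.sub (i2.const_mul 2)
  have l2 : ∫ q, (F q.1 (q.2 + h) - F q.1 q.2) * (G q.1 (q.2 + h) - G q.1 q.2) ∂(stripMeasure T) =
      (∫ q, F q.1 (q.2 + h) * G q.1 (q.2 + h) ∂(stripMeasure T)) -
        (∫ q, F q.1 (q.2 + h) * G q.1 q.2 ∂(stripMeasure T)) -
        (∫ q, F q.1 q.2 * G q.1 (q.2 + h) ∂(stripMeasure T)) +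
        ∫ q, F q.1 q.2 * G q.1 q.2 ∂(stripMeasure T) := by
    rw [← integral_sub i4 i5, ← integral_sub _ i1, ← integral_add _ i2]
    · congr 1 with q
      ring
    · exact (i4.sub i5).sub i1
    · exact i4.sub i5
  rw [l1, l2, e1, e2]
  ring

/-- Bounds that hold for each value of an auxiliary random parameter hold on average. -/
theorem lintegral_average_sq_le {α Ω : Type*} [MeasurableSpace α] [MeasurableSpace Ω]
    {μ : Measure α} [SFinite μ] {ν : Measure Ω} [IsProbabilityMeasure ν] {D : α → Ω → ℝ}
    (hD : Measurable (Function.uncurry D)) {c : ℝ≥0∞}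
    (h : ∀ᵐ w ∂ν, ∫⁻ x, ‖D x w‖ₑ ^ 2 ∂μ ≤ c) :
    ∫⁻ x, ‖∫ w, D x w ∂ν‖ₑ ^ 2 ∂μ ≤ c := by
  calc ∫⁻ x, ‖∫ w, D x w ∂ν‖ₑ ^ 2 ∂μ ≤ ∫⁻ x, ∫⁻ w, ‖D x w‖ₑ ^ 2 ∂ν ∂μ :=
        lintegral_mono fun x =>
          enorm_integral_sq_le (hD.comp measurable_prodMk_left).aestronglyMeasurable
    _ = ∫⁻ w, ∫⁻ x, ‖D x w‖ₑ ^ 2 ∂μ ∂ν :=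
        lintegral_lintegral_swap (hD.enorm.pow_const 2).aemeasurable
    _ ≤ ∫⁻ _, c ∂ν := lintegral_mono_ae h
    _ = c := by simp

/-! ### Hat averages of regular functions -/

theorem integrable_hat {f : ℝ → ℝ} (hf : Measurable f) {K : ℝ} (hK : ∀ x, |f x| ≤ K) (h x : ℝ) :
    Integrable (fun q : ℝ × ℝ => f (x + h * (q.1 - q.2))) (unitMeasure.prod unitMeasure) :=
  Integrable.of_bound (C := K)
    (hf.comp ((measurable_hat_shift h).const_add x)).aestronglyMeasurable
    (ae_of_all _ fun _ => hK _)

theorem hatAvg_sub_self {f : ℝ → ℝ} (hf : Measurable f) {K : ℝ} (hK : ∀ x, |f x| ≤ K) (h x : ℝ) :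
    hatAvg h f x - f x =
      ∫ q, (f (x + h * (q.1 - q.2)) - f x) ∂(unitMeasure.prod unitMeasure) := by
  rw [integral_sub (integrable_hat hf hK h x) (integrable_const _), hatAvg]
  simp

theorem hatAvg_nonneg {f : ℝ → ℝ} (hf : ∀ x, 0 ≤ f x) (h x : ℝ) : 0 ≤ hatAvg h f x :=
  integral_nonneg fun _ => hf _

namespace StripRegular

variable {T K : ℝ} {u : ℝ → ℝ → ℝ}

theorem measurable_slice (hu : StripRegular T K u) (t : ℝ) : Measurable (u t) :=
  hu.measurable.comp measurable_prodMk_left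

theorem memLp (hu : StripRegular T K u) : MemLp (fun q : ℝ × ℝ => u q.1 q.2) 2 (stripMeasure T) ∧
    ∫ q, u q.1 q.2 ^ 2 ∂(stripMeasure T) ≤ K :=
  memLp_two_of_lintegral_le hu.measurable.aestronglyMeasurable hu.nonneg hu.sq_le

theorem memLp_diff (hu : StripRegular T K u) (a : ℝ) :
    MemLp (fun q : ℝ × ℝ => u q.1 (q.2 + a) - u q.1 q.2) 2 (stripMeasure T) ∧
    ∫ q, (u q.1 (q.2 + a) - u q.1 q.2) ^ 2 ∂(stripMeasure T) ≤ a ^ 2 * K :=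
  memLp_two_of_lintegral_le ((hu.measurable.uncurry_translate a).sub
    hu.measurable).aestronglyMeasurable (mul_nonneg (sq_nonneg a) hu.nonneg) (hu.diff_le a)

theorem measurable_hatIntegrand (hu : StripRegular T K u) (h a : ℝ) :
    Measurable fun z : (ℝ × ℝ) × (ℝ × ℝ) => u z.1.1 (z.1.2 + a + h * (z.2.1 - z.2.2)) := by
  have hc : Measurable fun z : (ℝ × ℝ) × (ℝ × ℝ) =>
      (z.1.1, z.1.2 + a + h * (z.2.1 - z.2.2)) := by fun_prop
  exact hu.measurable.comp hc

/-- The hat average of width `h` is `O(h)`-close in `L²`. -/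
theorem memLp_hatAvg_sub (hu : StripRegular T K u) {h : ℝ} (hh : 0 ≤ h) :
    MemLp (fun q : ℝ × ℝ => hatAvg h (u q.1) q.2 - u q.1 q.2) 2 (stripMeasure T) ∧
    ∫ q, (hatAvg h (u q.1) q.2 - u q.1 q.2) ^ 2 ∂(stripMeasure T) ≤ h ^ 2 * K := by
  refine memLp_two_of_lintegral_le (f := fun q : ℝ × ℝ => hatAvg h (u q.1) q.2 - u q.1 q.2)
    ((measurable_hatAvg hu.measurable h).sub hu.measurable).aestronglyMeasurable
    (mul_nonneg (sq_nonneg h) hu.nonneg) ?_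
  have e : ∀ q : ℝ × ℝ, hatAvg h (u q.1) q.2 - u q.1 q.2 =
      ∫ r, (u q.1 (q.2 + h * (r.1 - r.2)) - u q.1 q.2) ∂(unitMeasure.prod unitMeasure) :=
    fun q => hatAvg_sub_self (hu.measurable_slice _) (hu.abs_le _) h q.2
  simp_rw [e]
  refine lintegral_average_sq_le
    (D := fun (q : ℝ × ℝ) (r : ℝ × ℝ) => u q.1 (q.2 + h * (r.1 - r.2)) - u q.1 q.2) ?_ ?_
  · have := hu.measurable_hatIntegrand h 0
    simp only [add_zero] at this
    exact this.sub (hu.measurable.comp measurable_fst)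
  · filter_upwards [ae_abs_hat_shift_le hh] with r hr
    refine (hu.diff_le _).trans (ENNReal.ofReal_le_ofReal
      (mul_le_mul_of_nonneg_right ?_ hu.nonneg))
    rw [← sq_abs]
    exact pow_le_pow_left₀ (abs_nonneg _) hr 2

/-- For increments over distance `h`, the hat average of width `h` is even `O(h²)`-close. -/
theorem memLp_hatAvg_diff_sub (hu : StripRegular T K u) {h : ℝ} (hh : 0 ≤ h) :
    MemLp (fun q : ℝ × ℝ => (hatAvg h (u q.1) (q.2 + h) - hatAvg h (u q.1) q.2) -
      (u q.1 (q.2 + h) - u q.1 q.2)) 2 (stripMeasure T) ∧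
    ∫ q, ((hatAvg h (u q.1) (q.2 + h) - hatAvg h (u q.1) q.2) -
      (u q.1 (q.2 + h) - u q.1 q.2)) ^ 2 ∂(stripMeasure T) ≤ h ^ 4 * K := by
  have hm := measurable_hatAvg hu.measurable h
  have hmh : Measurable fun q : ℝ × ℝ => hatAvg h (u q.1) (q.2 + h) :=
    Measurable.uncurry_translate (u := fun t => hatAvg h (u t)) hm h
  have hum := hu.measurable.uncurry_translate h
  refine memLp_two_of_lintegral_le (f := fun q : ℝ × ℝ =>
      (hatAvg h (u q.1) (q.2 + h) - hatAvg h (u q.1) q.2) - (u q.1 (q.2 + h) - u q.1 q.2))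
    ((hmh.sub hm).sub (hum.sub hu.measurable)).aestronglyMeasurable
    (mul_nonneg (by positivity) hu.nonneg) ?_
  have e : ∀ q : ℝ × ℝ, (hatAvg h (u q.1) (q.2 + h) - hatAvg h (u q.1) q.2) -
      (u q.1 (q.2 + h) - u q.1 q.2) = ∫ r, ((u q.1 (q.2 + h + h * (r.1 - r.2)) - u q.1 (q.2 + h)) -
        (u q.1 (q.2 + h * (r.1 - r.2)) - u q.1 q.2)) ∂(unitMeasure.prod unitMeasure) := by
    intro q
    have hs := hu.measurable_slice q.1
    have hb := hu.abs_le q.1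
    have i1 : ∀ x, Integrable (fun r : ℝ × ℝ => u q.1 (x + h * (r.1 - r.2)) - u q.1 x)
        (unitMeasure.prod unitMeasure) := fun x =>
      (integrable_hat hs hb h x).sub (integrable_const _)
    rw [integral_sub (i1 _) (i1 _), ← hatAvg_sub_self hs hb, ← hatAvg_sub_self hs hb]
    ring
  simp_rw [e]
  refine lintegral_average_sq_le
    (D := fun (q : ℝ × ℝ) (r : ℝ × ℝ) => (u q.1 (q.2 + h + h * (r.1 - r.2)) - u q.1 (q.2 + h)) -
        (u q.1 (q.2 + h * (r.1 - r.2)) - u q.1 q.2)) ?_ ?_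
  · have := hu.measurable_hatIntegrand h 0
    simp only [add_zero] at this
    exact ((hu.measurable_hatIntegrand h h).sub (hum.comp measurable_fst)).sub
      (this.sub (hu.measurable.comp measurable_fst))
  · filter_upwards [ae_abs_hat_shift_le hh] with r hr
    refine (hu.diff_diff_le _ _).trans (ENNReal.ofReal_le_ofReal
      (mul_le_mul_of_nonneg_right ?_ hu.nonneg))
    have : (h * (r.1 - r.2)) ^ 2 ≤ h ^ 2 := by
      rw [← sq_abs]
      exact pow_le_pow_left₀ (abs_nonneg _) hr 2
    calc h ^ 2 * (h * (r.1 - r.2)) ^ 2 ≤ h ^ 2 * h ^ 2 :=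
          mul_le_mul_of_nonneg_left this (sq_nonneg h)
      _ = h ^ 4 := by ring

/-- Hölder continuity bounds the hat averages uniformly. -/
theorem ae_abs_hatAvg_sub_le (hu : StripRegular T K u) {h : ℝ} (hh : 0 ≤ h) :
    ∀ᵐ q ∂(stripMeasure T), |hatAvg h (u q.1) q.2 - u q.1 q.2| ≤ √(K * h) := by
  have h1 : ∀ᵐ r ∂(unitMeasure.prod unitMeasure), ∀ᵐ q ∂(stripMeasure T),
      |u q.1 (q.2 + h * (r.1 - r.2)) - u q.1 q.2| ≤ √(K * h) := by
    filter_upwards [ae_abs_hat_shift_le hh] with r hr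
    filter_upwards [hu.holder (h * (r.1 - r.2))] with q hq
    exact Real.abs_le_sqrt (hq.trans (mul_le_mul_of_nonneg_left hr hu.nonneg))
  have hm : Measurable fun z : (ℝ × ℝ) × (ℝ × ℝ) =>
      |u z.1.1 (z.1.2 + h * (z.2.1 - z.2.2)) - u z.1.1 z.1.2| := by
    have := hu.measurable_hatIntegrand h 0
    simp only [add_zero] at this
    exact (this.sub (hu.measurable.comp measurable_fst)).abs
  have hset : MeasurableSet {z : (ℝ × ℝ) × (ℝ × ℝ) |
      |u z.1.1 (z.1.2 + h * (z.2.1 - z.2.2)) - u z.1.1 z.1.2| ≤ √(K * h)} :=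
    measurableSet_le hm measurable_const
  have h2 := (Measure.ae_ae_comm (μ := stripMeasure T) (ν := unitMeasure.prod unitMeasure)
    hset).2 h1
  filter_upwards [h2] with q hq
  rw [hatAvg_sub_self (hu.measurable_slice _) (hu.abs_le _)]
  have := norm_integral_le_of_norm_le_const (μ := unitMeasure.prod unitMeasure)
    (f := fun r => u q.1 (q.2 + h * (r.1 - r.2)) - u q.1 q.2) hq
  simpa using this

theorem memLp_hatAvg (hu : StripRegular T K u) {h : ℝ} (hh : 0 ≤ h) :
    MemLp (fun q : ℝ × ℝ => hatAvg h (u q.1) q.2) 2 (stripMeasure T) := by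
  have := (hu.memLp_hatAvg_sub hh).1.add hu.memLp.1
  refine this.ae_eq (ae_of_all _ fun q => ?_)
  simp

end StripRegular

/-! ### Positivity -/

/-- The properties of the flux function `A(t,x,v)` of the equation `∂ₜ u = ½ ∂ₓₓ A(t,x,u)` that
the argument uses. It is continuous and vanishes at `v = 0`; for values of `v` in `[-R,R]` it is
Lipschitz in `v` and its oscillation in space is at most linear in `v`; and it is strongly
monotone in `v` as long as `v ≥ -2δ`. -/
structure FluxBounds (A : ℝ → ℝ → ℝ → ℝ) (R C c δ : ℝ) : Prop where
  C_nonneg : 0 ≤ C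
  c_pos : 0 < c
  δ_pos : 0 < δ
  continuous : Continuous fun q : ℝ × ℝ × ℝ => A q.1 q.2.1 q.2.2
  zero : ∀ t x, A t x 0 = 0
  lip : ∀ t x y v w, |v| ≤ R → |w| ≤ R → |A t x v - A t y w| ≤ C * (|x - y| * |v| + |v - w|)
  mono : ∀ t x v w, -(2 * δ) ≤ v → -(2 * δ) ≤ w →
    c * (v - w) ^ 2 ≤ (A t x v - A t x w) * (v - w)

section flux

variable {T K C c δ : ℝ} {u : ℝ → ℝ → ℝ} {B : ℝ → ℝ → ℝ → ℝ}

theorem FluxBounds.abs_le (hB : FluxBounds B K C c δ) {v : ℝ} (hv : |v| ≤ K) (t x : ℝ) :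
    |B t x v| ≤ C * |v| := by
  have := hB.lip t x x v 0 hv (by simpa using (abs_nonneg v).trans hv)
  simpa [hB.zero] using this

theorem FluxBounds.measurable_comp (hB : FluxBounds B K C c δ) (hu : StripRegular T K u) :
    Measurable (Function.uncurry fun t x => B t x (u t x)) :=
  hB.continuous.measurable.comp (measurable_fst.prodMk (measurable_snd.prodMk hu.measurable))

theorem FluxBounds.memLp_comp (hB : FluxBounds B K C c δ) (hu : StripRegular T K u) :
    MemLp (fun q : ℝ × ℝ => B q.1 q.2 (u q.1 q.2)) 2 (stripMeasure T) :=
  hu.memLp.1.of_le_mul (c := C) (hB.measurable_comp hu).aestronglyMeasurable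
    (ae_of_all _ fun q => hB.abs_le (hu.abs_le q.1 q.2) q.1 q.2)

theorem ae_ae_of_ae_strip {P : ℝ × ℝ → Prop} (h : ∀ᵐ q ∂(stripMeasure T), P q) :
    ∀ᵐ x : ℝ, ∀ᵐ t ∂(volume.restrict (Icc 0 T)), P (t, x) := by
  unfold stripMeasure at h
  have h1 := (Measure.measurePreserving_swap (μ := (volume : Measure ℝ))
    (ν := volume.restrict (Icc 0 T))).quasiMeasurePreserving.ae h
  exact Measure.ae_ae_of_ae_prod h1

theorem exp_weight_le_one {l t : ℝ} (hl : 0 ≤ l) (ht : 0 ≤ t) : Real.exp (-(l * t)) ≤ 1 :=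
  Real.exp_le_one_iff.2 (by nlinarith [mul_nonneg hl ht])

theorem integrable_weight_negEnergy {v : ℝ × ℝ → ℝ} (hδ : 0 < δ) (hv : MemLp v 2 (stripMeasure T))
    {l : ℝ} (hl : 0 ≤ l) :
    Integrable (fun q : ℝ × ℝ => Real.exp (-(l * q.1)) * negEnergy δ (v q)) (stripMeasure T) := by
  refine hv.integrable_sq.mono' ?_ ?_
  · have h1 : Continuous fun q : ℝ × ℝ => Real.exp (-(l * q.1)) := by fun_prop
    exact h1.aestronglyMeasurable.mul
      ((negEnergy_continuous δ).comp_aestronglyMeasurable hv.1)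
  · filter_upwards [ae_strip_time_mem T] with q hq
    have h0 := negEnergy_nonneg hδ (v q)
    rw [norm_mul, Real.norm_eq_abs, Real.abs_exp, Real.norm_eq_abs, abs_of_nonneg h0]
    exact (mul_le_of_le_one_left h0 (exp_weight_le_one hl hq.1)).trans (negEnergy_le_sq hδ _)

/-- The energy balance on the strip for the hat average `U` of a solution. -/
theorem weighted_energy_le (hT : 0 < T) (hδ : 0 < δ) {U p : ℝ → ℝ → ℝ} {U₀ : ℝ → ℝ}
    (hU : MemLp (fun q : ℝ × ℝ => U q.1 q.2) 2 (stripMeasure T))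
    (hpm : Measurable (Function.uncurry p)) {P : ℝ} (hpb : ∀ t x, |p t x| ≤ P)
    (hp : MemLp (fun q : ℝ × ℝ => p q.1 q.2) 2 (stripMeasure T)) (hU₀ : ∀ x, 0 ≤ U₀ x)
    {h l : ℝ} (hl : 0 ≤ l)
    (hev : ∀ᵐ q ∂(stripMeasure T), U q.1 q.2 =
      U₀ q.2 + (2 * h ^ 2)⁻¹ * ∫ s in Ioc 0 q.1, secondDiff h (p s) q.2) :
    l * ∫ q, Real.exp (-(l * q.1)) * negEnergy δ (U q.1 q.2) ∂(stripMeasure T) ≤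
      (2 * h ^ 2)⁻¹ * ∫ q, Real.exp (-(l * q.1)) * clipNeg δ (U q.1 q.2) *
        secondDiff h (p q.1) q.2 ∂(stripMeasure T) := by
  have hi1 := integrable_weight_negEnergy hδ hU hl
  have hκ : MemLp (fun q : ℝ × ℝ => Real.exp (-(l * q.1)) * clipNeg δ (U q.1 q.2)) 2
      (stripMeasure T) := by
    refine hU.of_le ?_ ?_
    · have h1 : Continuous fun q : ℝ × ℝ => Real.exp (-(l * q.1)) := by fun_prop
      exact h1.aestronglyMeasurable.mul
        ((clipNeg_continuous δ).comp_aestronglyMeasurable hU.1)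
    · filter_upwards [ae_strip_time_mem T] with q hq
      rw [norm_mul, Real.norm_eq_abs, Real.abs_exp]
      exact (mul_le_of_le_one_left (norm_nonneg _) (exp_weight_le_one hl hq.1)).trans
        (abs_clipNeg_le hδ _)
  have hi2 := (MemLp.integrable_mul_two hκ (MemLp.strip_secondDiff hp h)).const_mul (2 * h ^ 2)⁻¹
  have hi1' := hi1.const_mul l
  rw [← integral_const_mul, ← integral_const_mul]
  unfold stripMeasure at hi1' hi2 ⊢
  rw [integral_prod_symm _ hi1', integral_prod_symm _ hi2]
  refine integral_mono_ae hi1'.integral_prod_right hi2.integral_prod_right ?_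
  filter_upwards [ae_ae_of_ae_strip hev] with x hx
  have hnm : Measurable fun t => (2 * h ^ 2)⁻¹ * secondDiff h (p t) x :=
    ((measurable_secondDiff hpm h).comp measurable_prodMk_right).const_mul _
  have hnb : ∀ t, |(2 * h ^ 2)⁻¹ * secondDiff h (p t) x| ≤ (2 * h ^ 2)⁻¹ * (4 * P) := by
    intro t
    rw [abs_mul, abs_of_nonneg (by positivity : 0 ≤ (2 * h ^ 2)⁻¹)]
    exact mul_le_mul_of_nonneg_left (abs_secondDiff_le (hpb t) h x) (by positivity)
  have hn : IntervalIntegrable (fun t => (2 * h ^ 2)⁻¹ * secondDiff h (p t) x) volume 0 T :=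
    (intervalIntegrable_const (c := (2 * h ^ 2)⁻¹ * (4 * P))).mono_fun hnm.aestronglyMeasurable
      (ae_of_all _ fun t => (hnb t).trans (le_abs_self _))
  have key := negEnergy_weighted_le hδ hn hnb (hU₀ x) l
  rw [intervalIntegral.integral_of_le hT.le, intervalIntegral.integral_of_le hT.le,
    ← integral_Icc_eq_integral_Ioc, ← integral_Icc_eq_integral_Ioc] at key
  have hxe : ∀ᵐ t ∂(volume.restrict (Icc 0 T)),
      U₀ x + ∫ s in (0 : ℝ)..t, (2 * h ^ 2)⁻¹ * secondDiff h (p s) x = U t x := by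
    filter_upwards [hx, ae_restrict_mem measurableSet_Icc] with t ht htT
    rw [ht, intervalIntegral.integral_const_mul, intervalIntegral.integral_of_le htT.1]
  have e1 : ∫ t in Icc 0 T, Real.exp (-(l * t)) * negEnergy δ
      (U₀ x + ∫ s in (0 : ℝ)..t, (2 * h ^ 2)⁻¹ * secondDiff h (p s) x) =
      ∫ t in Icc 0 T, Real.exp (-(l * t)) * negEnergy δ (U t x) := by
    refine integral_congr_ae ?_
    filter_upwards [hxe] with t ht
    rw [ht]
  have e2 : ∫ t in Icc 0 T, Real.exp (-(l * t)) * clipNeg δ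
      (U₀ x + ∫ s in (0 : ℝ)..t, (2 * h ^ 2)⁻¹ * secondDiff h (p s) x) *
        ((2 * h ^ 2)⁻¹ * secondDiff h (p t) x) =
      ∫ t in Icc 0 T, (2 * h ^ 2)⁻¹ * (Real.exp (-(l * t)) * clipNeg δ (U t x) *
        secondDiff h (p t) x) := by
    refine integral_congr_ae ?_
    filter_upwards [hxe] with t ht
    rw [ht]
    ring
  rw [e1, e2, ← integral_const_mul] at key
  exact key

theorem integral_add_add_add {α : Type*} [MeasurableSpace α] {μ : Measure α} {f g k m : α → ℝ}
    (hf : Integrable f μ) (hg : Integrable g μ) (hk : Integrable k μ) (hm : Integrable m μ) :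
    ∫ x, (f x + g x + k x + m x) ∂μ =
      (∫ x, f x ∂μ) + (∫ x, g x ∂μ) + (∫ x, k x ∂μ) + ∫ x, m x ∂μ := by
  rw [← integral_add hf hg, ← integral_add _ hk, ← integral_add _ hm]
  · exact (hf.add hg).add hk
  · exact hf.add hg

/-- The weighted energy of the negative part of a hat average is at most of the order of the step
of the finite differences. The rate `l` of the weight is the constant of `energy_pointwise`: the
factor `1 / (2h²)` in front of the second difference turns the energy on the right-hand side into
`l / 2` times the weighted energy, and the left-hand side absorbs it. -/
theorem weighted_energy_hatAvg_le (hT : 0 < T) (hu : StripRegular T K u)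
    (hB : FluxBounds B K C c δ) {u₀ : ℝ → ℝ} (hu₀ : ∀ x, 0 ≤ u₀ x) {h : ℝ} (hh : 0 < h)
    (hh1 : h ≤ 1) (hhδ : √(K * h) ≤ δ / 2)
    (hev : ∀ᵐ q ∂(stripMeasure T), hatAvg h (u q.1) q.2 = hatAvg h u₀ q.2 +
      (2 * h ^ 2)⁻¹ * ∫ s in Ioc 0 q.1, secondDiff h (fun x => B s x (u s x)) q.2) {l : ℝ}
    (hl : l = C ^ 2 / (4 * c) * (4 + 4 * (1 + K / δ) ^ 2) + C ^ 2 + 1) :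
    ∫ q, Real.exp (-(l * q.1)) * negEnergy δ (hatAvg h (u q.1) q.2) ∂(stripMeasure T) ≤
      4 * K * h := by
  have hδ := hB.δ_pos
  have hc := hB.c_pos
  have hK := hu.nonneg
  have hl0 : 0 < l := by
    rw [hl]
    have : 0 ≤ C ^ 2 / (4 * c) * (4 + 4 * (1 + K / δ) ^ 2) := by positivity
    positivity
  have hUm := hu.memLp_hatAvg hh.le
  have hpb : ∀ t x, |B t x (u t x)| ≤ C * K := fun t x =>
    (hB.abs_le (hu.abs_le t x) t x).trans (mul_le_mul_of_nonneg_left (hu.abs_le t x) hB.C_nonneg)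
  have hp := hB.memLp_comp hu
  have h1 := weighted_energy_le hT hδ (U := fun t x => hatAvg h (u t) x)
    (p := fun t x => B t x (u t x)) hUm (hB.measurable_comp hu) hpb hp
    (hatAvg_nonneg hu₀ h) hl0.le hev
  have hF : MemLp (fun q : ℝ × ℝ => Real.exp (-(l * q.1)) * clipNeg δ (hatAvg h (u q.1) q.2)) 2
      (stripMeasure T) := by
    refine hUm.of_le ?_ ?_
    · have h1 : Continuous fun q : ℝ × ℝ => Real.exp (-(l * q.1)) := by fun_prop
      exact h1.aestronglyMeasurable.mul
        ((clipNeg_continuous δ).comp_aestronglyMeasurable hUm.1)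
    · filter_upwards [ae_strip_time_mem T] with q hq
      rw [norm_mul, Real.norm_eq_abs, Real.abs_exp]
      exact (mul_le_of_le_one_left (norm_nonneg _) (exp_weight_le_one hl0.le hq.1)).trans
        (abs_clipNeg_le hδ _)
  have h2 := integral_strip_mul_secondDiff
    (F := fun t x => Real.exp (-(l * t)) * clipNeg δ (hatAvg h (u t) x))
    (G := fun t x => B t x (u t x)) hF hp h
  set I := ∫ q, Real.exp (-(l * q.1)) * negEnergy δ (hatAvg h (u q.1) q.2) ∂(stripMeasure T)
    with hI
  obtain ⟨m0, b0⟩ := hu.memLp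
  obtain ⟨m1, b1⟩ := hu.memLp_diff h
  obtain ⟨m2, b2⟩ := hu.memLp_hatAvg_sub hh.le
  obtain ⟨m3, b3⟩ := hu.memLp_hatAvg_diff_sub hh.le
  have j0 := m0.integrable_sq
  have j1 := m1.integrable_sq
  have j2 := m2.integrable_sq
  have j3 := m3.integrable_sq
  have jI := integrable_weight_negEnergy hδ hUm hl0.le
  -- The pointwise estimate on the strip.
  have hpt : ∀ᵐ q ∂(stripMeasure T),
      -((Real.exp (-(l * q.1)) * clipNeg δ (hatAvg h (u q.1) (q.2 + h)) -
          Real.exp (-(l * q.1)) * clipNeg δ (hatAvg h (u q.1) q.2)) *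
        (B q.1 (q.2 + h) (u q.1 (q.2 + h)) - B q.1 q.2 (u q.1 q.2))) ≤
      l * h ^ 2 * (Real.exp (-(l * q.1)) * negEnergy δ (hatAvg h (u q.1) q.2)) +
        l * (h ^ 2 * (hatAvg h (u q.1) q.2 - u q.1 q.2) ^ 2 +
          h * (u q.1 (q.2 + h) - u q.1 q.2) ^ 2 +
          h⁻¹ * ((hatAvg h (u q.1) (q.2 + h) - hatAvg h (u q.1) q.2) -
            (u q.1 (q.2 + h) - u q.1 q.2)) ^ 2 + h ^ 3 * u q.1 q.2 ^ 2) := by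
    have s1 := hu.ae_abs_hatAvg_sub_le hh.le
    have s2 := (measurePreserving_strip_translate T h).quasiMeasurePreserving.ae s1
    filter_upwards [s1, s2, hu.holder h, ae_strip_time_mem T] with q q1 q2 q3 q4
    have q3' : |u q.1 (q.2 + h) - u q.1 q.2| ≤ δ / 2 := by
      refine (Real.abs_le_sqrt q3).trans ?_
      rwa [abs_of_pos hh]
    have hd := energy_pointwise (R := K) (C := C)
      (a := u q.1 q.2) (b := u q.1 (q.2 + h)) (Ua := hatAvg h (u q.1) q.2)
      (Ub := hatAvg h (u q.1) (q.2 + h))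
      (Y₁ := B q.1 (q.2 + h) (u q.1 (q.2 + h)) - B q.1 (q.2 + h) (u q.1 q.2))
      (Y₂ := B q.1 (q.2 + h) (u q.1 q.2) - B q.1 q.2 (u q.1 q.2)) hδ hc hK hh hh1
      (fun ha hb => hB.mono _ _ _ _ hb ha) ?_ ?_ q3' (q1.trans hhδ) (q2.trans hhδ)
      (abs_hatAvg_le (hu.abs_le q.1) h q.2)
    · rw [← hl, sub_add_sub_cancel] at hd
      have hw0 := (Real.exp_pos (-(l * q.1))).le
      have hw1 := exp_weight_le_one hl0.le q4.1
      have hd' := mul_le_mul_of_nonneg_left hd hw0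
      set w := Real.exp (-(l * q.1))
      set X := h ^ 2 * (hatAvg h (u q.1) q.2 - u q.1 q.2) ^ 2 +
          h * (u q.1 (q.2 + h) - u q.1 q.2) ^ 2 +
          h⁻¹ * ((hatAvg h (u q.1) (q.2 + h) - hatAvg h (u q.1) q.2) -
            (u q.1 (q.2 + h) - u q.1 q.2)) ^ 2 + h ^ 3 * u q.1 q.2 ^ 2 with hX
      have hX0 : 0 ≤ X := by positivity
      have e1 : w * (l * (h ^ 2 * negEnergy δ (hatAvg h (u q.1) q.2) +
          h ^ 2 * (hatAvg h (u q.1) q.2 - u q.1 q.2) ^ 2 +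
          h * (u q.1 (q.2 + h) - u q.1 q.2) ^ 2 +
          ((hatAvg h (u q.1) (q.2 + h) - hatAvg h (u q.1) q.2) -
            (u q.1 (q.2 + h) - u q.1 q.2)) ^ 2 / h + h ^ 3 * u q.1 q.2 ^ 2)) =
          l * h ^ 2 * (w * negEnergy δ (hatAvg h (u q.1) q.2)) + w * (l * X) := by
        rw [hX]
        ring
      rw [e1] at hd'
      refine le_trans (le_of_eq (by ring)) (hd'.trans (add_le_add le_rfl ?_))
      exact mul_le_of_le_one_left (mul_nonneg hl0.le hX0) hw1
    · have := hB.lip q.1 (q.2 + h) q.2 (u q.1 q.2) (u q.1 q.2) (hu.abs_le _ _) (hu.abs_le _ _)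
      rwa [sub_self, abs_zero, add_zero, add_sub_cancel_left, abs_of_pos hh] at this
    · have := hB.lip q.1 q.2 (q.2 + h) (u q.1 q.2) (u q.1 (q.2 + h)) (hu.abs_le _ _)
        (hu.abs_le _ _)
      rw [sub_add_cancel_left, abs_neg, abs_of_pos hh, abs_sub_comm,
        abs_sub_comm (u q.1 q.2)] at this
      rwa [sub_add_sub_cancel]
  have jE : Integrable (fun q : ℝ × ℝ => h ^ 2 * (hatAvg h (u q.1) q.2 - u q.1 q.2) ^ 2 +
          h * (u q.1 (q.2 + h) - u q.1 q.2) ^ 2 +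
          h⁻¹ * ((hatAvg h (u q.1) (q.2 + h) - hatAvg h (u q.1) q.2) -
            (u q.1 (q.2 + h) - u q.1 q.2)) ^ 2 + h ^ 3 * u q.1 q.2 ^ 2) (stripMeasure T) :=
    (((j2.const_mul _).add (j1.const_mul _)).add (j3.const_mul _)).add (j0.const_mul _)
  have hFh := MemLp.strip_translate (F := fun t x =>
    Real.exp (-(l * t)) * clipNeg δ (hatAvg h (u t) x)) hF h
  have hph := MemLp.strip_translate (F := fun t x => B t x (u t x)) hp h
  have h3 := integral_mono_ae (MemLp.integrable_mul_two (hFh.sub hF) (hph.sub hp)).neg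
    ((jI.const_mul (l * h ^ 2)).add (jE.const_mul l)) hpt
  have e3 : ∫ q, ((fun q : ℝ × ℝ => l * h ^ 2 * (Real.exp (-(l * q.1)) *
        negEnergy δ (hatAvg h (u q.1) q.2))) +
      fun q : ℝ × ℝ => l * (h ^ 2 * (hatAvg h (u q.1) q.2 - u q.1 q.2) ^ 2 +
          h * (u q.1 (q.2 + h) - u q.1 q.2) ^ 2 +
          h⁻¹ * ((hatAvg h (u q.1) (q.2 + h) - hatAvg h (u q.1) q.2) -
            (u q.1 (q.2 + h) - u q.1 q.2)) ^ 2 + h ^ 3 * u q.1 q.2 ^ 2)) q ∂(stripMeasure T) ≤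
      l * h ^ 2 * I + l * (4 * K * h ^ 3) := by
    rw [integral_add' (jI.const_mul (l * h ^ 2)) (jE.const_mul l), integral_const_mul,
      integral_const_mul]
    refine add_le_add le_rfl (mul_le_mul_of_nonneg_left ?_ hl0.le)
    rw [integral_add_add_add (j2.const_mul _) (j1.const_mul _) (j3.const_mul _)
      (j0.const_mul _), integral_const_mul, integral_const_mul, integral_const_mul,
      integral_const_mul]
    have g2 := mul_le_mul_of_nonneg_left b2 (sq_nonneg h)
    have g1 := mul_le_mul_of_nonneg_left b1 hh.le
    have g3 := mul_le_mul_of_nonneg_left b3 (inv_pos.2 hh).le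
    have g0 := mul_le_mul_of_nonneg_left b0 (by positivity : 0 ≤ h ^ 3)
    have g4 : h⁻¹ * (h ^ 4 * K) = h ^ 3 * K := by field_simp
    have g5 : h ^ 4 * K ≤ h ^ 3 * K :=
      mul_le_mul_of_nonneg_right (pow_le_pow_of_le_one hh.le hh1 (by norm_num)) hK
    rw [g4] at g3
    have g6 : h ^ 2 * (h ^ 2 * K) = h ^ 4 * K := by ring
    have g7 : h * (h ^ 2 * K) = h ^ 3 * K := by ring
    rw [g6] at g2
    rw [g7] at g1
    linarith
  have h4 := h3.trans e3
  simp only [Pi.neg_apply, Pi.sub_apply] at h4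
  rw [integral_neg] at h4
  rw [h2] at h1
  have h5 := h1.trans (mul_le_mul_of_nonneg_left h4 (by positivity : 0 ≤ (2 * h ^ 2)⁻¹))
  have e5 : (2 * h ^ 2)⁻¹ * (l * h ^ 2 * I + l * (4 * K * h ^ 3)) = l * (I / 2 + 2 * K * h) := by
    field_simp
    ring
  rw [e5] at h5
  have h6 := le_of_mul_le_mul_left h5 hl0
  linarith

/-- Solutions with nonnegative initial value are nonnegative: the weighted energy of the negative
part of the solution is `O(h)` for every step `h`, hence zero. -/
theorem ae_nonneg_of_evolution (hT : 0 < T) (hu : StripRegular T K u)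
    (hB : FluxBounds B K C c δ) {u₀ : ℝ → ℝ} (hu₀ : ∀ x, 0 ≤ u₀ x)
    (hev : ∀ h : ℝ, 0 < h → ∀ᵐ q ∂(stripMeasure T), hatAvg h (u q.1) q.2 = hatAvg h u₀ q.2 +
      (2 * h ^ 2)⁻¹ * ∫ s in Ioc 0 q.1, secondDiff h (fun x => B s x (u s x)) q.2) :
    ∀ᵐ q ∂(stripMeasure T), 0 ≤ u q.1 q.2 := by
  have hδ := hB.δ_pos
  have hK := hu.nonneg
  obtain ⟨l, hl⟩ : ∃ l, l = C ^ 2 / (4 * c) * (4 + 4 * (1 + K / δ) ^ 2) + C ^ 2 + 1 := ⟨_, rfl⟩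
  have hl0 : 0 ≤ l := by
    have := hB.c_pos
    rw [hl]
    positivity
  have ji := integrable_weight_negEnergy hδ hu.memLp.1 hl0
  have hle : ∀ᶠ h in 𝓝[>] (0 : ℝ),
      ∫ q, Real.exp (-(l * q.1)) * negEnergy δ (u q.1 q.2) ∂(stripMeasure T) ≤ 10 * K * h := by
    have hsmall : ∀ᶠ h in 𝓝[>] (0 : ℝ), √(K * h) ≤ δ / 2 := by
      have : Tendsto (fun h : ℝ => √(K * h)) (𝓝[>] 0) (𝓝 0) := by
        have h1 : Continuous fun h : ℝ => √(K * h) := by fun_prop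
        have h2 := h1.tendsto 0
        simp only [mul_zero, Real.sqrt_zero] at h2
        exact h2.mono_left nhdsWithin_le_nhds
      exact (this.eventually (gt_mem_nhds (half_pos hδ))).mono fun h hh => le_of_lt hh
    filter_upwards [hsmall, Ioc_mem_nhdsGT (zero_lt_one' ℝ)] with h h1 h2
    have hU := weighted_energy_hatAvg_le hT hu hB hu₀ h2.1 h2.2 h1 (hev h h2.1) hl
    have jU := integrable_weight_negEnergy hδ (hu.memLp_hatAvg h2.1.le) hl0
    obtain ⟨m2, b2⟩ := hu.memLp_hatAvg_sub h2.1.le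
    have h3 : ∫ q, Real.exp (-(l * q.1)) * negEnergy δ (u q.1 q.2) ∂(stripMeasure T) ≤
        ∫ q, (2 * (Real.exp (-(l * q.1)) * negEnergy δ (hatAvg h (u q.1) q.2)) +
          2 * (hatAvg h (u q.1) q.2 - u q.1 q.2) ^ 2) ∂(stripMeasure T) := by
      refine integral_mono_ae ji ((jU.const_mul 2).add (m2.integrable_sq.const_mul 2)) ?_
      filter_upwards [ae_strip_time_mem T] with q hq
      have h4 := mul_le_mul_of_nonneg_left
        (negEnergy_le_of_near hδ (u q.1 q.2) (hatAvg h (u q.1) q.2))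
        (Real.exp_pos (-(l * q.1))).le
      have h5 := mul_le_of_le_one_left (by positivity :
        0 ≤ 2 * (hatAvg h (u q.1) q.2 - u q.1 q.2) ^ 2) (exp_weight_le_one hl0 hq.1)
      linarith
    rw [integral_add (jU.const_mul 2) (m2.integrable_sq.const_mul 2), integral_const_mul,
      integral_const_mul] at h3
    have h6 : h ^ 2 * K ≤ h * K := by
      refine mul_le_mul_of_nonneg_right ?_ hK
      rw [sq]
      exact mul_le_of_le_one_left h2.1.le h2.2
    linarith
  have hlim : Tendsto (fun h : ℝ => 10 * K * h) (𝓝[>] 0) (𝓝 0) := by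
    have h1 : Continuous fun h : ℝ => 10 * K * h := by fun_prop
    have h2 := h1.tendsto 0
    simp only [mul_zero] at h2
    exact h2.mono_left nhdsWithin_le_nhds
  have h0 := ge_of_tendsto hlim hle
  have hnn : ∀ q : ℝ × ℝ, 0 ≤ Real.exp (-(l * q.1)) * negEnergy δ (u q.1 q.2) := fun q =>
    mul_nonneg (Real.exp_pos _).le (negEnergy_nonneg hδ _)
  have h1 := (integral_eq_zero_iff_of_nonneg hnn ji).1
    (le_antisymm h0 (integral_nonneg hnn))
  filter_upwards [h1] with q hq
  refine nonneg_of_negEnergy_le hδ (le_of_eq ?_)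
  exact (mul_eq_zero.1 hq).resolve_left (Real.exp_pos _).ne'

end flux

/-! ### Uniqueness of nonnegative solutions -/

/-- Integration in time preserves square integrability on the strip. -/
theorem memLp_integral_Ioc {T : ℝ} {g : ℝ → ℝ → ℝ} (hgm : Measurable (Function.uncurry g))
    (hg : MemLp (fun q : ℝ × ℝ => g q.1 q.2) 2 (stripMeasure T)) :
    MemLp (fun q : ℝ × ℝ => ∫ s in Ioc 0 q.1, g s q.2) 2 (stripMeasure T) := by
  have hGm := measurable_integral_Ioc hgm
  refine ⟨hGm.aestronglyMeasurable, ?_⟩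
  have hfin : ∫⁻ q, ‖g q.1 q.2‖ₑ ^ 2 ∂(stripMeasure T) < ⊤ := by
    rw [lintegral_enorm_sq_eq]
    exact ENNReal.pow_lt_top hg.2
  have hle : ∫⁻ q, ‖∫ s in Ioc 0 q.1, g s q.2‖ₑ ^ 2 ∂(stripMeasure T) ≤
      ENNReal.ofReal T * (ENNReal.ofReal T * ∫⁻ q, ‖g q.1 q.2‖ₑ ^ 2 ∂(stripMeasure T)) := by
    unfold stripMeasure
    rw [lintegral_prod_symm' _ (hGm.enorm.pow_const 2),
      lintegral_prod_symm' (fun q : ℝ × ℝ => ‖g q.1 q.2‖ₑ ^ 2) (hgm.enorm.pow_const 2),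
      ← lintegral_const_mul' _ _ (by simp), ← lintegral_const_mul' _ _ (by simp)]
    refine lintegral_mono fun x => ?_
    have h1 : ∀ᵐ t ∂(volume.restrict (Icc 0 T)), ‖∫ s in Ioc 0 t, g s x‖ₑ ^ 2 ≤
        ENNReal.ofReal T * ∫⁻ s in Icc 0 T, ‖g s x‖ₑ ^ 2 := by
      filter_upwards [ae_restrict_mem measurableSet_Icc] with t ht
      refine (enorm_integral_sq_le_mul
        (hgm.comp measurable_prodMk_right).aestronglyMeasurable).trans ?_
      refine mul_le_mul' ?_ (lintegral_mono_set fun s hs => ⟨hs.1.le, hs.2.trans ht.2⟩)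
      rw [Measure.restrict_apply_univ, Real.volume_Ioc]
      exact ENNReal.ofReal_le_ofReal (by linarith [ht.2])
    refine (lintegral_mono_ae h1).trans (le_of_eq ?_)
    rw [lintegral_const, Measure.restrict_apply_univ, Real.volume_Icc, sub_zero, mul_comm]
  have h2 := hle.trans_lt (ENNReal.mul_lt_top ENNReal.ofReal_lt_top
    (ENNReal.mul_lt_top ENNReal.ofReal_lt_top hfin))
  rw [lintegral_enorm_sq_eq] at h2
  exact (ENNReal.pow_lt_top_iff.1 h2).resolve_right (by norm_num)

/-- The integral is half the square of `∫₀ᵀ f`. -/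
theorem integral_mul_primitive_nonneg {T : ℝ} (hT : 0 ≤ T) {f : ℝ → ℝ}
    (hf : IntervalIntegrable f volume 0 T) :
    0 ≤ ∫ t in Icc 0 T, f t * ∫ s in Ioc 0 t, f s := by
  have hN : AbsolutelyContinuousOnInterval (fun t => ∫ s in (0 : ℝ)..t, f s) 0 T :=
    hf.absolutelyContinuousOnInterval_intervalIntegral (by simp)
  have h1 := hN.integral_deriv_mul_eq_sub hN
  have h2 : ∫ t in (0 : ℝ)..T, (deriv (fun t => ∫ s in (0 : ℝ)..t, f s) t *
        (∫ s in (0 : ℝ)..t, f s) + (∫ s in (0 : ℝ)..t, f s) *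
        deriv (fun t => ∫ s in (0 : ℝ)..t, f s) t) =
      2 * ∫ t in (0 : ℝ)..T, f t * ∫ s in Ioc 0 t, f s := by
    rw [← intervalIntegral.integral_const_mul]
    refine intervalIntegral.integral_congr_ae ?_
    filter_upwards [hf.ae_hasDerivAt_integral] with t ht h
    rw [(ht (uIoc_subset_uIcc h) 0 (by simp)).deriv]
    rw [uIoc_of_le hT] at h
    rw [intervalIntegral.integral_of_le h.1.le]
    ring
  rw [h2] at h1
  rw [integral_Icc_eq_integral_Ioc, ← intervalIntegral.integral_of_le hT]
  simp only [intervalIntegral.integral_same] at h1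
  nlinarith [mul_self_nonneg (∫ s in (0 : ℝ)..T, f s)]

/-- The quadratic form of the (discrete) Laplacian of a time integral is negative: this replaces
an energy estimate in `H⁻¹`. -/
theorem integral_mul_secondDiff_primitive_nonpos {T : ℝ} (hT : 0 ≤ T) {g : ℝ → ℝ → ℝ}
    (hgm : Measurable (Function.uncurry g)) {P : ℝ} (hgb : ∀ t x, |g t x| ≤ P)
    (hg : MemLp (fun q : ℝ × ℝ => g q.1 q.2) 2 (stripMeasure T)) (h : ℝ) :
    ∫ q, g q.1 q.2 * (∫ s in Ioc 0 q.1, secondDiff h (g s) q.2) ∂(stripMeasure T) ≤ 0 := by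
  have hG := memLp_integral_Ioc hgm hg
  have hi : ∀ t x, IntegrableOn (fun s => g s x) (Ioc 0 t) := fun t x =>
    Integrable.of_bound (C := P) (hgm.comp measurable_prodMk_right).aestronglyMeasurable
      (ae_of_all _ fun s => hgb s x)
  have e1 : ∀ q : ℝ × ℝ, ∫ s in Ioc 0 q.1, secondDiff h (g s) q.2 =
      secondDiff h (fun x => ∫ s in Ioc 0 q.1, g s x) q.2 := by
    intro q
    exact integral_sub_two_mul_add (hi _ _) (hi _ _) (hi _ _)
  simp_rw [e1]
  rw [integral_strip_mul_secondDiff (G := fun t x => ∫ s in Ioc 0 t, g s x) hg hG h,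
    neg_nonpos]
  have e2 : ∀ q : ℝ × ℝ, (∫ s in Ioc 0 q.1, g s (q.2 + h)) - (∫ s in Ioc 0 q.1, g s q.2) =
      ∫ s in Ioc 0 q.1, (g s (q.2 + h) - g s q.2) := fun q =>
    (integral_sub (hi _ _) (hi _ _)).symm
  have hint := MemLp.integrable_mul_two ((MemLp.strip_translate hg h).sub hg)
    ((MemLp.strip_translate (F := fun t x => ∫ s in Ioc 0 t, g s x) hG h).sub hG)
  simp only [Pi.sub_apply, e2] at hint
  simp_rw [e2]
  unfold stripMeasure at hint ⊢
  rw [integral_prod_symm _ hint]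
  refine integral_nonneg fun x => ?_
  refine integral_mul_primitive_nonneg hT (f := fun t => g t (x + h) - g t x) ?_
  refine (intervalIntegrable_const (c := P + P)).mono_fun
    ((hgm.comp measurable_prodMk_right).sub
      (hgm.comp measurable_prodMk_right)).aestronglyMeasurable (ae_of_all _ fun t => ?_)
  exact ((abs_sub _ _).trans (add_le_add (hgb _ _) (hgb _ _))).trans (le_abs_self _)

theorem StripRegular.mono {T K K' : ℝ} {u : ℝ → ℝ → ℝ} (hu : StripRegular T K u) (hK : K ≤ K') :
    StripRegular T K' u where
  nonneg := hu.nonneg.trans hK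
  measurable := hu.measurable
  abs_le t x := (hu.abs_le t x).trans hK
  sq_le := hu.sq_le.trans (ENNReal.ofReal_le_ofReal hK)
  diff_le a := (hu.diff_le a).trans
    (ENNReal.ofReal_le_ofReal (mul_le_mul_of_nonneg_left hK (sq_nonneg a)))
  diff_diff_le a b := (hu.diff_diff_le a b).trans
    (ENNReal.ofReal_le_ofReal (mul_le_mul_of_nonneg_left hK (by positivity)))
  holder a := (hu.holder a).mono fun q hq => hq.trans (mul_le_mul_of_nonneg_right hK (abs_nonneg a))

/-- Two nonnegative solutions with the same initial value agree. The difference `g` of the fluxes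
is tested against the difference of the hat averages: the equation makes the result nonpositive,
while for `h → 0` it tends to the integral of `g (u₁ - u₂) ≥ c (u₁ - u₂)²`. -/
theorem ae_eq_of_evolution {T K C c δ : ℝ} {u₁ u₂ : ℝ → ℝ → ℝ} {B : ℝ → ℝ → ℝ → ℝ} (hT : 0 < T)
    (hu₁ : StripRegular T K u₁) (hu₂ : StripRegular T K u₂) (hB : FluxBounds B K C c δ)
    (hpos₁ : ∀ᵐ q ∂(stripMeasure T), 0 ≤ u₁ q.1 q.2)
    (hpos₂ : ∀ᵐ q ∂(stripMeasure T), 0 ≤ u₂ q.1 q.2) {u₀ : ℝ → ℝ}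
    (hev₁ : ∀ h : ℝ, 0 < h → ∀ᵐ q ∂(stripMeasure T), hatAvg h (u₁ q.1) q.2 = hatAvg h u₀ q.2 +
      (2 * h ^ 2)⁻¹ * ∫ s in Ioc 0 q.1, secondDiff h (fun x => B s x (u₁ s x)) q.2)
    (hev₂ : ∀ h : ℝ, 0 < h → ∀ᵐ q ∂(stripMeasure T), hatAvg h (u₂ q.1) q.2 = hatAvg h u₀ q.2 +
      (2 * h ^ 2)⁻¹ * ∫ s in Ioc 0 q.1, secondDiff h (fun x => B s x (u₂ s x)) q.2) :
    ∀ᵐ q ∂(stripMeasure T), u₁ q.1 q.2 = u₂ q.1 q.2 := by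
  have hδ := hB.δ_pos
  have hc := hB.c_pos
  set g : ℝ → ℝ → ℝ := fun t x => B t x (u₁ t x) - B t x (u₂ t x) with hgdef
  have hm₁ := hB.measurable_comp hu₁
  have hm₂ := hB.measurable_comp hu₂
  have hgm : Measurable (Function.uncurry g) := hm₁.sub hm₂
  have hpb : ∀ {u : ℝ → ℝ → ℝ}, StripRegular T K u → ∀ t x, |B t x (u t x)| ≤ C * K :=
    fun hu t x => (hB.abs_le (hu.abs_le t x) t x).trans
      (mul_le_mul_of_nonneg_left (hu.abs_le t x) hB.C_nonneg)
  have hgb : ∀ t x, |g t x| ≤ C * K + C * K := fun t x =>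
    (abs_sub _ _).trans (add_le_add (hpb hu₁ t x) (hpb hu₂ t x))
  have hg : MemLp (fun q : ℝ × ℝ => g q.1 q.2) 2 (stripMeasure T) :=
    (hB.memLp_comp hu₁).sub (hB.memLp_comp hu₂)
  have hw : MemLp (fun q : ℝ × ℝ => u₁ q.1 q.2 - u₂ q.1 q.2) 2 (stripMeasure T) :=
    hu₁.memLp.1.sub hu₂.memLp.1
  set J := ∫ q, g q.1 q.2 ^ 2 ∂(stripMeasure T) with hJ
  have hle : ∀ᶠ h in 𝓝[>] (0 : ℝ),
      ∫ q, c * (u₁ q.1 q.2 - u₂ q.1 q.2) ^ 2 ∂(stripMeasure T) ≤ (2 * K + J / 2) * h := by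
    filter_upwards [self_mem_nhdsWithin] with h hh
    rw [mem_Ioi] at hh
    obtain ⟨n1, b1⟩ := hu₁.memLp_hatAvg_sub hh.le
    obtain ⟨n2, b2⟩ := hu₂.memLp_hatAvg_sub hh.le
    have hS : MemLp (fun q : ℝ × ℝ => hatAvg h (u₁ q.1) q.2 - hatAvg h (u₂ q.1) q.2) 2
        (stripMeasure T) := (hu₁.memLp_hatAvg hh.le).sub (hu₂.memLp_hatAvg hh.le)
    have hSg := MemLp.integrable_mul_two hS hg
    have hevd : ∀ᵐ q ∂(stripMeasure T), (hatAvg h (u₁ q.1) q.2 - hatAvg h (u₂ q.1) q.2) *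
        g q.1 q.2 = (2 * h ^ 2)⁻¹ * (g q.1 q.2 * ∫ s in Ioc 0 q.1, secondDiff h (g s) q.2) := by
      filter_upwards [hev₁ h hh, hev₂ h hh] with q h1 h2
      have hi : ∀ {u : ℝ → ℝ → ℝ}, StripRegular T K u →
          IntegrableOn (fun s => secondDiff h (fun x => B s x (u s x)) q.2) (Ioc 0 q.1) :=
        fun {u} hu => Integrable.of_bound (C := 4 * (C * K))
          ((measurable_secondDiff (p := fun t x => B t x (u t x)) (hB.measurable_comp hu) h).comp
            measurable_prodMk_right).aestronglyMeasurable
          (ae_of_all _ fun s => abs_secondDiff_le (hpb hu s) h q.2)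
      have e : ∫ s in Ioc 0 q.1, secondDiff h (g s) q.2 =
          (∫ s in Ioc 0 q.1, secondDiff h (fun x => B s x (u₁ s x)) q.2) -
            ∫ s in Ioc 0 q.1, secondDiff h (fun x => B s x (u₂ s x)) q.2 := by
        rw [← integral_sub (hi hu₁) (hi hu₂)]
        congr 1 with s
        simp only [secondDiff, hgdef]
        ring
      rw [h1, h2, e]
      ring
    have hneg : ∫ q, (hatAvg h (u₁ q.1) q.2 - hatAvg h (u₂ q.1) q.2) * g q.1 q.2
        ∂(stripMeasure T) ≤ 0 := by
      rw [integral_congr_ae hevd, integral_const_mul]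
      exact mul_nonpos_of_nonneg_of_nonpos (by positivity)
        (integral_mul_secondDiff_primitive_nonpos hT.le hgm hgb hg h)
    have hmono : ∫ q, c * (u₁ q.1 q.2 - u₂ q.1 q.2) ^ 2 ∂(stripMeasure T) ≤
        ∫ q, (h⁻¹ * (hatAvg h (u₁ q.1) q.2 - u₁ q.1 q.2) ^ 2 +
          h⁻¹ * (hatAvg h (u₂ q.1) q.2 - u₂ q.1 q.2) ^ 2 + h / 2 * g q.1 q.2 ^ 2 +
          (hatAvg h (u₁ q.1) q.2 - hatAvg h (u₂ q.1) q.2) * g q.1 q.2) ∂(stripMeasure T) := by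
      refine integral_mono_ae (hw.integrable_sq.const_mul c)
        ((((n1.integrable_sq.const_mul _).add (n2.integrable_sq.const_mul _)).add
          (hg.integrable_sq.const_mul _)).add hSg) ?_
      filter_upwards [hpos₁, hpos₂] with q q1 q2
      have hm := hB.mono q.1 q.2 (u₁ q.1 q.2) (u₂ q.1 q.2) (by linarith) (by linarith)
      change c * (u₁ q.1 q.2 - u₂ q.1 q.2) ^ 2 ≤ _
      refine hm.trans ?_
      change g q.1 q.2 * (u₁ q.1 q.2 - u₂ q.1 q.2) ≤ _
      set r₁ := hatAvg h (u₁ q.1) q.2 - u₁ q.1 q.2 with hr₁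
      set r₂ := hatAvg h (u₂ q.1) q.2 - u₂ q.1 q.2 with hr₂
      have e : u₁ q.1 q.2 - u₂ q.1 q.2 =
          (hatAvg h (u₁ q.1) q.2 - hatAvg h (u₂ q.1) q.2) + (r₂ - r₁) := by
        rw [hr₁, hr₂]
        ring
      rw [e, mul_add, mul_comm (g q.1 q.2) (hatAvg h (u₁ q.1) q.2 - hatAvg h (u₂ q.1) q.2)]
      -- Young's inequality with weight `h`: the averaging errors are `O(h²)` in squared `L²` norm.
      have hy : g q.1 q.2 * (r₂ - r₁) ≤
          h⁻¹ * r₁ ^ 2 + h⁻¹ * r₂ ^ 2 + h / 2 * g q.1 q.2 ^ 2 := by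
        have h1 : h⁻¹ * r₁ ^ 2 + h⁻¹ * r₂ ^ 2 + h / 2 * g q.1 q.2 ^ 2 - g q.1 q.2 * (r₂ - r₁) =
            h⁻¹ / 2 * ((r₂ - r₁ - h * g q.1 q.2) ^ 2 + (r₁ + r₂) ^ 2) := by
          field_simp
          ring
        have h2 : 0 ≤ h⁻¹ / 2 * ((r₂ - r₁ - h * g q.1 q.2) ^ 2 + (r₁ + r₂) ^ 2) := by positivity
        linarith
      linarith
    rw [integral_add_add_add (n1.integrable_sq.const_mul _) (n2.integrable_sq.const_mul _)
      (hg.integrable_sq.const_mul _) hSg, integral_const_mul h⁻¹, integral_const_mul h⁻¹,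
      integral_const_mul (h / 2), ← hJ] at hmono
    have e : h⁻¹ * (h ^ 2 * K) = h * K := by field_simp
    have g1 := mul_le_mul_of_nonneg_left b1 (inv_pos.2 hh).le
    have g2 := mul_le_mul_of_nonneg_left b2 (inv_pos.2 hh).le
    rw [e] at g1 g2
    linarith
  have hlim : Tendsto (fun h : ℝ => (2 * K + J / 2) * h) (𝓝[>] 0) (𝓝 0) := by
    have h1 : Continuous fun h : ℝ => (2 * K + J / 2) * h := by fun_prop
    have h2 := h1.tendsto 0
    simp only [mul_zero] at h2
    exact h2.mono_left nhdsWithin_le_nhds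
  have h0 := ge_of_tendsto hlim hle
  have hnn : ∀ q : ℝ × ℝ, 0 ≤ c * (u₁ q.1 q.2 - u₂ q.1 q.2) ^ 2 := fun q => by positivity
  have h1 := (integral_eq_zero_iff_of_nonneg hnn (hw.integrable_sq.const_mul c)).1
    (le_antisymm h0 (integral_nonneg hnn))
  filter_upwards [h1] with q hq
  have h2 := (mul_eq_zero.1 hq).resolve_left hc.ne'
  exact sub_eq_zero.1 (pow_eq_zero_iff (two_ne_zero) |>.1 h2)

/-! ### The flux function of the driver -/

/-- The flux `h⁻¹(t,x,v)² v` of the equation. The time variable is projected onto `[0,T]`, so that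
the flux is defined and continuous for all times. -/
noncomputable def driverFlux (T : ℝ) (h : ℝ → ℝ → ℝ → ℝ) (t x v : ℝ) : ℝ :=
  driverInv h (max 0 (min t T)) x v ^ 2 * v

namespace DriverAssumptions

variable {T c_h c₀ C₀ M : ℝ} {h : ℝ → ℝ → ℝ → ℝ} {u₀ : ℝ → ℝ}

theorem apply_driverInv (hh : DriverAssumptions T h u₀ c_h c₀ C₀ M) {t : ℝ} (ht : t ∈ Icc 0 T)
    (x v : ℝ) : h t x (driverInv h t x v) = v :=
  Function.invFun_eq ((hh.continuous t ht x).surjective (hh.tendsto_atTop t ht x)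
    (hh.tendsto_atBot t ht x) v)

theorem driverInv_mono (hh : DriverAssumptions T h u₀ c_h c₀ C₀ M) {t : ℝ} (ht : t ∈ Icc 0 T)
    (x : ℝ) {v w : ℝ} (hvw : v ≤ w) : driverInv h t x v ≤ driverInv h t x w := by
  rw [← (hh.strictMono t ht x).le_iff_le, hh.apply_driverInv ht, hh.apply_driverInv ht]
  exact hvw

theorem mul_abs_sub_le (hh : DriverAssumptions T h u₀ c_h c₀ C₀ M) {t : ℝ} (ht : t ∈ Icc 0 T)
    (x z w : ℝ) : c_h * |z - w| ≤ |h t x z - h t x w| := by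
  obtain ⟨_, _, hz, ⟨_, hp⟩, -⟩ := hh.partials
  have hd : Differentiable ℝ (h t x) := fun w => (hp t ht x w).2.2.1.differentiableAt
  have key : ∀ {z w}, w ≤ z → c_h * |z - w| ≤ |h t x z - h t x w| := fun {z w} hzw => by
    rw [abs_of_nonneg (sub_nonneg.2 hzw)]
    exact (mul_sub_le_image_sub_of_le_deriv hd (hh.le_deriv t ht x) hzw).trans (le_abs_self _)
  rcases le_total w z with hzw | hzw
  · exact key hzw
  · rw [abs_sub_comm z, abs_sub_comm (h t x z)]
    exact key hzw

/-- The inverse of the driver is Lipschitz in all variables. -/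
theorem exists_driverInv_lipschitz (hh : DriverAssumptions T h u₀ c_h c₀ C₀ M) :
    ∃ L : ℝ, 0 ≤ L ∧ ∀ t ∈ Icc 0 T, ∀ s ∈ Icc 0 T, ∀ x y v w : ℝ,
      |driverInv h t x v - driverInv h s y w| ≤
        L * (|t - s| + |x - y|) + |v - w| / c_h := by
  obtain ⟨L, hL⟩ := hh.lipschitz
  have hc := hh.c_h_pos
  refine ⟨|L| / c_h, by positivity, fun t ht s hs x y v w => ?_⟩
  have h1 := hh.mul_abs_sub_le ht x (driverInv h t x v) (driverInv h s y w)
  have h2 := hL s hs t ht y x (driverInv h s y w) (driverInv h s y w)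
  rw [hh.apply_driverInv ht] at h1
  rw [hh.apply_driverInv hs, sub_self, abs_zero, add_zero, abs_sub_comm s, abs_sub_comm y] at h2
  have h3 : L * (|t - s| + |x - y|) ≤ |L| * (|t - s| + |x - y|) :=
    mul_le_mul_of_nonneg_right (le_abs_self L) (by positivity)
  have h4 := abs_sub_le v w (h t x (driverInv h s y w))
  have e : |L| / c_h * (|t - s| + |x - y|) + |v - w| / c_h =
      (|L| * (|t - s| + |x - y|) + |v - w|) / c_h := by ring
  rw [e, le_div_iff₀ hc]
  linarith

/-- The inverse of the driver stays positive for slightly negative densities: it is at least `c₀`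
at `v = 0` and grows at most at rate `1 / c_h`. -/
theorem le_driverInv (hh : DriverAssumptions T h u₀ c_h c₀ C₀ M) {t : ℝ} (ht : t ∈ Icc 0 T)
    (x : ℝ) {v : ℝ} (hv : -(c₀ * c_h / 8) ≤ v) : 7 / 8 * c₀ ≤ driverInv h t x v := by
  have hc := hh.c_h_pos
  have h0 := (hh.basal t ht x).1
  have hc0 := hh.c₀_pos
  rcases le_total 0 v with hv0 | hv0
  · have := hh.driverInv_mono ht x hv0
    linarith
  · have h1 := hh.mul_abs_sub_le ht x (driverInv h t x 0) (driverInv h t x v)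
    rw [hh.apply_driverInv ht, hh.apply_driverInv ht, zero_sub, abs_neg, abs_of_nonpos hv0] at h1
    have h2 := le_abs_self (driverInv h t x 0 - driverInv h t x v)
    have h3 : c_h * (driverInv h t x 0 - driverInv h t x v) ≤ c_h * (c₀ / 8) := by
      have := mul_le_mul_of_nonneg_left h2 hc.le
      linarith
    have := le_of_mul_le_mul_left h3 hc
    linarith

/-- Strong monotonicity of the flux, where the factor `v` may be slightly negative because the
growth of `h⁻¹` in `v` is controlled by `1 / c_h`. -/
theorem driverFlux_mono (hh : DriverAssumptions T h u₀ c_h c₀ C₀ M) {t : ℝ} (ht : t ∈ Icc 0 T)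
    (x : ℝ) {v w : ℝ} (hv : -(c₀ * c_h / 8) ≤ v) (hw : -(c₀ * c_h / 8) ≤ w) :
    c₀ ^ 2 / 8 * (v - w) ^ 2 ≤
      (driverInv h t x v ^ 2 * v - driverInv h t x w ^ 2 * w) * (v - w) := by
  wlog hwv : w ≤ v generalizing v w
  · have := this hw hv (le_of_not_ge hwv)
    linarith
  have hc := hh.c_h_pos
  have hc0 := hh.c₀_pos
  have ha := hh.le_driverInv ht x hv
  have hb := hh.le_driverInv ht x hw
  have hab := hh.driverInv_mono ht x hwv
  have hlip := hh.mul_abs_sub_le ht x (driverInv h t x v) (driverInv h t x w)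
  rw [hh.apply_driverInv ht, hh.apply_driverInv ht, abs_of_nonneg (sub_nonneg.2 hab),
    abs_of_nonneg (sub_nonneg.2 hwv)] at hlip
  set a := driverInv h t x v
  set b := driverInv h t x w
  have hd : 0 ≤ v - w := sub_nonneg.2 hwv
  have key : c₀ ^ 2 / 8 * (v - w) ≤ a ^ 2 * v - b ^ 2 * w := by
    have e : a ^ 2 * v - b ^ 2 * w = a ^ 2 * (v - w) + (a - b) * (a + b) * w := by ring
    have ha2 : c₀ ^ 2 / 8 ≤ a * (a - c₀ / 4) := by nlinarith
    have h1 := mul_le_mul_of_nonneg_right ha2 hd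
    have hp : 0 ≤ (a - b) * (a + b) :=
      mul_nonneg (sub_nonneg.2 hab) (by linarith)
    rcases le_total 0 w with hw0 | hw0
    · have h2 := mul_nonneg hp hw0
      have h3 : 0 ≤ a * (c₀ / 4) * (v - w) := mul_nonneg (by nlinarith) hd
      nlinarith
    · have h2 : (a - b) * (a + b) * (-w) ≤ (a - b) * (a + b) * (c₀ * c_h / 8) :=
        mul_le_mul_of_nonneg_left (by linarith) hp
      have h3 : c_h * (a - b) * (a + b) ≤ (v - w) * (2 * a) :=
        mul_le_mul hlip (by linarith) (by linarith) hd
      have h4 := mul_le_mul_of_nonneg_left h3 (by linarith : 0 ≤ c₀ / 8)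
      nlinarith
  have := mul_le_mul_of_nonneg_right key hd
  linarith

theorem fluxBounds_driverFlux (hh : DriverAssumptions T h u₀ c_h c₀ C₀ M) (hT : 0 ≤ T) {R : ℝ}
    (hR : 0 ≤ R) : ∃ C, FluxBounds (driverFlux T h) R C (c₀ ^ 2 / 8) (c₀ * c_h / 16) := by
  obtain ⟨L, hL0, hL⟩ := hh.exists_driverInv_lipschitz
  have hc := hh.c_h_pos
  have hc0 := hh.c₀_pos
  have hτ : ∀ t : ℝ, max 0 (min t T) ∈ Icc 0 T := fun t =>
    ⟨le_max_left _ _, max_le hT (min_le_right _ _)⟩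
  have hC0 : 0 ≤ C₀ := by
    have := hh.basal 0 ⟨le_rfl, hT⟩ 0
    linarith
  obtain ⟨Z, hZ⟩ : ∃ Z, Z = C₀ + R / c_h := ⟨_, rfl⟩
  have hZ0 : 0 ≤ Z := by rw [hZ]; positivity
  have hzb : ∀ t ∈ Icc 0 T, ∀ x v, |v| ≤ R → |driverInv h t x v| ≤ Z := by
    intro t ht x v hv
    have h1 := hL t ht t ht x x v 0
    rw [sub_self, sub_self, abs_zero, add_zero, mul_zero, zero_add, sub_zero] at h1
    have h2 := hh.basal t ht x
    have h3 := abs_sub_abs_le_abs_sub (driverInv h t x v) (driverInv h t x 0)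
    rw [abs_of_nonneg (hc0.le.trans h2.1)] at h3
    have h4 : |v| / c_h ≤ R / c_h := div_le_div_of_nonneg_right hv hc.le
    linarith
  have hcont : Continuous fun q : ℝ × ℝ × ℝ => driverInv h (max 0 (min q.1 T)) q.2.1 q.2.2 := by
    refine continuous_iff_continuousAt.2 fun q₀ => tendsto_iff_dist_tendsto_zero.2 ?_
    refine squeeze_zero (fun _ => dist_nonneg)
      (fun q => hL _ (hτ q.1) _ (hτ q₀.1) q.2.1 q₀.2.1 q.2.2 q₀.2.2) ?_
    have h1 : Continuous fun q : ℝ × ℝ × ℝ =>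
        L * (|max 0 (min q.1 T) - max 0 (min q₀.1 T)| + |q.2.1 - q₀.2.1|) +
          |q.2.2 - q₀.2.2| / c_h := by fun_prop
    simpa using h1.tendsto q₀
  refine ⟨2 * Z * L + Z ^ 2 + 2 * Z * R / c_h, ?_⟩
  refine ⟨by positivity, by positivity, by positivity, ?_, fun t x => by simp [driverFlux], ?_, ?_⟩
  · exact (hcont.pow 2).mul (continuous_snd.comp continuous_snd)
  · intro t x y v w hv hw
    unfold driverFlux
    have ha := hzb _ (hτ t) x v hv
    have hb := hzb _ (hτ t) y w hw
    have hl := hL _ (hτ t) _ (hτ t) x y v w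
    rw [sub_self, abs_zero, zero_add] at hl
    set a := driverInv h (max 0 (min t T)) x v
    set b := driverInv h (max 0 (min t T)) y w
    have e : a ^ 2 * v - b ^ 2 * w = (a - b) * (a + b) * v + b ^ 2 * (v - w) := by ring
    have hab : |a + b| ≤ 2 * Z := (abs_add_le a b).trans (by linarith)
    have hb2 : b ^ 2 ≤ Z ^ 2 := sq_le_sq' (abs_le.1 hb).1 (abs_le.1 hb).2
    have h1 : |(a - b) * (a + b) * v| ≤ (L * |x - y| + |v - w| / c_h) * (2 * Z) * |v| := by
      rw [abs_mul, abs_mul]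
      exact mul_le_mul_of_nonneg_right (mul_le_mul hl hab (abs_nonneg _) (by positivity))
        (abs_nonneg _)
    have h2 : |b ^ 2 * (v - w)| ≤ Z ^ 2 * |v - w| := by
      rw [abs_mul, abs_of_nonneg (sq_nonneg b)]
      exact mul_le_mul_of_nonneg_right hb2 (abs_nonneg _)
    have h3 : |v - w| / c_h * (2 * Z) * |v| ≤ |v - w| / c_h * (2 * Z) * R :=
      mul_le_mul_of_nonneg_left hv (by positivity)
    have h4 := abs_add_le ((a - b) * (a + b) * v) (b ^ 2 * (v - w))
    have h5 : 0 ≤ (Z ^ 2 + 2 * Z * R / c_h) * (|x - y| * |v|) := by positivity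
    have h6 : 0 ≤ 2 * Z * L * |v - w| := by positivity
    rw [e]
    calc _ ≤ L * |x - y| * (2 * Z) * |v| + |v - w| / c_h * (2 * Z) * R + Z ^ 2 * |v - w| := by
          linarith
      _ = 2 * Z * L * (|x - y| * |v|) + (Z ^ 2 + 2 * Z * R / c_h) * |v - w| := by ring
      _ ≤ _ := by linarith
  · intro t x v w hv hw
    exact hh.driverFlux_mono (hτ t) x (by linarith) (by linarith)

end DriverAssumptions

/-! ### Conclusion -/

/-- The evolution of the hat averages for the bounded measurable representative `v` of a weak
solution `u`. -/
theorem IsWeakSolution.hatAvg_evolution {T K N C c δ : ℝ} (hT : 0 < T) {h : ℝ → ℝ → ℝ → ℝ}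
    {u₀ v₀ : ℝ → ℝ} {u v : ℝ → ℝ → ℝ} (hu : IsWeakSolution T h u₀ u) (hv : StripRegular T K v)
    (huv : ∀ᵐ t ∂(volume.restrict (Icc 0 T)), ∀ᵐ x, u t x = v t x)
    (hB : FluxBounds (driverFlux T h) K C c δ) (hv₀ : Measurable v₀) (hN : ∀ x, |v₀ x| ≤ N)
    (hu₀ : ∀ᵐ x, u₀ x = v₀ x) (r : ℝ) (hr : 0 < r) :
    ∀ᵐ q ∂(stripMeasure T), hatAvg r (v q.1) q.2 = hatAvg r v₀ q.2 +
      (2 * r ^ 2)⁻¹ * ∫ s in Ioc 0 q.1, secondDiff r (fun x => driverFlux T h s x (v s x)) q.2 := by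
  refine _root_.hatAvg_evolution (K := max K (max (C * K) N)) hT
    (p := fun t x => driverFlux T h t x (v t x)) hv.measurable
    (fun t x => (hv.abs_le t x).trans (le_max_left _ _)) (hB.measurable_comp hv)
    (fun t x => ?_) hv₀ (fun x => (hN x).trans ((le_max_right _ _).trans (le_max_right _ _)))
    (fun φ h1 h2 h3 => ?_) hr
  · exact ((hB.abs_le (hv.abs_le t x) t x).trans
      (mul_le_mul_of_nonneg_left (hv.abs_le t x) hB.C_nonneg)).trans
      ((le_max_left _ _).trans (le_max_right _ _))
  · have key := hu.2 φ h1 h2 h3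
    have e1 : ∫ t in Icc 0 T, ∫ x, v t x * deriv (fun s => φ s x) t =
        ∫ t in Icc 0 T, ∫ x, u t x * deriv (fun s => φ s x) t := by
      refine integral_congr_ae ?_
      filter_upwards [huv] with t ht
      refine integral_congr_ae ?_
      filter_upwards [ht] with x hx
      rw [hx]
    have e2 : ∫ x, v₀ x * φ 0 x = ∫ x, u₀ x * φ 0 x := by
      refine integral_congr_ae ?_
      filter_upwards [hu₀] with x hx
      rw [hx]
    have e3 : ∫ t in Icc 0 T, ∫ x, driverFlux T h t x (v t x) * iteratedDeriv 2 (φ t) x =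
        ∫ t in Icc 0 T, ∫ x, driverInv h t x (u t x) ^ 2 * u t x * iteratedDeriv 2 (φ t) x := by
      refine integral_congr_ae ?_
      filter_upwards [huv, ae_restrict_mem measurableSet_Icc] with t ht htT
      refine integral_congr_ae ?_
      filter_upwards [ht] with x hx
      rw [hx, driverFlux, min_eq_left htT.2, max_eq_right htT.1]
    rw [e1, e2, e3]
    exact key

/-- This allows to assume that the initial density is Borel measurable and that its bounds hold
everywhere. -/
theorem exists_measurable_nonneg_representative {f : ℝ → ℝ} (hf : MemLp f ∞ volume)
    (h0 : ∀ᵐ x, 0 ≤ f x) : ∃ (g : ℝ → ℝ) (N : ℝ), Measurable g ∧ (∀ x, 0 ≤ g x) ∧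
      (∀ x, |g x| ≤ N) ∧ ∀ᵐ x, f x = g x := by
  obtain ⟨N, hN⟩ : ∃ N : ℝ, N = (eLpNorm f ⊤ volume).toReal := ⟨_, rfl⟩
  have hN0 : 0 ≤ N := hN ▸ ENNReal.toReal_nonneg
  have hg0 : ∀ x, 0 ≤ max 0 (min N (hf.1.mk f x)) := fun x => le_max_left _ _
  refine ⟨fun x => max 0 (min N (hf.1.mk f x)), N, ?_, hg0, fun x => ?_, ?_⟩
  · exact measurable_const.max (measurable_const.min hf.1.stronglyMeasurable_mk.measurable)
  · rw [abs_of_nonneg (hg0 x)]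
    exact max_le hN0 (min_le_left _ _)
  · filter_upwards [h0, hf.1.ae_eq_mk, ae_le_eLpNormEssSup (f := f) (μ := volume)] with x h1 h2 h3
    have h4 : f x ≤ N := by
      rw [← eLpNorm_exponent_top] at h3
      have h5 := ENNReal.toReal_mono hf.2.ne h3
      rw [toReal_enorm, ← hN] at h5
      exact (le_abs_self _).trans h5
    rw [← h2, min_eq_right h4, max_eq_right h1]

theorem mainTheorem4 (T : ℝ) (hT : 0 < T) (h : ℝ → ℝ → ℝ → ℝ) (u₀ : ℝ → ℝ)
    (c_h c₀ C₀ M : ℝ)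
    (hu₀_nonneg : ∀ᵐ x ∂(volume : Measure ℝ), 0 ≤ u₀ x)
    (hu₀_H1 : MemH1 u₀) (hu₀_bdd : MemLp u₀ ∞ volume)
    (hh : DriverAssumptions T h u₀ c_h c₀ C₀ M)
    (u₁ u₂ : ℝ → ℝ → ℝ)
    (hu₁ : IsWeakSolution T h u₀ u₁) (hu₂ : IsWeakSolution T h u₀ u₂) :
    ∀ᵐ p ∂(stripMeasure T), u₁ p.1 p.2 = u₂ p.1 p.2 := by
  obtain ⟨v₀, N, hv₀, hv₀_nonneg, hN, hu₀⟩ :=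
    exists_measurable_nonneg_representative hu₀_bdd hu₀_nonneg
  obtain ⟨K₁, v₁, hv₁, huv₁, huv₁'⟩ := hu₁.1.exists_stripRegular
  obtain ⟨K₂, v₂, hv₂, huv₂, huv₂'⟩ := hu₂.1.exists_stripRegular
  replace hv₁ := hv₁.mono (le_max_left K₁ K₂)
  replace hv₂ := hv₂.mono (le_max_right K₁ K₂)
  obtain ⟨C, hB⟩ := hh.fluxBounds_driverFlux hT.le hv₁.nonneg
  have hev₁ := hu₁.hatAvg_evolution hT hv₁ huv₁' hB hv₀ hN hu₀
  have hev₂ := hu₂.hatAvg_evolution hT hv₂ huv₂' hB hv₀ hN hu₀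
  have hpos₁ := ae_nonneg_of_evolution hT hv₁ hB hv₀_nonneg hev₁
  have hpos₂ := ae_nonneg_of_evolution hT hv₂ hB hv₀_nonneg hev₂
  have heq := ae_eq_of_evolution hT hv₁ hv₂ hB hpos₁ hpos₂ hev₁ hev₂
  filter_upwards [huv₁, huv₂, heq] with q h1 h2 h3
  rw [h1, h2, h3]
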